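/- **Setting.** Let $B\in\mathbb R^{d_C\times d_\mu}$, $D\in\mathbb R^{d_C\times d_\delta}$ and $d_n\in\mathbb R^{d_C}$ $(n\ge1)$ be known. For each $n$ let $\mathcal F_n$ be a set of joint distributions $F$ of estimators $(\overline\mu_n,\overline\Pi_n,\overline\Omega_n,\widehat\Upsilon_n)$, with true values $\mu_F\in\mathbb R^{d_\mu}$, $\Pi_F\in\mathbb R^{d_\mu\times d_\delta}$ (which may also depend on $n$). Put $C_F=B\Pi_F+D$, $b_F=d_n-B\mu_F$, $\overline C_n=B\overline\Pi_n+D$, $\mathcal F_{n0}=\{F\in\mathcal F_n: C_F\delta\le b_F\text{ for some }\delta\}$ and $\delta^*_F=\operatorname{argmin}_{C_F\delta\le b_F}\|\delta\|$. Assume that $\mathcal F_{n0}\ne\emptyset$ for all $n\ge1$, that $\overline\Omega_n$ is symmetric almost surely under every $F\in\mathcal F_{n0}$, and that $0<\alpha<1/2$. Write $\mathrm{poly}(C,b)=\{\delta:C\delta\le b\}$, $\mathrm{ppoly}(B,d;C)=\{\mu: B\mu+C\delta\le d\text{ for some }\delta\}$, $I_K$ for the selection of the rows in $K$, $\Sigma(\Omega,\delta)=\binom{I}{\delta\otimes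 I}'\Omega\binom{I}{\delta\otimes I}$, and $\|a\|_\Sigma=(a'\Sigma a)^{1/2}$. **The refined GCC test.** Let $\widetilde\mu_n$ minimize $n(\overline\mu_n-\mu)'\widehat\Upsilon_n(\overline\mu_n-\mu)$ over $\mathrm{ppoly}(B,d_n;\overline C_n)$, let $\widetilde\delta_n$ be the minimum norm point of $\mathrm{poly}(\overline C_n,d_n-B\widetilde\mu_n)$, and let $\widetilde\Sigma_n=\Sigma(\overline\Omega_n,\widetilde\delta_n)$. Let $T_n=\min_{B\mu+\overline C_n\delta\le d_n}n(\overline\mu_n-\mu)'\widetilde\Sigma_n^{-1}(\overline\mu_n-\mu)$ and, whenever $\widetilde\Sigma_n$ is positive definite, let $(\widehat\mu_n,\widehat\delta_n)$ be any minimizer. Let $\widehat K=\{j:(B\widehat\mu_n+\overline C_n\widehat\delta_n)_j=(d_n)_j\}$, $\widehat s_n=\mathrm{rk}(I_{\widehat K}[B,D])-\mathrm{rk}(I_{\widehat K}\overline C_n)$, and let $\widehat r_n$ be the maximal number of linearly independent elements of $B'\{h\ge0:h'\overline C_n=0,\ h'(B\widehat\mu_n-d_n)=0\}$. Let $cv(s,p)$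 be the $1-p$ quantile of $\chi^2_s$ ($\chi^2_0$ is the point mass at $0$). If $\widehat s_n=\widehat r_n=1$, take any matrix $H$ with finitely many rows such that $H\overline C_n=0$ and $\mathrm{ppoly}(B,d_n;\overline C_n)=\{\mu:A\mu\le g\}$, where $A=HB$ has rows $a_j'$ and $g=Hd_n$, take any $\bar j$ with $a_{\bar j}'\widehat\mu_n=g_{\bar j}$ and $a_{\bar j}\ne0$, and set $\widehat\beta_n=2\alpha\Phi(\inf_{j\ne\bar j}\tau_j)$, where $\Phi$ is the standard normal distribution function ($\Phi(\infty)=1$, $\inf\emptyset=\infty$) and $$\tau_j=\frac{\sqrt n\,\|a_{\bar j}\|_{\widetilde\Sigma_n}(g_j-a_j'\widehat\mu_n)}{\|a_{\bar j}\|_{\widetilde\Sigma_n}\|a_j\|_{\widetilde\Sigma_n}-a_{\bar j}'\widetilde\Sigma_na_j}$$ if the denominator is positive, $\tau_j=\infty$ otherwise. In all other cases $\widehat\beta_n=\alpha$. The test rejects if $T_n>cv(\widehat s_n,\widehat\beta_n)$. **Assumption 1.** For all sequences $F_n\in\mathcal F_{n0}$ and all subsequences there are a further subsequence $n_q$ and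 $\mu_\infty,d_\infty,\Pi_\infty$, a positive semidefinite $\Omega_\infty$ and a positive definite $\Upsilon_\infty$ such that, along $n_q$ and under $F_{n_q}$: (i) $\mu_{F_{n_q}}\to\mu_\infty$, $\Pi_{F_{n_q}}\to\Pi_\infty$, $d_{n_q}\to d_\infty$; (ii) $\sqrt{n_q}\,\bigl((\overline\mu_{n_q}-\mu_{F_{n_q}})',\mathrm{vec}(\overline\Pi_{n_q}-\Pi_{F_{n_q}})'\bigr)'\to_dN(0,\Omega_\infty)$; (iii) $\Sigma(\Omega_\infty,\delta^*_\infty)$ is positive definite, where $\delta^*_\infty$ is the minimum norm point of $\mathrm{poly}(C_\infty,b_\infty)$, $C_\infty=B\Pi_\infty+D$, $b_\infty=d_\infty-B\mu_\infty$; (iv) $\overline\Omega_{n_q}\to_p\Omega_\infty$; (v) $\widehat\Upsilon_{n_q}\to_p\Upsilon_\infty$; (vi) $\mathrm{poly}(C_\infty,b_\infty)\ne\emptyset$. **Assumption 2.** Let $K^=$ be the set of indices $j$ of inequalities that come from an equality, that is, for which some row $j'$ of $B$, of $D$ and of every $d_n$ is the negative of row $j$. For all sequences $F_n\in\mathcal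 F_{n0}$ and all subsequences satisfying 1(i) with limits $(\mu_\infty,d_\infty,\Pi_\infty)$, there is a further subsequence along which $P_{F_{n_q}}(\mathrm{rk}(I_K\overline C_{n_q})=\mathrm{rk}(I_KC_{F_{n_q}})=\mathrm{rk}(I_KC_\infty))\to1$ for every $K\supseteq K^=$ such that, for some $x$, $C_\infty x\le b_\infty$ with equality in all rows in $K$. **Activatable sets.** For $b\in(-\infty,\infty]^{d_C}$, the minimal activatable set of $\mathrm{poly}(C,b)$ is the intersection over $\delta\in\mathrm{poly}(C,b)$ of the sets of rows in which $C\delta\le b$ holds with equality. For $h\in[0,\infty]^{d_C}$ and positive definite $\Sigma$, let $\mu(x)$ minimize $(x-\mu)'\Sigma^{-1}(x-\mu)$ over $\mathrm{ppoly}(B,h;C)$, and let $K^\dagger(x)$ be the minimal activatable set of $\mathrm{poly}(C,h-B\mu(x))$. Let $\mathcal K(B,C,h)$ be the collection of the sets $K^\dagger(x)$, $x\in\mathbb R^{d_\mu}$, and $\mathcal L(B,C,h)$ the collection of the sets $\{j:\psi_j>0\}$ over all $x$ and all $\psi\ge0$ with $2\Sigma^{-1}(\mu(x)-x)+B'\psi=0$,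 $C'\psi=0$, and $\psi_j=0$ for $j\notin K^\dagger(x)$. (Neither collection depends on $\Sigma$.) **Assumption 3.** For all sequences $F_n\in\mathcal F_{n0}$ and all subsequences satisfying 1(i) with limits such that $\mathrm{poly}(C_\infty,b_\infty)\neq\emptyset$, there is a further subsequence along which $P_{F_{n_q}}(\mathrm{rk}(I_K\overline C_{n_q})=\mathrm{rk}(I_KC_{F_{n_q}})=\mathrm{rk}(I_KC_\infty))\to1$ for $K$ the minimal activatable set of $\mathrm{poly}(C_\infty,b_\infty)$. **Assumption 4.** For all sequences $F_n\in\mathcal F_{n0}$ and all subsequences $n_m$ satisfying 1(i) and $\sqrt{n_m}(d_{n_m}-B\mu_{F_{n_m}}-C_{F_{n_m}}\delta^*_{F_{n_m}})\to h_\infty$ elementwise for some $h_\infty\in[0,\infty]^{d_C}$, there is a further subsequence along which $P_{F_{n_q}}(\mathrm{rk}(I_K\overline C_{n_q})=\mathrm{rk}(I_KC_\infty))\to1$ for all $K\in\mathcal K(B,C_\infty,h_\infty)\cup\mathcal L(B,C_\infty,h_\infty)$. **Theorem.** Suppose that Assumptions 1 and 2 hold, or that Assumptions 1, 3 and 4 hold.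 Then $\widehat\beta_n\in[\alpha,2\alpha]$ whenever $\widetilde\Sigma_n$ is positive definite, and $$\limsup_{n\to\infty}\ \sup_{F\in\mathcal F_{n0}}P_F\bigl(T_n>cv(\widehat s_n,\widehat\beta_n)\bigr)\le\alpha .$$ -/

import Mathlib

open MeasureTheory ProbabilityTheory Filter Topology Matrix

noncomputable section

namespace GCC

/-! ### Linear algebra, polyhedra and projections -/

/-- Euclidean norm of a coordinate vector. -/
def eNorm {k : ℕ} (x : Fin k → ℝ) : ℝ := ‖(WithLp.toLp 2 x : EuclideanSpace ℝ (Fin k))‖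

/-- The quadratic form `x' W x`. -/
def quad {k : ℕ} (W : Matrix (Fin k) (Fin k) ℝ) (x : Fin k → ℝ) : ℝ := x ⬝ᵥ (W *ᵥ x)

/-- `rk(I_K C)`: the rank of the submatrix of `C` formed by the rows in `K`. -/
def rowRank {m : ℕ} {ι : Type*} [Fintype ι] (C : Matrix (Fin m) ι ℝ) (K : Set (Fin m)) : ℕ :=
  (C.submatrix (Subtype.val : K → Fin m) id).rank

/-- `poly(C, b) = {x : C x ≤ b}`. -/
def poly {m k : ℕ} (C : Matrix (Fin m) (Fin k) ℝ) (b : Fin m → ℝ) : Set (Fin k → ℝ) :=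
  {x | C *ᵥ x ≤ b}

/-- `ppoly(B, d; C) = {μ : B μ + C δ ≤ d for some δ}`. -/
def ppoly {m p k : ℕ} (B : Matrix (Fin m) (Fin p) ℝ) (d : Fin m → ℝ)
    (C : Matrix (Fin m) (Fin k) ℝ) : Set (Fin p → ℝ) :=
  {μ | ∃ δ : Fin k → ℝ, B *ᵥ μ + C *ᵥ δ ≤ d}

/-- `argmin_{δ ∈ S} ‖δ‖`; the minimizer is unique for nonempty closed convex `S`. -/
def minNormPoint {k : ℕ} (S : Set (Fin k → ℝ)) : Fin k → ℝ :=
  Classical.epsilon fun δ => δ ∈ S ∧ ∀ δ' ∈ S, eNorm δ ≤ eNorm δ'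

/-- Extended-real vector associated with a real vector. -/
def toE {m : ℕ} (b : Fin m → ℝ) : Fin m → EReal := fun j => ((b j : ℝ) : EReal)

/-- `poly(C, b)` when entries of `b` may be infinite. -/
def polyE {m k : ℕ} (C : Matrix (Fin m) (Fin k) ℝ) (b : Fin m → EReal) : Set (Fin k → ℝ) :=
  {x | ∀ j, (((C *ᵥ x) j : ℝ) : EReal) ≤ b j}

/-- The vector `h - B μ`, where entries of `h` may be infinite. -/
def shiftE {m p : ℕ} (B : Matrix (Fin m) (Fin p) ℝ) (h : Fin m → EReal) (μ : Fin p → ℝ) :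
    Fin m → EReal :=
  fun j => h j - (((B *ᵥ μ) j : ℝ) : EReal)

/-- `ppoly(B, h; C)` when entries of `h` may be infinite. -/
def ppolyE {m p k : ℕ} (B : Matrix (Fin m) (Fin p) ℝ) (h : Fin m → EReal)
    (C : Matrix (Fin m) (Fin k) ℝ) : Set (Fin p → ℝ) :=
  {μ | ∃ δ : Fin k → ℝ, ∀ j, (((B *ᵥ μ + C *ᵥ δ) j : ℝ) : EReal) ≤ h j}

/-! ### Activatable sets of inequalities -/

/-- `𝒜(C, b)`: sets of inequalities that can be simultaneously active (others may be too). -/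
def simActive {m k : ℕ} (C : Matrix (Fin m) (Fin k) ℝ) (b : Fin m → ℝ) : Set (Set (Fin m)) :=
  {K | ∃ x : Fin k → ℝ, C *ᵥ x ≤ b ∧ ∀ j ∈ K, (C *ᵥ x) j = b j}

/-- `J` is exactly the set of inequalities active at some point of `poly(C, b)`. -/
def Activatable {m k : ℕ} (C : Matrix (Fin m) (Fin k) ℝ) (b : Fin m → EReal)
    (J : Set (Fin m)) : Prop :=
  ∃ δ ∈ polyE C b, J = {j | (((C *ᵥ δ) j : ℝ) : EReal) = b j}

/-- The minimal activatable set of `poly(C, b)`: the intersection of all activatable sets. -/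
def minActivatable {m k : ℕ} (C : Matrix (Fin m) (Fin k) ℝ) (b : Fin m → EReal) :
    Set (Fin m) :=
  ⋂₀ {J | Activatable C b J}

/-- `μ` is the `μ`-part of a solution of `min (x - μ)' S⁻¹ (x - μ)` over `B μ + C δ ≤ h`. -/
def IsProjection {m p k : ℕ} (S : Matrix (Fin p) (Fin p) ℝ) (B : Matrix (Fin m) (Fin p) ℝ)
    (C : Matrix (Fin m) (Fin k) ℝ) (h : Fin m → EReal) (x μ : Fin p → ℝ) : Prop :=
  μ ∈ ppolyE B h C ∧ ∀ μ' ∈ ppolyE B h C, quad S⁻¹ (x - μ) ≤ quad S⁻¹ (x - μ')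

/-- `ψ` is a vector of KKT multipliers for the projection of `x`, with projection `μ`, that
vanishes off `K`. -/
def IsMultiplier {m p k : ℕ} (S : Matrix (Fin p) (Fin p) ℝ) (B : Matrix (Fin m) (Fin p) ℝ)
    (C : Matrix (Fin m) (Fin k) ℝ) (x μ : Fin p → ℝ) (K : Set (Fin m)) (ψ : Fin m → ℝ) : Prop :=
  (2 : ℝ) • (S⁻¹ *ᵥ (μ - x)) + Bᵀ *ᵥ ψ = 0 ∧ Cᵀ *ᵥ ψ = 0 ∧ 0 ≤ ψ ∧ ∀ j ∉ K, ψ j = 0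

/-- `𝒦(B, C, h)`: the collection, over all `x`, of the minimal activatable sets of
`poly(C, h - B μ(x))`. The collection is the same for every positive definite weight matrix
`S`, so that the quantifier over `S` does not change it. -/
def kActivatable {m p k : ℕ} (B : Matrix (Fin m) (Fin p) ℝ) (C : Matrix (Fin m) (Fin k) ℝ)
    (h : Fin m → EReal) : Set (Set (Fin m)) :=
  {K | ∃ (S : Matrix (Fin p) (Fin p) ℝ) (x μ : Fin p → ℝ), S.PosDef ∧
    IsProjection S B C h x μ ∧ K = minActivatable C (shiftE B h μ)}

/-- `ℒ(B, C, h)`: the collection, over all `x`, of the supports of the KKT multipliers that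
vanish off the minimal activatable set. Again this does not depend on `S`. -/
def lActivatable {m p k : ℕ} (B : Matrix (Fin m) (Fin p) ℝ) (C : Matrix (Fin m) (Fin k) ℝ)
    (h : Fin m → EReal) : Set (Set (Fin m)) :=
  {L | ∃ (S : Matrix (Fin p) (Fin p) ℝ) (x μ : Fin p → ℝ) (ψ : Fin m → ℝ), S.PosDef ∧
    IsProjection S B C h x μ ∧
    IsMultiplier S B C x μ (minActivatable C (shiftE B h μ)) ψ ∧ L = {j | 0 < ψ j}}

/-! ### Critical values -/

/-- The chi-squared distribution with `s` degrees of freedom (the point mass at zero if `s = 0`). -/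
def chiSq (s : ℕ) : Measure ℝ :=
  (Measure.pi fun _ : Fin s => gaussianReal 0 1).map fun x => ∑ i, x i ^ 2

/-- `cv(s, p)`: the `1 - p` quantile of the chi-squared distribution with `s` degrees of freedom. -/
def cv (s : ℕ) (p : ℝ) : ℝ := sInf {x : ℝ | 1 - p ≤ cdf (chiSq s) x}

/-- The standard normal distribution function, with value one at `⊤`. -/
def stdNormalCdf (t : EReal) : ℝ := (gaussianReal 0 1).real {x : ℝ | (x : EReal) ≤ t}

/-! ### Inactivity of inequalities -/

/-- `‖a‖_S = (a' S a)^{1/2}`. -/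
def wNorm {k : ℕ} (S : Matrix (Fin k) (Fin k) ℝ) (a : Fin k → ℝ) : ℝ := √(quad S a)

/-- The inactivity of the `j`-th inequality of `A μ ≤ g` at `x`, relative to the row `i`. -/
def tauRow {a p : ℕ} (n : ℕ) (S : Matrix (Fin p) (Fin p) ℝ) (A : Matrix (Fin a) (Fin p) ℝ)
    (g : Fin a → ℝ) (x : Fin p → ℝ) (i j : Fin a) : EReal :=
  open Classical in
  if 0 < wNorm S (A i) * wNorm S (A j) - A i ⬝ᵥ (S *ᵥ A j) then
    ((√(n : ℝ) * wNorm S (A i) * (g j - A j ⬝ᵥ x) /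
      (wNorm S (A i) * wNorm S (A j) - A i ⬝ᵥ (S *ᵥ A j)) : ℝ) : EReal)
  else ⊤

/-- The smallest inactivity of the inequalities other than the reference row `i`. -/
def tau {a p : ℕ} (n : ℕ) (S : Matrix (Fin p) (Fin p) ℝ) (A : Matrix (Fin a) (Fin p) ℝ)
    (g : Fin a → ℝ) (x : Fin p → ℝ) (i : Fin a) : EReal :=
  ⨅ j : {j : Fin a // j ≠ i}, tauRow n S A g x i j

/-! ### Estimators and the model -/

/-- Index set of the vector `(μ', vec(Π)')'`; the entry `(j, i)` of `vec(Π)` is `Π i j`. -/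
abbrev VecIdx (dμ dδ : ℕ) : Type := Fin dμ ⊕ (Fin dδ × Fin dμ)

/-- Values of the estimators: the estimator of `μ`, the estimator of `Π`, the estimator of the
asymptotic variance matrix `Ω` and the preliminary weight matrix `Υ`. -/
abbrev Est (dμ dδ : ℕ) : Type :=
  (Fin dμ → ℝ) × (Fin dμ → Fin dδ → ℝ) × (VecIdx dμ dδ → VecIdx dμ dδ → ℝ) ×
    (Fin dμ → Fin dμ → ℝ)

def Est.mu {dμ dδ : ℕ} (e : Est dμ dδ) : Fin dμ → ℝ := e.1

def Est.Pi {dμ dδ : ℕ} (e : Est dμ dδ) : Matrix (Fin dμ) (Fin dδ) ℝ := Matrix.of e.2.1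

def Est.Omega {dμ dδ : ℕ} (e : Est dμ dδ) : Matrix (VecIdx dμ dδ) (VecIdx dμ dδ) ℝ :=
  Matrix.of e.2.2.1

def Est.Upsilon {dμ dδ : ℕ} (e : Est dμ dδ) : Matrix (Fin dμ) (Fin dμ) ℝ := Matrix.of e.2.2.2

/-- The joint distributions of the estimators. -/
abbrev Law (dμ dδ : ℕ) : Type := ProbabilityMeasure (Est dμ dδ)

/-- The vector `(μ', vec(Π)')'`. -/
def stackVec {dμ dδ : ℕ} (μ : Fin dμ → ℝ) (P : Matrix (Fin dμ) (Fin dδ) ℝ) :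
    EuclideanSpace ℝ (VecIdx dμ dδ) :=
  WithLp.toLp 2 (Sum.elim μ fun q => P q.2 q.1)

/-- The matrix `(I ; δ ⊗ I)` (stacked vertically). -/
def loading {dμ dδ : ℕ} (δ : Fin dδ → ℝ) : Matrix (VecIdx dμ dδ) (Fin dμ) ℝ :=
  Matrix.fromRows 1 (Matrix.of fun q i => δ q.1 * (1 : Matrix (Fin dμ) (Fin dμ) ℝ) q.2 i)

/-- `(I ; δ ⊗ I)' Ω (I ; δ ⊗ I)`. -/
def sandwich {dμ dδ : ℕ} (Ω : Matrix (VecIdx dμ dδ) (VecIdx dμ dδ) ℝ) (δ : Fin dδ → ℝ) :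
    Matrix (Fin dμ) (Fin dμ) ℝ :=
  (loading δ : Matrix (VecIdx dμ dδ) (Fin dμ) ℝ)ᵀ * Ω * (loading δ : Matrix (VecIdx dμ dδ) (Fin dμ) ℝ)

/-- The known matrices `B` and `D`, the sequence of known vectors `d n`, the parameter spaces
`ℱ n` of joint distributions of the estimators at sample size `n`, and the true values `μ_F` and
`Π_F`, which may depend on `n`. -/
structure Model (dC dμ dδ : ℕ) where
  B : Matrix (Fin dC) (Fin dμ) ℝ
  D : Matrix (Fin dC) (Fin dδ) ℝ
  d : ℕ → Fin dC → ℝ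
  laws : ℕ → Set (Law dμ dδ)
  muF : ℕ → Law dμ dδ → Fin dμ → ℝ
  PiF : ℕ → Law dμ dδ → Matrix (Fin dμ) (Fin dδ) ℝ

namespace Model

variable {dC dμ dδ : ℕ} (M : Model dC dμ dδ)

/-- `C = B Π + D`. -/
def CMat (P : Matrix (Fin dμ) (Fin dδ) ℝ) : Matrix (Fin dC) (Fin dδ) ℝ := M.B * P + M.D

/-- `C_F = B Π_F + D`. -/
def CF (n : ℕ) (F : Law dμ dδ) : Matrix (Fin dC) (Fin dδ) ℝ := M.CMat (M.PiF n F)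

/-- `b_F = d_n - B μ_F`. -/
def bF (n : ℕ) (F : Law dμ dδ) : Fin dC → ℝ := M.d n - M.B *ᵥ M.muF n F

/-- `ℱ_{n0}`: the distributions in `ℱ_n` that satisfy the null hypothesis. -/
def null (n : ℕ) : Set (Law dμ dδ) :=
  {F | F ∈ M.laws n ∧ ∃ δ : Fin dδ → ℝ, M.CF n F *ᵥ δ ≤ M.bF n F}

/-- The minimum norm `δ` with `C_F δ ≤ b_F`. -/
def deltaStar (n : ℕ) (F : Law dμ dδ) : Fin dδ → ℝ := minNormPoint (poly (M.CF n F) (M.bF n F))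

/-- The indices of the inequalities that belong to an equality, that is, to a pair of opposing
inequalities. -/
def eqIdx : Set (Fin dC) :=
  {j | ∃ j' : Fin dC, M.B j' = -M.B j ∧ M.D j' = -M.D j ∧ ∀ n, 1 ≤ n → M.d n j' = -M.d n j}

/-! ### The refined test -/

/-- The estimator of `C`. -/
def Cbar (e : Est dμ dδ) : Matrix (Fin dC) (Fin dδ) ℝ := M.CMat e.Pi

/-- The preliminary restricted estimator of `μ`. -/
def muTilde (n : ℕ) (e : Est dμ dδ) : Fin dμ → ℝ :=
  Classical.epsilon fun μ => μ ∈ ppoly M.B (M.d n) (M.Cbar e) ∧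
    ∀ μ' ∈ ppoly M.B (M.d n) (M.Cbar e),
      (n : ℝ) * quad e.Upsilon (e.mu - μ) ≤ (n : ℝ) * quad e.Upsilon (e.mu - μ')

/-- The preliminary restricted estimator of `δ`, of minimum norm. -/
def deltaTilde (n : ℕ) (e : Est dμ dδ) : Fin dδ → ℝ :=
  minNormPoint (poly (M.Cbar e) (M.d n - M.B *ᵥ M.muTilde n e))

/-- The estimator of the asymptotic variance matrix. -/
def sigmaTilde (n : ℕ) (e : Est dμ dδ) : Matrix (Fin dμ) (Fin dμ) ℝ :=
  sandwich e.Omega (M.deltaTilde n e)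

/-- The objective function of the QLR statistic. -/
def objective (n : ℕ) (e : Est dμ dδ) (μ : Fin dμ → ℝ) : ℝ :=
  (n : ℝ) * quad (M.sigmaTilde n e)⁻¹ (e.mu - μ)

/-- The QLR statistic. -/
def T (n : ℕ) (e : Est dμ dδ) : ℝ :=
  sInf {t | ∃ (μ : Fin dμ → ℝ) (δ : Fin dδ → ℝ),
    M.B *ᵥ μ + M.Cbar e *ᵥ δ ≤ M.d n ∧ t = M.objective n e μ}

/-- `(μ, δ)` solves the minimization problem that defines the QLR statistic. -/
def IsSolution (n : ℕ) (e : Est dμ dδ) (μ : Fin dμ → ℝ) (δ : Fin dδ → ℝ) : Prop :=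
  M.B *ᵥ μ + M.Cbar e *ᵥ δ ≤ M.d n ∧
    ∀ (μ' : Fin dμ → ℝ) (δ' : Fin dδ → ℝ), M.B *ᵥ μ' + M.Cbar e *ᵥ δ' ≤ M.d n →
      M.objective n e μ ≤ M.objective n e μ'

/-- The set of inequalities that are active at `(μ, δ)`. -/
def activeSet (n : ℕ) (e : Est dμ dδ) (μ : Fin dμ → ℝ) (δ : Fin dδ → ℝ) : Set (Fin dC) :=
  {j | (M.Cbar e *ᵥ δ) j = (M.d n - M.B *ᵥ μ) j}

/-- The degrees of freedom `rk(I_K [B, D]) - rk(I_K C)`, with `K` the active set and `C` the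
estimator. The second rank never exceeds the first. -/
def sHat (n : ℕ) (e : Est dμ dδ) (μ : Fin dμ → ℝ) (δ : Fin dδ → ℝ) : ℕ :=
  rowRank (Matrix.fromCols M.B M.D) (M.activeSet n e μ δ) -
    rowRank (M.Cbar e) (M.activeSet n e μ δ)

/-- The maximal number of linearly independent elements of
`B' {h ≥ 0 : h' C = 0, h' (B μ - d) = 0}`, with `C` the estimator. -/
def rHat (n : ℕ) (e : Est dμ dδ) (μ : Fin dμ → ℝ) : ℕ :=
  Set.finrank ℝ ((fun h : Fin dC → ℝ => M.Bᵀ *ᵥ h) ''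
    {h | 0 ≤ h ∧ h ᵥ* M.Cbar e = 0 ∧ h ⬝ᵥ (M.B *ᵥ μ - M.d n) = 0})

/-- `β` is a refined level computed from the solution `(μ, δ)`. If both degrees of freedom are one,
it is `2 α Φ(τ)` for some representation `{A μ ≤ g}`, `A = H B`, `g = H d`, `H C = 0`, of the
projected constraint set and some active nonzero reference row of `A`; otherwise it is `α`. -/
def IsRefinedLevel (n : ℕ) (α : ℝ) (e : Est dμ dδ) (μ : Fin dμ → ℝ) (δ : Fin dδ → ℝ)
    (β : ℝ) : Prop :=
  (M.sHat n e μ δ = 1 ∧ M.rHat n e μ = 1 →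
    ∃ (dA : ℕ) (H : Matrix (Fin dA) (Fin dC) ℝ) (i : Fin dA),
      H * M.Cbar e = 0 ∧
      ppoly M.B (M.d n) (M.Cbar e) = poly (H * M.B) (H *ᵥ M.d n) ∧
      ((H * M.B) *ᵥ μ) i = (H *ᵥ M.d n) i ∧ (H * M.B) i ≠ 0 ∧
      β = 2 * α * stdNormalCdf (tau n (M.sigmaTilde n e) (H * M.B) (H *ᵥ M.d n) μ i)) ∧
  (¬ (M.sHat n e μ δ = 1 ∧ M.rHat n e μ = 1) → β = α)

/-! ### Assumptions -/

/-- The true parameter values converge along the subsequence `φ`. -/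
def ParamConv (F : ℕ → Law dμ dδ) (φ : ℕ → ℕ) (μ : Fin dμ → ℝ) (d : Fin dC → ℝ)
    (P : Matrix (Fin dμ) (Fin dδ) ℝ) : Prop :=
  Tendsto (fun q => M.muF (φ q) (F (φ q))) atTop (𝓝 μ) ∧
  Tendsto (fun q => M.PiF (φ q) (F (φ q))) atTop (𝓝 P) ∧
  Tendsto (fun q => M.d (φ q)) atTop (𝓝 d)

/-- Sequences of distributions that satisfy the null hypothesis. -/
def IsNullSeq (F : ℕ → Law dμ dδ) : Prop := ∀ n, 1 ≤ n → F n ∈ M.null n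

/-- Asymptotic normality and consistent variance estimation along subsequences. -/
def Assumption1 : Prop :=
  ∀ F : ℕ → Law dμ dδ, M.IsNullSeq F → ∀ φ : ℕ → ℕ, StrictMono φ →
    ∃ (χ : ℕ → ℕ) (μ : Fin dμ → ℝ) (d : Fin dC → ℝ) (P : Matrix (Fin dμ) (Fin dδ) ℝ)
      (Ω : Matrix (VecIdx dμ dδ) (VecIdx dμ dδ) ℝ) (Υ : Matrix (Fin dμ) (Fin dμ) ℝ),
      StrictMono χ ∧ Ω.PosSemidef ∧ Υ.PosDef ∧
      M.ParamConv F (φ ∘ χ) μ d P ∧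
      TendstoInDistribution
        (fun (q : ℕ) (e : Est dμ dδ) => √(φ (χ q) : ℝ) •
          stackVec (e.mu - M.muF (φ (χ q)) (F (φ (χ q))))
            (e.Pi - M.PiF (φ (χ q)) (F (φ (χ q)))))
        atTop (id : EuclideanSpace ℝ (VecIdx dμ dδ) → EuclideanSpace ℝ (VecIdx dμ dδ))
        (fun q => (F (φ (χ q)) : Measure (Est dμ dδ))) (multivariateGaussian 0 Ω) ∧
      (sandwich Ω (minNormPoint (poly (M.CMat P) (d - M.B *ᵥ μ)))).PosDef ∧
      (∀ ε : ℝ, 0 < ε → Tendsto (fun q => (F (φ (χ q)) : Measure (Est dμ dδ))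
        {e | ∃ i j, ε ≤ |e.Omega i j - Ω i j|}) atTop (𝓝 0)) ∧
      (∀ ε : ℝ, 0 < ε → Tendsto (fun q => (F (φ (χ q)) : Measure (Est dμ dδ))
        {e | ∃ i j, ε ≤ |e.Upsilon i j - Υ i j|}) atTop (𝓝 0)) ∧
      (poly (M.CMat P) (d - M.B *ᵥ μ)).Nonempty

/-- Stable rank. -/
def Assumption2 : Prop :=
  ∀ F : ℕ → Law dμ dδ, M.IsNullSeq F → ∀ φ : ℕ → ℕ, StrictMono φ →
    ∀ (μ : Fin dμ → ℝ) (d : Fin dC → ℝ) (P : Matrix (Fin dμ) (Fin dδ) ℝ),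
      M.ParamConv F φ μ d P →
      ∃ χ : ℕ → ℕ, StrictMono χ ∧
        ∀ K ∈ simActive (M.CMat P) (d - M.B *ᵥ μ), M.eqIdx ⊆ K →
          Tendsto (fun q => (F (φ (χ q)) : Measure (Est dμ dδ))
            {e | rowRank (M.Cbar e) K = rowRank (M.CF (φ (χ q)) (F (φ (χ q)))) K ∧
              rowRank (M.CF (φ (χ q)) (F (φ (χ q)))) K = rowRank (M.CMat P) K}) atTop (𝓝 1)

/-- Stable rank for the minimal activatable set of the limiting constraint set for `δ`. -/
def Assumption3 : Prop :=
  ∀ F : ℕ → Law dμ dδ, M.IsNullSeq F → ∀ φ : ℕ → ℕ, StrictMono φ →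
    ∀ (μ : Fin dμ → ℝ) (d : Fin dC → ℝ) (P : Matrix (Fin dμ) (Fin dδ) ℝ),
      M.ParamConv F φ μ d P → (poly (M.CMat P) (d - M.B *ᵥ μ)).Nonempty →
      ∃ χ : ℕ → ℕ, StrictMono χ ∧
        ∀ K, K = minActivatable (M.CMat P) (shiftE M.B (toE d) μ) →
          Tendsto (fun q => (F (φ (χ q)) : Measure (Est dμ dδ))
            {e | rowRank (M.Cbar e) K = rowRank (M.CF (φ (χ q)) (F (φ (χ q)))) K ∧
              rowRank (M.CF (φ (χ q)) (F (φ (χ q)))) K = rowRank (M.CMat P) K}) atTop (𝓝 1)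

/-- Stable rank for the K- and L-activatable sets of the rescaled limiting problem. -/
def Assumption4 : Prop :=
  ∀ F : ℕ → Law dμ dδ, M.IsNullSeq F → ∀ φ : ℕ → ℕ, StrictMono φ →
    ∀ (μ : Fin dμ → ℝ) (d : Fin dC → ℝ) (P : Matrix (Fin dμ) (Fin dδ) ℝ) (h : Fin dC → EReal),
      M.ParamConv F φ μ d P → (∀ j, 0 ≤ h j) →
      (∀ j, Tendsto (fun q => ((√(φ q : ℝ) * (M.bF (φ q) (F (φ q)) -
        M.CF (φ q) (F (φ q)) *ᵥ M.deltaStar (φ q) (F (φ q))) j : ℝ) : EReal)) atTop (𝓝 (h j))) →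
      ∃ χ : ℕ → ℕ, StrictMono χ ∧
        ∀ K ∈ kActivatable M.B (M.CMat P) h ∪ lActivatable M.B (M.CMat P) h,
          Tendsto (fun q => (F (φ (χ q)) : Measure (Est dμ dδ))
            {e | rowRank (M.Cbar e) K = rowRank (M.CMat P) K}) atTop (𝓝 1)

end Model

end GCC

end

/-! If the bound failed, some level `a > α` would be exceeded by the rejection probabilities along a
subsequence of null distributions. Compactness and the assumptions give a further subsequence along
which all parameters converge. In the local coordinates `√n (μ - origin)` the projected constraint
set becomes `{ν : B ν + C̄ w ≤ h_n}`, where `h_n ≥ 0` is nonrandom and converges in `[0, ∞]`, and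
the rescaled estimator converges to `N(0, Σ)`. The limit problem is to test, from one Gaussian
observation, whether its mean lies in a polyhedron containing the origin, which is the true mean.

The limit problem has level `α` (`stdGaussian_critRegion_le`). After whitening, split the points
outside the polyhedron `P` by the normal cone `N` at their projection. Given the component
orthogonal to `span N`, such a cell is a shifted cone `c + N` with `⟪c, y⟫ ≥ 0` on `N`, because `0 ∈
P`. The shift multiplies the Gaussian density by a factor that decreases along rays, so within the
cell the chi-squared test with `dim N` degrees of freedom rejects a fraction of at most `α`
(`stdGaussian_shifted_cone_le`). If `N` is a ray and balls inside `P` touch the face, the cell also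
receives the points of `P` on the inner normal, up to the radius of a ball. If `τ` is the largest
radius, this line carries mass at least `Φ(τ)` before the shift and rejection at level `2 α Φ(τ)`
uses only `α Φ(τ)`. This pays for the refined level. Enlarged cells stay disjoint
(`eq_of_mem_innerCell`), so the bounds add up to `α`. In the sample, `t ≤ τ` provides an inscribed
ellipsoid of radius `t` touching at the estimate (`Model.exists_inscribed_of_lt_tau`).

The passage to the limit rests on stable ranks. Limit points of the constraint sets lie in the limit
set because multipliers of the limit problem can be lifted to the approximating ones when the rank
is stable on their supports (`LocalLimit.mem_of_tendsto`). The converse approximation is a Hoffman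
bound for the fixed matrix `[B, D]`. Degrees of freedom satisfy `r̂ ≤ ŝ`, and `r̂` is eventually at
least the dimension of a space containing the limit residual (`exists_normSpan_le_coneDim`). The
residual almost surely avoids spaces of too small a dimension (`stdGaussian_residual_mem_eq_zero`).
Hence limits of rejecting realizations lie in `limitRegion`, of probability at most `α`, and a
portmanteau argument (`le_measure_of_tendstoInDistribution`) contradicts `a > α`. Both sets of rank
assumptions enter only through `Model.HasStableSubseq`. -/

noncomputable section

namespace GCC

/-! ### Finitely generated cones -/

section Cones

variable {ι E : Type*} [Fintype ι] [NormedAddCommGroup E] [NormedSpace ℝ E]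

/-- A nonnegative combination with dependent support can be rewritten with smaller support. -/
lemma exists_smaller_support (v : ι → E) (ψ g : ι → ℝ) (hψ : 0 ≤ ψ)
    (hg : ∑ j, g j • v j = 0) (hg0 : g ≠ 0) (hgψ : ∀ j, ψ j = 0 → g j = 0) :
    ∃ ψ' : ι → ℝ, 0 ≤ ψ' ∧ (∀ j, ψ j = 0 → ψ' j = 0) ∧ (∃ j, ψ j ≠ 0 ∧ ψ' j = 0) ∧
      ∑ j, ψ' j • v j = ∑ j, ψ j • v j := by
  classical
  obtain ⟨i, hi⟩ : ∃ i, g i ≠ 0 := by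
    by_contra! h; exact hg0 (funext h)
  wlog hpos : 0 < g i generalizing g
  · refine this (-g) ?_ (by simpa using hg0) (by simpa using hgψ) (by simpa using hi) ?_
    · simp [Finset.sum_neg_distrib, hg]
    · simp only [Pi.neg_apply, Left.neg_pos_iff]
      exact lt_of_le_of_ne (not_lt.mp hpos) hi
  have hs : (Finset.univ.filter fun j => 0 < g j).Nonempty := ⟨i, by simpa using hpos⟩
  -- Ratio test: moving from `ψ` along `-g`, the first coordinate to vanish has the smallest `ψ j /
  -- g j` among those with `g j > 0`.
  obtain ⟨k, hk, hmin⟩ := Finset.exists_min_image _ (fun j => ψ j / g j) hs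
  simp only [Finset.mem_filter, Finset.mem_univ, true_and] at hk hmin
  have ht : 0 ≤ ψ k / g k := div_nonneg (hψ k) hk.le
  refine ⟨fun j => ψ j - ψ k / g k * g j, fun j => ?_, fun j hj => ?_, ⟨k, ?_, ?_⟩, ?_⟩
  · rcases lt_or_ge 0 (g j) with h | h
    · have := (le_div_iff₀ h).mp (hmin j h)
      simpa using this
    · have h1 := mul_nonpos_of_nonneg_of_nonpos ht h
      have h2 : 0 ≤ ψ j := hψ j
      simp only [Pi.zero_apply]
      linarith
  · simp [hj, hgψ j hj]
  · exact fun h => hk.ne' (hgψ k h)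
  · field_simp; simp
  · simp only [sub_smul, Finset.sum_sub_distrib, mul_smul, ← Finset.smul_sum, hg]
    simp

/-- Carathéodory's theorem for cones: as long as the generators in the support are dependent,
`exists_smaller_support` removes one of them. -/
lemma exists_independent_support (v : ι → E) (ψ : ι → ℝ) (hψ : 0 ≤ ψ) :
    ∃ ψ' : ι → ℝ, 0 ≤ ψ' ∧ (∀ j, ψ j = 0 → ψ' j = 0) ∧
      ∑ j, ψ' j • v j = ∑ j, ψ j • v j ∧
      ∀ g : ι → ℝ, (∀ j, ψ' j = 0 → g j = 0) → ∑ j, g j • v j = 0 → g = 0 := by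
  classical
  induction hN : (Finset.univ.filter fun j => ψ j ≠ 0).card using Nat.strong_induction_on
    generalizing ψ with
  | _ N ih =>
    by_cases h : ∀ g : ι → ℝ, (∀ j, ψ j = 0 → g j = 0) → ∑ j, g j • v j = 0 → g = 0
    · exact ⟨ψ, hψ, fun _ h => h, rfl, h⟩
    · push Not at h
      obtain ⟨g, h1, h2, h3⟩ := h
      obtain ⟨ψ₁, p1, p2, ⟨k, k1, k2⟩, p4⟩ := exists_smaller_support v ψ g hψ h2 h3 h1
      obtain ⟨ψ', q1, q2, q3, q4⟩ := ih _ (by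
        rw [← hN]
        apply Finset.card_lt_card
        refine ⟨fun j hj => ?_, fun hsub => ?_⟩
        · simp only [Finset.mem_filter, Finset.mem_univ, true_and] at hj ⊢
          exact fun h => hj (p2 j h)
        · have := hsub (show k ∈ _ by simpa using k1)
          simp [k2] at this) ψ₁ p1 rfl
      exact ⟨ψ', q1, fun j hj => q2 j (p2 j hj), q3.trans p4, q4⟩

/-- Nonnegative combinations have representations with coefficients bounded by a multiple of the
norm of the sum. -/
lemma exists_conic_bound (v : ι → E) :
    ∃ c : ℝ, 0 ≤ c ∧ ∀ ψ : ι → ℝ, 0 ≤ ψ → ∃ ψ' : ι → ℝ, 0 ≤ ψ' ∧ (∀ j, ψ j = 0 → ψ' j = 0) ∧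
      ∑ j, ψ' j • v j = ∑ j, ψ j • v j ∧ ‖ψ'‖ ≤ c * ‖∑ j, ψ j • v j‖ := by
  classical
  let f : (ι → ℝ) →ₗ[ℝ] E := Fintype.linearCombination ℝ v
  have hf : ∀ g, f g = ∑ j, g j • v j := fun g => Fintype.linearCombination_apply ℝ v g
  -- Where the generators are independent the combination map is injective, hence bounded below.
  -- There are finitely many supports, so the sum of the constants serves all; dependent supports
  -- get the dummy constant 0.
  have key : ∀ s : Finset ι, ∃ c : ℝ, 0 ≤ c ∧
      ((∀ g : ι → ℝ, (∀ j ∉ s, g j = 0) → ∑ j, g j • v j = 0 → g = 0) →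
        ∀ g : ι → ℝ, (∀ j ∉ s, g j = 0) → ‖g‖ ≤ c * ‖∑ j, g j • v j‖) := by
    intro s
    by_cases h : ∀ g : ι → ℝ, (∀ j ∉ s, g j = 0) → ∑ j, g j • v j = 0 → g = 0
    · let U : Submodule ℝ (ι → ℝ) :=
        { carrier := {g | ∀ j ∉ s, g j = 0}
          add_mem' := fun {a b} ha hb j hj => by simp [ha j hj, hb j hj]
          zero_mem' := fun j _ => rfl
          smul_mem' := fun c a ha j hj => by simp [ha j hj] }
      have hker : LinearMap.ker (f ∘ₗ U.subtype) = ⊥ := by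
        rw [LinearMap.ker_eq_bot']
        intro g hg
        exact Subtype.ext (h g g.2 (by simpa [hf] using hg))
      obtain ⟨K, -, hK⟩ := LinearMap.exists_antilipschitzWith _ hker
      refine ⟨K, K.2, fun _ g hg => ?_⟩
      have := hK.le_mul_norm_sub 0 ⟨g, hg⟩
      simpa [hf] using this
    · exact ⟨0, le_rfl, fun h' => absurd h' h⟩
  choose c hc0 hc using key
  refine ⟨∑ s, c s, Finset.sum_nonneg fun s _ => hc0 s, fun ψ hψ => ?_⟩
  obtain ⟨ψ', p1, p2, p3, p4⟩ := exists_independent_support v ψ hψ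
  refine ⟨ψ', p1, p2, p3, ?_⟩
  let s : Finset ι := Finset.univ.filter fun j => ψ' j ≠ 0
  have h1 := hc s (fun g hg => p4 g fun j hj => hg j (by simp [s, hj])) ψ' (by simp [s])
  rw [← p3]
  refine h1.trans (mul_le_mul_of_nonneg_right ?_ (norm_nonneg _))
  exact Finset.single_le_sum (fun t _ => hc0 t) (Finset.mem_univ s)

/-- A finitely generated cone is closed. -/
lemma isClosed_conic (v : ι → E) :
    IsClosed {y : E | ∃ ψ : ι → ℝ, 0 ≤ ψ ∧ ∑ j, ψ j • v j = y} := by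
  obtain ⟨c, hc, H⟩ := exists_conic_bound v
  refine isClosed_of_closure_subset fun y hy => ?_
  obtain ⟨u, hu, hlim⟩ := mem_closure_iff_seq_limit.mp hy
  have : ∀ n, ∃ ψ : ι → ℝ, 0 ≤ ψ ∧ ∑ j, ψ j • v j = u n ∧ ‖ψ‖ ≤ c * ‖u n‖ := fun n => by
    obtain ⟨ψ, h1, h2⟩ := hu n
    obtain ⟨ψ', p1, -, p3, p4⟩ := H ψ h1
    exact ⟨ψ', p1, p3.trans h2, by rwa [h2] at p4⟩
  choose ψ h1 h2 h3 using this
  -- Bounded coefficients allow a convergent subsequence, whose limit represents `y`.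
  obtain ⟨R, hR⟩ := (hlim.norm.const_mul c).bddAbove_range
  obtain ⟨ψ₀, -, φ, hφ, hlimψ⟩ := tendsto_subseq_of_bounded
    (Metric.isBounded_closedBall (x := (0 : ι → ℝ)) (r := R)) (x := ψ)
    (fun n => by simpa using (h3 n).trans (hR ⟨n, rfl⟩))
  refine ⟨ψ₀, ?_, ?_⟩
  · exact ge_of_tendsto' hlimψ fun n => h1 _
  · have e1 : Tendsto (fun n => ∑ j, ψ (φ n) j • v j) atTop (𝓝 (∑ j, ψ₀ j • v j)) :=
      tendsto_finsetSum _ fun j _ => ((tendsto_pi_nhds.mp hlimψ) j).smul_const _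
    have e2 : Tendsto (fun n => ∑ j, ψ (φ n) j • v j) atTop (𝓝 y) := by
      simp_rw [h2]; exact hlim.comp hφ.tendsto_atTop
    exact tendsto_nhds_unique e1 e2

end Cones

/-! ### Farkas' lemma -/

section Farkas

variable {m ι : Type*} [Fintype m]

lemma transpose_mulVec_eq_sum (G : Matrix m ι ℝ) (ψ : m → ℝ) :
    Gᵀ *ᵥ ψ = ∑ j, ψ j • G j := by
  ext i
  simp [Matrix.mulVec, dotProduct, Finset.sum_apply, mul_comm]

variable [Fintype ι]

/-- Bounded nonnegative solutions of `G' ψ = y` with support in a prescribed set. -/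
lemma exists_multiplier_bound (G : Matrix m ι ℝ) :
    ∃ c : ℝ, 0 ≤ c ∧ ∀ ψ : m → ℝ, 0 ≤ ψ → ∃ ψ' : m → ℝ, 0 ≤ ψ' ∧ (∀ j, ψ j = 0 → ψ' j = 0) ∧
      Gᵀ *ᵥ ψ' = Gᵀ *ᵥ ψ ∧ ‖ψ'‖ ≤ c * ‖Gᵀ *ᵥ ψ‖ := by
  obtain ⟨c, hc, H⟩ := exists_conic_bound (fun j => G j)
  refine ⟨c, hc, fun ψ hψ => ?_⟩
  obtain ⟨ψ', h⟩ := H ψ hψ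
  exact ⟨ψ', by simpa only [transpose_mulVec_eq_sum] using h⟩

/-- Farkas' lemma for the rows in `K`. -/
lemma farkas (G : Matrix m ι ℝ) (K : Set m) (y : ι → ℝ)
    (h : ∀ z : ι → ℝ, (∀ j ∈ K, (G *ᵥ z) j ≤ 0) → y ⬝ᵥ z ≤ 0) :
    ∃ ψ : m → ℝ, 0 ≤ ψ ∧ (∀ j ∉ K, ψ j = 0) ∧ Gᵀ *ᵥ ψ = y := by
  classical
  -- Zeroing the rows outside `K` makes the cone of all rows equal to the cone of the rows in `K`.
  let v : m → ι → ℝ := fun j => if j ∈ K then G j else 0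
  let C : ProperCone ℝ (ι → ℝ) :=
    { carrier := {y | ∃ ψ : m → ℝ, 0 ≤ ψ ∧ ∑ j, ψ j • v j = y}
      add_mem' := by
        rintro a b ⟨p, hp, rfl⟩ ⟨q, hq, rfl⟩
        exact ⟨p + q, add_nonneg hp hq, by simp [add_smul, Finset.sum_add_distrib]⟩
      zero_mem' := ⟨0, le_rfl, by simp⟩
      smul_mem' := by
        rintro c a ⟨p, hp, rfl⟩
        refine ⟨(c : ℝ) • p, smul_nonneg c.2 hp, ?_⟩
        simp only [Pi.smul_apply, smul_assoc, ← Finset.smul_sum]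
        rfl
      isClosed' := isClosed_conic v }
  have hy : y ∈ C := by
    by_contra hy
    -- A functional separates `y` from the closed cone; the negative of the vector representing it
    -- violates `h`.
    obtain ⟨f, hf1, hf2⟩ := C.hyperplane_separation_point hy
    let z : ι → ℝ := fun i => f (Pi.single i 1)
    have hfz : ∀ x : ι → ℝ, f x = x ⬝ᵥ z := fun x => by
      conv_lhs => rw [pi_eq_sum_univ' x]
      simp [z, dotProduct]
    have := h (-z) fun j hj => by
      have h1 := hf1 (v j) ⟨Pi.single j 1, by
        intro i; by_cases hi : i = j <;> simp [hi], by
        simp [Pi.single_apply]⟩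
      rw [hfz] at h1
      simp only [v, hj, if_true] at h1
      simpa [Matrix.mulVec] using h1
    rw [hfz] at hf2
    simp at this
    linarith
  obtain ⟨ψ, h1, h2⟩ := hy
  refine ⟨fun j => if j ∈ K then ψ j else 0, fun j => ?_, fun j hj => by simp [hj], ?_⟩
  · have := h1 j
    by_cases hj : j ∈ K <;> simp_all
  · rw [transpose_mulVec_eq_sum, ← h2]
    refine Finset.sum_congr rfl fun j _ => ?_
    by_cases hj : j ∈ K <;> simp [hj, v]

end Farkas

/-! ### Minimization of quadratic forms and multipliers -/

section Minimization

variable {m ι : Type*} [Fintype m] [Fintype ι]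

lemma continuous_quadForm (W : Matrix ι ι ℝ) (x : ι → ℝ) :
    Continuous fun z : ι → ℝ => (x - z) ⬝ᵥ (W *ᵥ (x - z)) := by
  simp only [dotProduct, Matrix.mulVec]
  fun_prop

/-- The norm of `ι → ℝ` is the supremum norm, which the Euclidean norm dominates. -/
lemma sq_norm_le_dotProduct_self (x : ι → ℝ) : ‖x‖ ^ 2 ≤ x ⬝ᵥ x := by
  have h0 : 0 ≤ x ⬝ᵥ x := Finset.sum_nonneg fun i _ => mul_self_nonneg _
  have : ‖x‖ ≤ √(x ⬝ᵥ x) := by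
    refine (pi_norm_le_iff_of_nonneg (Real.sqrt_nonneg _)).mpr fun i => ?_
    refine Real.abs_le_sqrt ?_
    rw [sq]
    exact Finset.single_le_sum (f := fun i => x i * x i) (fun j _ => mul_self_nonneg _)
      (Finset.mem_univ i)
  calc ‖x‖ ^ 2 ≤ √(x ⬝ᵥ x) ^ 2 := by gcongr
    _ = _ := Real.sq_sqrt h0

/-- A coercive quadratic form attains its minimum over a nonempty closed set. -/
lemma exists_quadForm_min (W : Matrix ι ι ℝ) {c : ℝ} (hc : 0 < c)
    (hW : ∀ z : ι → ℝ, c * ‖z‖ ^ 2 ≤ z ⬝ᵥ (W *ᵥ z)) (x : ι → ℝ) {S : Set (ι → ℝ)}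
    (hS : IsClosed S) (hne : S.Nonempty) :
    ∃ z ∈ S, ∀ z' ∈ S, (x - z) ⬝ᵥ (W *ᵥ (x - z)) ≤ (x - z') ⬝ᵥ (W *ᵥ (x - z')) := by
  obtain ⟨z₀, hz₀⟩ := hne
  refine (continuous_quadForm W x).continuousOn.exists_isMinOn' hS hz₀ ?_
  refine Filter.Eventually.filter_mono inf_le_left ?_
  have h1 : Tendsto (fun z : ι → ℝ => c * ‖x - z‖ ^ 2) (cocompact _) atTop := by
    refine Tendsto.const_mul_atTop hc ((tendsto_pow_atTop two_ne_zero).comp ?_)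
    refine tendsto_norm_cocompact_atTop.comp ?_
    exact (Homeomorph.subLeft x).isClosedEmbedding.tendsto_cocompact
  filter_upwards [h1.eventually_ge_atTop ((x - z₀) ⬝ᵥ (W *ᵥ (x - z₀)))] with z hz
  exact hz.trans (hW _)

lemma quadForm_add (W : Matrix ι ι ℝ) (hW : W.IsSymm) (a b : ι → ℝ) :
    (a + b) ⬝ᵥ (W *ᵥ (a + b)) = a ⬝ᵥ (W *ᵥ a) + 2 * (a ⬝ᵥ (W *ᵥ b)) + b ⬝ᵥ (W *ᵥ b) := by
  have : b ⬝ᵥ (W *ᵥ a) = a ⬝ᵥ (W *ᵥ b) := by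
    rw [dotProduct_comm, ← Matrix.vecMul_transpose, hW.eq, ← Matrix.dotProduct_mulVec]
  simp only [Matrix.mulVec_add, dotProduct_add, add_dotProduct, this]
  ring

/-- First-order condition for the minimum of a quadratic form over a convex set. -/
lemma quadForm_min_variational {W : Matrix ι ι ℝ} (hW : W.IsSymm) {x z : ι → ℝ}
    {S : Set (ι → ℝ)} (hS : Convex ℝ S) (hz : z ∈ S)
    (hmin : ∀ z' ∈ S, (x - z) ⬝ᵥ (W *ᵥ (x - z)) ≤ (x - z') ⬝ᵥ (W *ᵥ (x - z')))
    {z' : ι → ℝ} (hz' : z' ∈ S) : (W *ᵥ (x - z)) ⬝ᵥ (z' - z) ≤ 0 := by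
  by_contra! hpos
  set a := (W *ᵥ (x - z)) ⬝ᵥ (z' - z) with ha
  set b := (z' - z) ⬝ᵥ (W *ᵥ (z' - z)) with hb
  have key : ∀ t : ℝ, 0 ≤ t → t ≤ 1 → 0 ≤ -2 * t * a + t ^ 2 * b := by
    intro t h0 h1
    have hmem : z + t • (z' - z) ∈ S := hS.add_smul_sub_mem hz hz' ⟨h0, h1⟩
    have := hmin _ hmem
    have e : x - (z + t • (z' - z)) = (x - z) + (-t) • (z' - z) := by
      rw [neg_smul]; abel
    rw [e, quadForm_add W hW] at this
    have e2 : (x - z) ⬝ᵥ (W *ᵥ ((-t) • (z' - z))) = -t * a := by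
      rw [Matrix.mulVec_smul, dotProduct_smul, ha, smul_eq_mul, Matrix.dotProduct_mulVec,
        ← Matrix.mulVec_transpose, hW.eq]
    have e3 : ((-t) • (z' - z)) ⬝ᵥ (W *ᵥ ((-t) • (z' - z))) = t ^ 2 * b := by
      rw [Matrix.mulVec_smul, dotProduct_smul, smul_dotProduct, hb, smul_eq_mul, smul_eq_mul]
      ring
    rw [e2, e3] at this
    linarith
  -- With this `t`, `t * b ≤ a`, so the quadratic term cannot offset the linear term `-2 * t * a`.
  have h1 := key (min 1 (a / (|b| + 1))) (by positivity) (min_le_left _ _)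
  set t := min 1 (a / (|b| + 1)) with ht
  have ht0 : 0 < t := by positivity
  have h2 : t * (|b| + 1) ≤ a := by
    have := min_le_right 1 (a / (|b| + 1))
    rwa [← ht, le_div_iff₀ (by positivity)] at this
  nlinarith [le_abs_self b, mul_pos ht0 ht0]

/-- A linear functional that is maximal at `z` over `{G z ≤ h}` is a nonnegative combination of
the rows that are active at `z`. -/
lemma exists_normal_multiplier (G : Matrix m ι ℝ) (h : m → EReal) (z : ι → ℝ)
    (hz : ∀ j, (((G *ᵥ z) j : ℝ) : EReal) ≤ h j) (K : Set m)
    (hK : ∀ j ∉ K, (((G *ᵥ z) j : ℝ) : EReal) < h j) (y : ι → ℝ)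
    (hy : ∀ z', (∀ j, (((G *ᵥ z') j : ℝ) : EReal) ≤ h j) → y ⬝ᵥ (z' - z) ≤ 0) :
    ∃ ψ : m → ℝ, 0 ≤ ψ ∧ (∀ j ∉ K, ψ j = 0) ∧ Gᵀ *ᵥ ψ = y := by
  refine farkas G K y fun d hd => ?_
  -- A short step along `d` stays feasible: rows in `K` do not increase, and the others are slack.
  -- So the functional cannot increase along `d`.
  have hev : ∀ᶠ ε in 𝓝[>] (0 : ℝ), ∀ j, (((G *ᵥ (z + ε • d)) j : ℝ) : EReal) ≤ h j := by
    rw [eventually_all]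
    intro j
    by_cases hj : j ∈ K
    · filter_upwards [self_mem_nhdsWithin] with ε hε
      refine le_trans ?_ (hz j)
      rw [EReal.coe_le_coe_iff, Matrix.mulVec_add, Matrix.mulVec_smul]
      have := mul_nonpos_of_nonneg_of_nonpos (le_of_lt hε) (hd j hj)
      simpa using this
    · have hc : Tendsto (fun ε : ℝ => (((G *ᵥ (z + ε • d)) j : ℝ) : EReal)) (𝓝[>] 0)
          (𝓝 (((G *ᵥ z) j : ℝ) : EReal)) := by
        have : Continuous fun ε : ℝ => (((G *ᵥ (z + ε • d)) j : ℝ) : EReal) := by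
          refine continuous_coe_real_ereal.comp ?_
          simp only [Matrix.mulVec, dotProduct]
          fun_prop
        simpa using (this.tendsto 0).mono_left nhdsWithin_le_nhds
      filter_upwards [hc.eventually_lt_const (hK j hj)] with ε hε using hε.le
  obtain ⟨ε, h1, h2⟩ := (hev.and self_mem_nhdsWithin).exists
  have := hy _ h1
  have h2' : (0 : ℝ) < ε := h2
  simp only [add_sub_cancel_left, dotProduct_smul, smul_eq_mul] at this
  by_contra! hpos
  exact absurd this (not_le.mpr (mul_pos h2' hpos))

/-- Hoffman-type continuity of `{G z ≤ h}` in `h`. -/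
lemma exists_tendsto_feasible (G : Matrix m ι ℝ) {hs : ℕ → m → ℝ} {h : m → EReal}
    (h0 : ∀ q, 0 ≤ hs q) (hlim : ∀ j, Tendsto (fun q => ((hs q j : ℝ) : EReal)) atTop (𝓝 (h j)))
    {z : ι → ℝ} (hz : ∀ j, (((G *ᵥ z) j : ℝ) : EReal) ≤ h j) :
    ∃ zs : ℕ → ι → ℝ, Tendsto zs atTop (𝓝 z) ∧ ∀ᶠ q in atTop, G *ᵥ zs q ≤ hs q := by
  classical
  obtain ⟨c, hc, hcb⟩ := exists_multiplier_bound G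
  -- Only rows active at `z` in the limit can be violated at `z` by a vanishing amount infinitely
  -- often; `e` measures this violation.
  let K : Set m := {j | (((G *ᵥ z) j : ℝ) : EReal) = h j}
  let e : ℕ → ℝ := fun q => ∑ j, if j ∈ K then |(G *ᵥ z) j - hs q j| else 0
  have he0 : ∀ q, 0 ≤ e q := fun q => Finset.sum_nonneg fun j _ => by split_ifs <;> positivity
  have he : Tendsto e atTop (𝓝 0) := by
    rw [← Finset.sum_const_zero (s := (Finset.univ : Finset m))]
    refine tendsto_finsetSum _ fun j _ => ?_
    by_cases hj : j ∈ K
    · have h1 := hlim j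
      rw [← (show (((G *ᵥ z) j : ℝ) : EReal) = h j from hj), EReal.tendsto_coe] at h1
      simpa [hj] using (h1.const_sub ((G *ᵥ z) j)).abs
    · simp [hj]
  have key : ∀ q, ∃ z' : ι → ℝ, (∀ j ∈ K, (G *ᵥ z') j ≤ hs q j) ∧ ‖z - z'‖ ≤ c * e q := by
    intro q
    -- Rows outside `K` are dropped by an infinite right-hand side. The remaining set contains 0, so
    -- `z` can be projected onto it.
    let h' : m → EReal := fun j => if j ∈ K then ((hs q j : ℝ) : EReal) else ⊤
    let S : Set (ι → ℝ) := {z' | ∀ j, (((G *ᵥ z') j : ℝ) : EReal) ≤ h' j}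
    have hSmem : ∀ z', z' ∈ S ↔ ∀ j ∈ K, (G *ᵥ z') j ≤ hs q j := by
      intro z'
      refine forall_congr' fun j => ?_
      by_cases hj : j ∈ K <;> simp [h', hj]
    have hScl : IsClosed S := by
      have : S = ⋂ j ∈ K, {z' | (G *ᵥ z') j ≤ hs q j} := by
        ext z'; simp [hSmem]
      rw [this]
      refine isClosed_biInter fun j _ => isClosed_le ?_ continuous_const
      simp only [Matrix.mulVec, dotProduct]
      fun_prop
    have hScv : Convex ℝ S := by
      intro a ha b hb s t hs' ht hst
      rw [hSmem] at ha hb ⊢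
      intro j hj
      simp only [Matrix.mulVec_add, Matrix.mulVec_smul, Pi.add_apply, Pi.smul_apply, smul_eq_mul]
      calc _ ≤ s * hs q j + t * hs q j := by gcongr; exacts [ha j hj, hb j hj]
        _ = hs q j := by rw [← add_mul, hst, one_mul]
    have hSne : S.Nonempty := ⟨0, (hSmem 0).mpr fun j _ => by simpa using h0 q j⟩
    obtain ⟨z', hz'S, hmin⟩ := exists_quadForm_min (1 : Matrix ι ι ℝ) (c := 1) one_pos
      (fun x => by simpa using sq_norm_le_dotProduct_self x) z hScl hSne
    refine ⟨z', (hSmem z').mp hz'S, ?_⟩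
    set y := z - z' with hy
    obtain ⟨ψ₀, p1, p2, p3⟩ := exists_normal_multiplier G h' z' hz'S
      {j | (((G *ᵥ z') j : ℝ) : EReal) = h' j} (fun j hj => lt_of_le_of_ne (hz'S j) hj) y
      (fun z'' hz'' => by
        have := quadForm_min_variational Matrix.isSymm_one hScv hz'S hmin hz''
        rwa [Matrix.one_mulVec] at this)
    -- The residual `y` is a combination of active rows with coefficients of order `‖y‖`. Pairing it
    -- with `y` gives `‖y‖ ^ 2 ≤ c * ‖y‖ * e q`, which is the Hoffman bound.
    obtain ⟨ψ, q1, q2, q3, q4⟩ := hcb ψ₀ p1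
    rw [p3] at q3 q4
    have hsum : y ⬝ᵥ y ≤ c * ‖y‖ * e q := by
      have e1 : y ⬝ᵥ y = ψ ⬝ᵥ (G *ᵥ y) := by
        nth_rewrite 1 [← q3]
        rw [Matrix.mulVec_transpose, ← Matrix.dotProduct_mulVec]
      rw [e1, Finset.mul_sum]
      refine Finset.sum_le_sum fun j _ => ?_
      by_cases hψ : ψ j = 0
      · rw [hψ, zero_mul]; split_ifs <;> positivity
      · have hact : (((G *ᵥ z') j : ℝ) : EReal) = h' j := by
          by_contra hne
          exact hψ (q2 j (p2 j hne))
        have hjK : j ∈ K := by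
          by_contra hj
          simp [h', hj] at hact
        simp only [h', hjK, if_true, EReal.coe_eq_coe_iff] at hact
        simp only [hjK, if_true]
        have hψb : ψ j ≤ c * ‖y‖ :=
          (le_abs_self _).trans ((norm_le_pi_norm ψ j).trans q4)
        have : (G *ᵥ y) j = (G *ᵥ z) j - hs q j := by
          rw [hy, Matrix.mulVec_sub, Pi.sub_apply, hact]
        rw [this]
        calc ψ j * ((G *ᵥ z) j - hs q j) ≤ ψ j * |(G *ᵥ z) j - hs q j| :=
              mul_le_mul_of_nonneg_left (le_abs_self _) (q1 j)
          _ ≤ _ := by gcongr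
    rcases (norm_nonneg y).eq_or_lt with h | h
    · rw [← h]; exact mul_nonneg hc (he0 q)
    · have := (sq_norm_le_dotProduct_self y).trans hsum
      nlinarith
  choose zs hz1 hz2 using key
  have hlimz : Tendsto zs atTop (𝓝 z) := by
    rw [tendsto_iff_norm_sub_tendsto_zero]
    refine squeeze_zero (fun _ => norm_nonneg _) (fun q => ?_) (by simpa using he.const_mul c)
    rw [norm_sub_rev]; exact hz2 q
  refine ⟨zs, hlimz, ?_⟩
  have : ∀ j, ∀ᶠ q in atTop, (G *ᵥ zs q) j ≤ hs q j := by
    intro j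
    by_cases hj : j ∈ K
    · exact Eventually.of_forall fun q => hz1 q j hj
    · have hc' : Tendsto (fun q => (((G *ᵥ zs q) j : ℝ) : EReal)) atTop
          (𝓝 (((G *ᵥ z) j : ℝ) : EReal)) := by
        have : Continuous fun x : ι → ℝ => (((G *ᵥ x) j : ℝ) : EReal) := by
          refine continuous_coe_real_ereal.comp ?_
          simp only [Matrix.mulVec, dotProduct]
          fun_prop
        exact (this.tendsto z).comp hlimz
      filter_upwards [hc'.eventually_lt (hlim j) (lt_of_le_of_ne (hz j) hj)] with q hq
      exact (EReal.coe_lt_coe_iff.mp hq).le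
  filter_upwards [eventually_all.mpr this] with q hq using hq

end Minimization

/-! ### Minimal activatable sets -/

section Activatable

variable {m p k : ℕ}

lemma polyE_toE (C : Matrix (Fin m) (Fin k) ℝ) (b : Fin m → ℝ) : polyE C (toE b) = poly C b := by
  ext x
  simp [polyE, poly, toE, Pi.le_def]

lemma shiftE_toE (B : Matrix (Fin m) (Fin p) ℝ) (d : Fin m → ℝ) (μ : Fin p → ℝ) :
    shiftE B (toE d) μ = toE (d - B *ᵥ μ) := by
  ext j
  simp [shiftE, toE]

lemma ppolyE_toE (B : Matrix (Fin m) (Fin p) ℝ) (C : Matrix (Fin m) (Fin k) ℝ) (d : Fin m → ℝ) :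
    ppolyE B (toE d) C = ppoly B d C := by
  ext x
  simp [ppolyE, ppoly, toE, Pi.le_def, EReal.coe_le_coe_iff, -EReal.coe_add]

lemma coe_le_shiftE_iff {B : Matrix (Fin m) (Fin p) ℝ} {h : Fin m → EReal} {μ : Fin p → ℝ}
    {j : Fin m} {x : ℝ} :
    (x : EReal) ≤ shiftE B h μ j ↔ (((B *ᵥ μ) j + x : ℝ) : EReal) ≤ h j := by
  unfold shiftE
  induction h j with
  | bot => simp
  | top => simp
  | coe y =>
    rw [← EReal.coe_sub, EReal.coe_le_coe_iff, EReal.coe_le_coe_iff]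
    constructor <;> intro <;> linarith

lemma coe_eq_shiftE_iff {B : Matrix (Fin m) (Fin p) ℝ} {h : Fin m → EReal} {μ : Fin p → ℝ}
    {j : Fin m} {x : ℝ} :
    (x : EReal) = shiftE B h μ j ↔ (((B *ᵥ μ) j + x : ℝ) : EReal) = h j := by
  unfold shiftE
  induction h j with
  | bot => simp
  | top =>
    rw [EReal.top_sub_coe]
    exact iff_of_false (EReal.coe_ne_top _) (EReal.coe_ne_top _)
  | coe y =>
    rw [← EReal.coe_sub, EReal.coe_eq_coe_iff, EReal.coe_eq_coe_iff]
    constructor <;> intro <;> linarith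

lemma mem_polyE_shiftE_iff {B : Matrix (Fin m) (Fin p) ℝ} {C : Matrix (Fin m) (Fin k) ℝ}
    {h : Fin m → EReal} {μ : Fin p → ℝ} {δ : Fin k → ℝ} :
    δ ∈ polyE C (shiftE B h μ) ↔ ∀ j, (((B *ᵥ μ + C *ᵥ δ) j : ℝ) : EReal) ≤ h j :=
  forall_congr' fun _ => coe_le_shiftE_iff

lemma eq_of_mem_minActivatable {C : Matrix (Fin m) (Fin k) ℝ} {b : Fin m → EReal}
    {δ : Fin k → ℝ} (hδ : δ ∈ polyE C b) {j : Fin m} (hj : j ∈ minActivatable C b) :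
    (((C *ᵥ δ) j : ℝ) : EReal) = b j :=
  hj {j | (((C *ᵥ δ) j : ℝ) : EReal) = b j} ⟨δ, hδ, rfl⟩

lemma convex_polyE (C : Matrix (Fin m) (Fin k) ℝ) (b : Fin m → EReal) :
    Convex ℝ (polyE C b) := by
  intro x hx y hy s t hs ht hst j
  have h1 := hx j
  have h2 := hy j
  revert h1 h2
  induction b j with
  | bot => simp
  | top => simp
  | coe z =>
    simp only [EReal.coe_le_coe_iff, Matrix.mulVec_add, Matrix.mulVec_smul, Pi.add_apply,
      Pi.smul_apply, smul_eq_mul]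
    intro h1 h2
    calc _ ≤ s * z + t * z := by gcongr
      _ = z := by rw [← add_mul, hst, one_mul]

lemma lt_convexComb {x y s t : ℝ} {b : EReal} (hx : (x : EReal) < b) (hy : (y : EReal) ≤ b)
    (hs : 0 < s) (ht : 0 ≤ t) (hst : s + t = 1) : ((s * x + t * y : ℝ) : EReal) < b := by
  induction b with
  | bot => simp at hx
  | top => exact EReal.coe_lt_top _
  | coe z =>
    rw [EReal.coe_lt_coe_iff] at *
    rw [EReal.coe_le_coe_iff] at hy
    calc s * x + t * y < s * z + t * z := by
          have := mul_lt_mul_of_pos_left hx hs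
          have := mul_le_mul_of_nonneg_left hy ht
          linarith
      _ = z := by rw [← add_mul, hst, one_mul]

/-- Some point of a nonempty polyhedron activates exactly the minimal activatable set. -/
lemma exists_lt_off_minActivatable {C : Matrix (Fin m) (Fin k) ℝ} {b : Fin m → EReal}
    (hne : (polyE C b).Nonempty) :
    ∃ δ ∈ polyE C b, ∀ j ∉ minActivatable C b, (((C *ᵥ δ) j : ℝ) : EReal) < b j := by
  classical
  have key : ∀ s : Finset (Fin m), (∀ j ∈ s, j ∉ minActivatable C b) →
      ∃ δ ∈ polyE C b, ∀ j ∈ s, (((C *ᵥ δ) j : ℝ) : EReal) < b j := by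
    intro s
    induction s using Finset.induction_on with
    | empty => exact fun _ => ⟨hne.some, hne.some_mem, by simp⟩
    | insert a s ha ih =>
      intro hs
      obtain ⟨δ, h1, h2⟩ := ih fun j hj => hs j (Finset.mem_insert_of_mem hj)
      have h3 := hs a (Finset.mem_insert_self _ _)
      simp only [minActivatable, Set.mem_sInter, Set.mem_ofPred_eq, not_forall] at h3
      obtain ⟨J, ⟨δ', h4, rfl⟩, h5⟩ := h3
      have e : ∀ j, (C *ᵥ ((1 / 2 : ℝ) • δ + (1 / 2 : ℝ) • δ')) j =
          1 / 2 * (C *ᵥ δ) j + 1 / 2 * (C *ᵥ δ') j := fun j => by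
        simp [Matrix.mulVec_add, Matrix.mulVec_smul]
      -- The midpoint keeps the strict inequalities of `δ` and gains that of `δ'` in row `a`.
      refine ⟨(1 / 2 : ℝ) • δ + (1 / 2 : ℝ) • δ', convex_polyE C b h1 h4 (by norm_num)
        (by norm_num) (by norm_num), fun j hj => ?_⟩
      rw [e]
      rcases Finset.mem_insert.mp hj with rfl | hj
      · rw [add_comm]
        exact lt_convexComb (lt_of_le_of_ne (h4 _) h5) (h1 _) (by norm_num) (by norm_num)
          (by norm_num)
      · exact lt_convexComb (h2 j hj) (h4 _) (by norm_num) (by norm_num) (by norm_num)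
  obtain ⟨δ, h1, h2⟩ := key (Finset.univ.filter fun j => j ∉ minActivatable C b) (by simp)
  exact ⟨δ, h1, fun j hj => h2 j (by simpa using hj)⟩

/-- Strict complementarity for the minimal activatable set. -/
lemma exists_pos_on_minActivatable {C : Matrix (Fin m) (Fin k) ℝ} {b : Fin m → ℝ}
    (hne : (poly C b).Nonempty) :
    ∃ η : Fin m → ℝ, (∀ j ∈ minActivatable C (toE b), 0 < η j) ∧
      (∀ j ∉ minActivatable C (toE b), η j = 0) ∧ Cᵀ *ᵥ η = 0 ∧ η ⬝ᵥ b = 0 := by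
  classical
  set K := minActivatable C (toE b) with hKdef
  obtain ⟨δ, hδ, hlt⟩ := exists_lt_off_minActivatable (C := C) (b := toE b) (by rwa [polyE_toE])
  have h1 : ∀ j, ∃ η : Fin m → ℝ, 0 ≤ η ∧ (j ∈ K → 0 < η j) ∧ (∀ j ∉ K, η j = 0) ∧
      Cᵀ *ᵥ η = 0 := by
    intro j
    by_cases hj : j ∈ K
    -- Row `j` is constant on the polyhedron, so `-C j` is a normal at `δ`, a nonnegative
    -- combination of rows in `K`. Adding the unit vector at `j` gives a null combination positive
    -- at `j`.
    · obtain ⟨ψ, p1, p2, p3⟩ := exists_normal_multiplier C (toE b) δ hδ K hlt (-(C j)) (by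
        intro z' hz'
        have e1 := eq_of_mem_minActivatable hδ hj
        have e2 := eq_of_mem_minActivatable (show z' ∈ polyE C (toE b) from hz') hj
        rw [← e1, EReal.coe_eq_coe_iff] at e2
        have : C j ⬝ᵥ z' = C j ⬝ᵥ δ := e2
        simp [this])
      refine ⟨ψ + Pi.single j 1, add_nonneg p1 (by simp), fun _ => ?_, fun i hi => ?_, ?_⟩
      · have := p1 j
        simp only [Pi.add_apply, Pi.single_eq_same]
        simp only [Pi.zero_apply] at this
        linarith
      · have : i ≠ j := fun h => hi (h ▸ hj)
        simp [p2 i hi, this]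
      · rw [Matrix.mulVec_add, p3]
        ext i; simp
    · exact ⟨0, le_rfl, fun h => absurd h hj, by simp, by simp⟩
  choose η e1 e2 e3 e4 using h1
  refine ⟨∑ j, η j, fun j hj => ?_, fun j hj => ?_, ?_, ?_⟩
  · rw [Finset.sum_apply]
    exact Finset.sum_pos' (fun i _ => e1 i j) ⟨j, Finset.mem_univ _, e2 j hj⟩
  · rw [Finset.sum_apply]
    exact Finset.sum_eq_zero fun i _ => e3 i j hj
  · rw [Matrix.mulVec_sum]; simp [e4]
  · have h5 : (∑ j, η j) ⬝ᵥ b = (∑ j, η j) ⬝ᵥ (C *ᵥ δ) := by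
      refine Finset.sum_congr rfl fun j _ => ?_
      by_cases hj : j ∈ K
      · have := eq_of_mem_minActivatable hδ hj
        simp only [toE, EReal.coe_eq_coe_iff] at this
        rw [this]
      · simp [Finset.sum_apply, e3 _ j hj]
    rw [h5, Matrix.dotProduct_mulVec, ← Matrix.mulVec_transpose, Matrix.mulVec_sum]
    simp [e4]

end Activatable

/-! ### Projected polyhedra -/

section Projected

variable {m p k : ℕ}

lemma convex_ppolyE (B : Matrix (Fin m) (Fin p) ℝ) (h : Fin m → EReal)
    (C : Matrix (Fin m) (Fin k) ℝ) : Convex ℝ (ppolyE B h C) := by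
  rintro x ⟨δ, hx⟩ y ⟨δ', hy⟩ s t hs ht hst
  refine ⟨s • δ + t • δ', fun j => ?_⟩
  have h1 := hx j
  have h2 := hy j
  revert h1 h2
  induction h j with
  | bot => simp
  | top => simp
  | coe z =>
    simp only [EReal.coe_le_coe_iff, Matrix.mulVec_add, Matrix.mulVec_smul, Pi.add_apply,
      Pi.smul_apply, smul_eq_mul]
    intro h1 h2
    calc _ = s * ((B *ᵥ x) j + (C *ᵥ δ) j) + t * ((B *ᵥ y) j + (C *ᵥ δ') j) := by ring
      _ ≤ s * z + t * z := by gcongr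
      _ = z := by rw [← add_mul, hst, one_mul]

/-- Membership of `ν` says that the slack vector `h - B ν`, on the rows with finite `h`, lies in the
cone generated by plus and minus the columns of `C` and the unit vectors, which is closed. -/
lemma isClosed_ppolyE (B : Matrix (Fin m) (Fin p) ℝ) {h : Fin m → EReal} (h0 : ∀ j, h j ≠ ⊥)
    (C : Matrix (Fin m) (Fin k) ℝ) : IsClosed (ppolyE B h C) := by
  classical
  let J : Type := {j : Fin m // h j ≠ ⊤}
  let v : Fin k ⊕ (Fin k ⊕ J) → J → ℝ :=
    Sum.elim (fun i j => C j i) (Sum.elim (fun i j => -C j i) (fun j => Pi.single j 1))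
  have hcl := isClosed_conic v
  let f : (Fin p → ℝ) → J → ℝ := fun ν j => (h j).toReal - (B *ᵥ ν) j
  have hf : Continuous f := by
    refine continuous_pi fun j => continuous_const.sub ?_
    simp only [Matrix.mulVec, dotProduct]
    fun_prop
  convert hcl.preimage hf using 1
  ext ν
  simp only [ppolyE, Set.mem_ofPred_eq, Set.mem_preimage]
  constructor
  · rintro ⟨δ, hδ⟩
    refine ⟨Sum.elim (fun i => max (δ i) 0) (Sum.elim (fun i => max (-δ i) 0)
      (fun j => (h j).toReal - (B *ᵥ ν + C *ᵥ δ) j)), ?_, ?_⟩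
    · rintro (i | i | j)
      · exact le_max_right _ _
      · exact le_max_right _ _
      · have := hδ j
        rw [← EReal.coe_toReal j.2 (h0 j), EReal.coe_le_coe_iff] at this
        simpa using this
    · ext j
      have hmax : ∀ x : ℝ, max x 0 - max (-x) 0 = x := fun x => by
        rcases le_total x 0 with hx | hx <;> simp [hx]
      simp only [Fintype.sum_sum_type, Sum.elim_inl, Sum.elim_inr, Pi.add_apply,
        Finset.sum_apply, Pi.smul_apply, smul_eq_mul, v, f]
      have e1 : ∑ i, max (δ i) 0 * C j i + ∑ i, max (-δ i) 0 * -C j i = (C *ᵥ δ) j := by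
        rw [← Finset.sum_add_distrib]
        refine Finset.sum_congr rfl fun i _ => ?_
        conv_rhs => rw [← hmax (δ i)]
        ring
      have e2 : ∑ x : J, ((h x).toReal - ((B *ᵥ ν) x + (C *ᵥ δ) x)) * (Pi.single x 1 : J → ℝ) j =
          (h j).toReal - ((B *ᵥ ν) j + (C *ᵥ δ) j) := by
        rw [Finset.sum_eq_single j]
        · simp
        · intro b _ hb; simp [hb.symm]
        · simp
      rw [e2, ← add_assoc, e1]
      ring
  · rintro ⟨ψ, h1, h2⟩
    refine ⟨fun i => ψ (Sum.inl i) - ψ (Sum.inr (Sum.inl i)), fun j => ?_⟩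
    by_cases hj : h j = ⊤
    · simp [hj]
    · have := congrFun h2 ⟨j, hj⟩
      simp only [Fintype.sum_sum_type, Sum.elim_inl, Sum.elim_inr,
        Finset.sum_apply, Pi.smul_apply, smul_eq_mul, v, f] at this
      have e2 : ∑ x : J, ψ (Sum.inr (Sum.inr x)) * (Pi.single x 1 : J → ℝ) ⟨j, hj⟩ =
          ψ (Sum.inr (Sum.inr ⟨j, hj⟩)) := by
        rw [Finset.sum_eq_single ⟨j, hj⟩]
        · simp
        · intro b _ hb; simp [hb.symm]
        · simp
      have e1 : ∑ i, ψ (Sum.inl i) * C j i + ∑ i, ψ (Sum.inr (Sum.inl i)) * -C j i =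
          (C *ᵥ fun i => ψ (Sum.inl i) - ψ (Sum.inr (Sum.inl i))) j := by
        rw [← Finset.sum_add_distrib]
        refine Finset.sum_congr rfl fun i _ => ?_
        ring
      have e3 := h1 (Sum.inr (Sum.inr ⟨j, hj⟩))
      rw [e2, ← add_assoc, e1] at this
      rw [← EReal.coe_toReal hj (h0 j), EReal.coe_le_coe_iff, Pi.add_apply]
      simp only [Pi.zero_apply] at e3
      linarith

lemma isClosed_ppoly (B : Matrix (Fin m) (Fin p) ℝ) (d : Fin m → ℝ)
    (C : Matrix (Fin m) (Fin k) ℝ) : IsClosed (ppoly B d C) := by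
  rw [← ppolyE_toE]
  exact isClosed_ppolyE B (fun j => EReal.coe_ne_bot _) C

/-- Normal vectors of a projected polyhedron. -/
lemma exists_ppolyE_multiplier (B : Matrix (Fin m) (Fin p) ℝ) (C : Matrix (Fin m) (Fin k) ℝ)
    (h : Fin m → EReal) {ν : Fin p → ℝ} {w : Fin k → ℝ}
    (hw : ∀ j, (((B *ᵥ ν + C *ᵥ w) j : ℝ) : EReal) ≤ h j) (K : Set (Fin m))
    (hK : ∀ j ∉ K, (((B *ᵥ ν + C *ᵥ w) j : ℝ) : EReal) < h j) (y : Fin p → ℝ)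
    (hy : ∀ ν' ∈ ppolyE B h C, y ⬝ᵥ (ν' - ν) ≤ 0) :
    ∃ ψ : Fin m → ℝ, 0 ≤ ψ ∧ (∀ j ∉ K, ψ j = 0) ∧ Bᵀ *ᵥ ψ = y ∧ Cᵀ *ᵥ ψ = 0 := by
  have hG : ∀ z : Fin p ⊕ Fin k → ℝ, Matrix.fromCols B C *ᵥ z =
      B *ᵥ (z ∘ Sum.inl) + C *ᵥ (z ∘ Sum.inr) := fun z => Matrix.fromCols_mulVec _ _ _
  -- View `y` as a functional of `(ν, w)` that ignores `w`: its two blocks give the equations for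
  -- `B` and `C`.
  obtain ⟨ψ, h1, h2, h3⟩ := exists_normal_multiplier (Matrix.fromCols B C) h (Sum.elim ν w)
    (by simpa [hG] using hw) K (by simpa [hG] using hK) (Sum.elim y 0) (by
      intro z' hz'
      have := hy (z' ∘ Sum.inl) ⟨z' ∘ Sum.inr, by simpa [hG] using hz'⟩
      simpa [dotProduct, Fintype.sum_sum_type] using this)
  rw [Matrix.transpose_fromCols, Matrix.fromRows_mulVec] at h3
  exact ⟨ψ, h1, h2, by simpa using congrArg (· ∘ Sum.inl) h3,
    by simpa using congrArg (· ∘ Sum.inr) h3⟩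

end Projected

/-! ### Matrices of stable rank -/

section StableRank

variable {m p k : ℕ}

lemma abs_mulVec_sub_le {κ ι : Type*} [Fintype κ] [Fintype ι] (A A' : Matrix κ ι ℝ) (v : ι → ℝ) :
    ‖A *ᵥ v - A' *ᵥ v‖ ≤ (∑ i, ∑ j, |A i j - A' i j|) * ‖v‖ := by
  refine (pi_norm_le_iff_of_nonneg (by positivity)).mpr fun i => ?_
  rw [← Matrix.sub_mulVec, Real.norm_eq_abs]
  calc |∑ j, (A - A') i j * v j| ≤ ∑ j, |(A - A') i j * v j| := Finset.abs_sum_le_sum_abs _ _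
    _ ≤ ∑ j, |A i j - A' i j| * ‖v‖ := by
        refine Finset.sum_le_sum fun j _ => ?_
        rw [abs_mul, Matrix.sub_apply]
        gcongr
        exact norm_le_pi_norm v j
    _ = (∑ j, |A i j - A' i j|) * ‖v‖ := (Finset.sum_mul _ _ _).symm
    _ ≤ _ := by
        gcongr
        exact Finset.single_le_sum (f := fun i => ∑ j, |A i j - A' i j|)
          (fun i _ => by positivity) (Finset.mem_univ i)

/-- Along a convergent sequence of matrices of stable rank, every element of the range has a
preimage whose norm is uniformly controlled. -/
lemma exists_bounded_preimage {κ ι α : Type*} [Fintype κ] [Fintype ι] {l : Filter α}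
    {As : α → Matrix κ ι ℝ} {A : Matrix κ ι ℝ} (hA : Tendsto As l (𝓝 A))
    (hr : ∀ᶠ q in l, (As q).rank = A.rank) :
    ∃ c : ℝ, 0 ≤ c ∧ ∀ᶠ q in l, ∀ v, ∃ u, As q *ᵥ u = As q *ᵥ v ∧ ‖u‖ ≤ c * ‖As q *ᵥ v‖ := by
  -- The limit matrix is bounded below on a complement `U` of its kernel, and nearby matrices
  -- inherit this with half the constant.
  obtain ⟨U, hU⟩ := Submodule.exists_isCompl (LinearMap.ker A.mulVecLin)
  have hker : LinearMap.ker (A.mulVecLin ∘ₗ U.subtype) = ⊥ := by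
    rw [LinearMap.ker_eq_bot']
    intro u hu
    have : (u : ι → ℝ) ∈ LinearMap.ker A.mulVecLin ⊓ U := ⟨hu, u.2⟩
    rw [hU.inf_eq_bot] at this
    exact Subtype.ext this
  obtain ⟨K, hK0, hK⟩ := LinearMap.exists_antilipschitzWith _ hker
  have hKu : ∀ u ∈ U, ‖u‖ ≤ K * ‖A *ᵥ u‖ := fun u hu => by
    have := hK.le_mul_norm_sub 0 ⟨u, hu⟩
    simpa using this
  have hfr : Module.finrank ℝ U = A.rank := by
    have h1 := Submodule.finrank_add_eq_of_isCompl hU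
    have h2 := LinearMap.finrank_range_add_finrank_ker A.mulVecLin
    rw [Matrix.rank]
    omega
  have hε : Tendsto (fun q => ∑ i, ∑ j, |As q i j - A i j|) l (𝓝 0) := by
    have : ∀ i j, Tendsto (fun q => |As q i j - A i j|) l (𝓝 0) := fun i j => by
      have := ((tendsto_pi_nhds.mp ((tendsto_pi_nhds.mp hA) i)) j).sub_const (A i j)
      simpa using this.abs
    simpa using tendsto_finsetSum Finset.univ fun i _ =>
      tendsto_finsetSum Finset.univ fun j _ => this i j
  have hK0' : (0 : ℝ) < K := hK0
  refine ⟨2 * K, by positivity, ?_⟩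
  filter_upwards [hr, hε.eventually_lt_const (u := 1 / (2 * (K : ℝ))) (by positivity)] with q hq hεq
  have hlow : ∀ u ∈ U, ‖u‖ ≤ 2 * K * ‖As q *ᵥ u‖ := by
    intro u hu
    have h1 := hKu u hu
    have h2 := abs_mulVec_sub_le (As q) A u
    have h3 : ‖A *ᵥ u‖ ≤ ‖As q *ᵥ u‖ + ‖As q *ᵥ u - A *ᵥ u‖ := by
      have := norm_sub_le (As q *ᵥ u) (As q *ᵥ u - A *ᵥ u)
      simpa using this
    have h4 : (∑ i, ∑ j, |As q i j - A i j|) * ‖u‖ ≤ 1 / (2 * (K : ℝ)) * ‖u‖ := by gcongr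
    have h5 : K * (1 / (2 * (K : ℝ)) * ‖u‖) = ‖u‖ / 2 := by field_simp
    have h6 : K * ‖A *ᵥ u‖ ≤ K * (‖As q *ᵥ u‖ + 1 / (2 * (K : ℝ)) * ‖u‖) := by
      gcongr; linarith
    rw [mul_add, h5] at h6
    linarith
  have hinj : Function.Injective ((As q).mulVecLin ∘ₗ U.subtype) := by
    rw [← LinearMap.ker_eq_bot, LinearMap.ker_eq_bot']
    intro u hu
    have h1 := hlow u u.2
    have h2 : As q *ᵥ (u : ι → ℝ) = 0 := hu
    rw [h2, norm_zero, mul_zero] at h1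
    exact Subtype.ext (norm_le_zero_iff.mp h1)
  -- Here the rank enters: the image of `U` has dimension `A.rank`, so it exhausts the range of `As
  -- q`.
  have hrange : LinearMap.range ((As q).mulVecLin ∘ₗ U.subtype) =
      LinearMap.range (As q).mulVecLin := by
    refine Submodule.eq_of_le_of_finrank_eq (LinearMap.range_comp_le_range _ _) ?_
    rw [LinearMap.finrank_range_of_inj hinj, hfr, ← hq, Matrix.rank]
  intro v
  have hv : As q *ᵥ v ∈ LinearMap.range ((As q).mulVecLin ∘ₗ U.subtype) := by
    rw [hrange]; exact ⟨v, rfl⟩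
  obtain ⟨u, hu⟩ := hv
  have hu' : As q *ᵥ (u : ι → ℝ) = As q *ᵥ v := hu
  exact ⟨u, hu', hu' ▸ hlow u u.2⟩

/-- Extension of a vector indexed by `K` by zero. -/
def extendZero (K : Set (Fin m)) (v : K → ℝ) : Fin m → ℝ :=
  open Classical in fun j => if h : j ∈ K then v ⟨j, h⟩ else 0

lemma extendZero_of_mem {K : Set (Fin m)} (v : K → ℝ) (j : K) : extendZero K v j = v j := by
  simp [extendZero]

lemma extendZero_of_notMem {K : Set (Fin m)} (v : K → ℝ) {j : Fin m} (hj : j ∉ K) :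
    extendZero K v j = 0 := by
  simp [extendZero, hj]

lemma extendZero_comp {K : Set (Fin m)} {h : Fin m → ℝ} (hh : ∀ j ∉ K, h j = 0) :
    extendZero K (fun j => h j) = h := by
  ext j
  by_cases hj : j ∈ K
  · simp [extendZero, hj]
  · rw [extendZero_of_notMem _ hj, hh j hj]

lemma transpose_mulVec_extendZero {ι : Type*} (C : Matrix (Fin m) ι ℝ) (K : Set (Fin m))
    [Fintype K] (v : K → ℝ) :
    Cᵀ *ᵥ extendZero K v = (C.submatrix (Subtype.val : K → Fin m) id)ᵀ *ᵥ v := by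
  classical
  ext i
  simp only [Matrix.mulVec, dotProduct, Matrix.transpose_apply, Matrix.submatrix_apply, id]
  refine (Fintype.sum_of_injective Subtype.val Subtype.val_injective _ _ (fun j hj => ?_)
    fun j => ?_).symm
  · rw [extendZero_of_notMem v (by simpa using hj), mul_zero]
  · rw [extendZero_of_mem]

lemma tendsto_extendZero {α : Type*} {l : Filter α} {K : Set (Fin m)} {vs : α → K → ℝ} {v : K → ℝ}
    (hv : Tendsto vs l (𝓝 v)) :
    Tendsto (fun q => extendZero K (vs q)) l (𝓝 (extendZero K v)) := by
  refine tendsto_pi_nhds.mpr fun j => ?_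
  by_cases hj : j ∈ K
  · simpa [extendZero, hj] using (tendsto_pi_nhds.mp hv) ⟨j, hj⟩
  · simpa [extendZero, hj] using tendsto_const_nhds

lemma tendsto_submatrix {α : Type*} {l : Filter α} {Cs : α → Matrix (Fin m) (Fin k) ℝ}
    {C : Matrix (Fin m) (Fin k) ℝ} (hC : Tendsto Cs l (𝓝 C)) (K : Set (Fin m)) :
    Tendsto (fun q => (Cs q).submatrix (Subtype.val : K → Fin m) id) l
      (𝓝 (C.submatrix (Subtype.val : K → Fin m) id)) :=
  tendsto_pi_nhds.mpr fun j => tendsto_pi_nhds.mpr fun i =>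
    (tendsto_pi_nhds.mp ((tendsto_pi_nhds.mp hC) j)) i

lemma tendsto_mulVec {α κ ι : Type*} [Fintype ι] {l : Filter α} {As : α → Matrix κ ι ℝ}
    {A : Matrix κ ι ℝ} (hA : Tendsto As l (𝓝 A)) {vs : α → ι → ℝ} {v : ι → ℝ}
    (hv : Tendsto vs l (𝓝 v)) : Tendsto (fun q => As q *ᵥ vs q) l (𝓝 (A *ᵥ v)) :=
  tendsto_pi_nhds.mpr fun i => tendsto_finsetSum _ fun j _ =>
    ((tendsto_pi_nhds.mp ((tendsto_pi_nhds.mp hA) i)) j).mul ((tendsto_pi_nhds.mp hv) j)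

lemma tendsto_transpose {α κ ι : Type*} {l : Filter α} {As : α → Matrix κ ι ℝ}
    {A : Matrix κ ι ℝ} (hA : Tendsto As l (𝓝 A)) : Tendsto (fun q => (As q)ᵀ) l (𝓝 Aᵀ) :=
  tendsto_pi_nhds.mpr fun j => tendsto_pi_nhds.mpr fun i =>
    (tendsto_pi_nhds.mp ((tendsto_pi_nhds.mp hA) i)) j

/-- If the rank of the rows in `K` is stable, elements of the left null space with support in `K`
are limits of such elements. -/
lemma exists_tendsto_leftKer {α : Type*} {l : Filter α} {Cs : α → Matrix (Fin m) (Fin k) ℝ}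
    {C : Matrix (Fin m) (Fin k) ℝ} (hC : Tendsto Cs l (𝓝 C)) {K : Set (Fin m)}
    (hr : ∀ᶠ q in l, rowRank (Cs q) K = rowRank C K) {η : Fin m → ℝ}
    (hη : ∀ j ∉ K, η j = 0) (hCη : Cᵀ *ᵥ η = 0) :
    ∃ ηs : α → Fin m → ℝ, Tendsto ηs l (𝓝 η) ∧
      ∀ᶠ q in l, (∀ j ∉ K, ηs q j = 0) ∧ (Cs q)ᵀ *ᵥ ηs q = 0 := by
  classical
  have hA := tendsto_transpose (tendsto_submatrix hC K)
  -- The transposed rows nearly annihilate `η`; a small vector with the same image is subtracted to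
  -- annihilate it exactly.
  obtain ⟨c, hc, H⟩ := exists_bounded_preimage hA (by
    filter_upwards [hr] with q hq
    rw [Matrix.rank_transpose, Matrix.rank_transpose]; exact hq)
  set v : K → ℝ := fun j => η j with hv
  have hη' : extendZero K v = η := extendZero_comp hη
  have hAv : (C.submatrix (Subtype.val : K → Fin m) id)ᵀ *ᵥ v = 0 := by
    rw [← transpose_mulVec_extendZero, hη', hCη]
  have hlim : Tendsto (fun q => ((Cs q).submatrix (Subtype.val : K → Fin m) id)ᵀ *ᵥ v) l (𝓝 0) := by
    rw [← hAv]; exact tendsto_mulVec hA tendsto_const_nhds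
  let P : α → (K → ℝ) → Prop := fun q u =>
    ((Cs q).submatrix (Subtype.val : K → Fin m) id)ᵀ *ᵥ u =
      ((Cs q).submatrix (Subtype.val : K → Fin m) id)ᵀ *ᵥ v ∧
      ‖u‖ ≤ c * ‖((Cs q).submatrix (Subtype.val : K → Fin m) id)ᵀ *ᵥ v‖
  let u : α → K → ℝ := fun q => Classical.epsilon (P q)
  have hu : ∀ᶠ q in l, P q (u q) := by
    filter_upwards [H] with q hq using Classical.epsilon_spec (hq v)
  have hu0 : Tendsto u l (𝓝 0) := by
    rw [tendsto_zero_iff_norm_tendsto_zero]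
    refine squeeze_zero' (Eventually.of_forall fun _ => norm_nonneg _)
      (hu.mono fun q hq => hq.2) (by simpa using hlim.norm.const_mul c)
  refine ⟨fun q => extendZero K (v - u q), ?_, ?_⟩
  · rw [← hη']
    exact tendsto_extendZero (by simpa using hu0.const_sub v)
  · filter_upwards [hu] with q hq
    refine ⟨fun j hj => extendZero_of_notMem _ hj, ?_⟩
    rw [transpose_mulVec_extendZero, Matrix.mulVec_sub, hq.1, sub_self]

/-- If the rank of the rows in `K` is stable, small elements of the range of these rows have small
preimages. -/
lemma exists_tendsto_preimage {α : Type*} {l : Filter α} {Cs : α → Matrix (Fin m) (Fin k) ℝ}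
    {C : Matrix (Fin m) (Fin k) ℝ} (hC : Tendsto Cs l (𝓝 C)) {K : Set (Fin m)}
    (hr : ∀ᶠ q in l, rowRank (Cs q) K = rowRank C K) {zs : α → Fin k → ℝ}
    (hz : ∀ j ∈ K, Tendsto (fun q => (Cs q *ᵥ zs q) j) l (𝓝 0)) :
    ∃ us : α → Fin k → ℝ, Tendsto us l (𝓝 0) ∧
      ∀ᶠ q in l, ∀ j ∈ K, (Cs q *ᵥ us q) j = (Cs q *ᵥ zs q) j := by
  classical
  obtain ⟨c, hc, H⟩ := exists_bounded_preimage (tendsto_submatrix hC K) hr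
  have e : ∀ q (z : Fin k → ℝ) (j : K),
      ((Cs q).submatrix (Subtype.val : K → Fin m) id *ᵥ z) j = (Cs q *ᵥ z) j := fun q z j => rfl
  let P : α → (Fin k → ℝ) → Prop := fun q u =>
    (Cs q).submatrix (Subtype.val : K → Fin m) id *ᵥ u =
      (Cs q).submatrix (Subtype.val : K → Fin m) id *ᵥ zs q ∧
      ‖u‖ ≤ c * ‖(Cs q).submatrix (Subtype.val : K → Fin m) id *ᵥ zs q‖
  let u : α → Fin k → ℝ := fun q => Classical.epsilon (P q)
  have hu : ∀ᶠ q in l, P q (u q) := by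
    filter_upwards [H] with q hq using Classical.epsilon_spec (hq (zs q))
  have hlim : Tendsto (fun q => (Cs q).submatrix (Subtype.val : K → Fin m) id *ᵥ zs q) l (𝓝 0) :=
    tendsto_pi_nhds.mpr fun j => by simpa [e] using hz j j.2
  refine ⟨u, ?_, ?_⟩
  · rw [tendsto_zero_iff_norm_tendsto_zero]
    exact squeeze_zero' (Eventually.of_forall fun _ => norm_nonneg _)
      (hu.mono fun q hq => hq.2) (by simpa using hlim.norm.const_mul c)
  · filter_upwards [hu] with q hq j hj
    exact congrFun hq.1 ⟨j, hj⟩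

/-- The span `{B' η : η' C = 0, supp η ⊆ K}`. -/
def normSpan (B : Matrix (Fin m) (Fin p) ℝ) (C : Matrix (Fin m) (Fin k) ℝ) (K : Set (Fin m)) :
    Submodule ℝ (Fin p → ℝ) where
  carrier := {y | ∃ η : Fin m → ℝ, (∀ j ∉ K, η j = 0) ∧ Cᵀ *ᵥ η = 0 ∧ Bᵀ *ᵥ η = y}
  add_mem' := by
    rintro _ _ ⟨a, a1, a2, rfl⟩ ⟨b, b1, b2, rfl⟩
    exact ⟨a + b, fun j hj => by simp [a1 j hj, b1 j hj], by simp [Matrix.mulVec_add, a2, b2],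
      Matrix.mulVec_add _ _ _⟩
  zero_mem' := ⟨0, by simp, by simp, by simp⟩
  smul_mem' := by
    rintro c _ ⟨a, a1, a2, rfl⟩
    exact ⟨c • a, fun j hj => by simp [a1 j hj], by simp [Matrix.mulVec_smul, a2],
      Matrix.mulVec_smul _ _ _⟩

/-- Rank-nullity: `normSpan` is the image under `B'` of the left kernel of the rows of `C` in `K`,
and what is lost is the left kernel of the rows of `[B, C]`. A difference of ranks thus becomes a
dimension of normals. -/
lemma finrank_normSpan_add (B : Matrix (Fin m) (Fin p) ℝ) (C : Matrix (Fin m) (Fin k) ℝ)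
    (K : Set (Fin m)) :
    Module.finrank ℝ (normSpan B C K) + rowRank C K = rowRank (Matrix.fromCols B C) K := by
  classical
  let f := ((C.submatrix (Subtype.val : K → Fin m) id)ᵀ).mulVecLin
  let g := ((B.submatrix (Subtype.val : K → Fin m) id)ᵀ).mulVecLin
  let e := (((Matrix.fromCols B C).submatrix (Subtype.val : K → Fin m) id)ᵀ).mulVecLin
  have hS : normSpan B C K = (LinearMap.ker f).map g := by
    ext y
    constructor
    · rintro ⟨η, h1, h2, rfl⟩
      rw [← extendZero_comp h1, transpose_mulVec_extendZero] at h2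
      rw [← extendZero_comp h1, transpose_mulVec_extendZero]
      exact ⟨_, h2, rfl⟩
    · rintro ⟨v, hv, rfl⟩
      exact ⟨extendZero K v, fun j hj => extendZero_of_notMem v hj,
        (transpose_mulVec_extendZero _ _ _).trans hv, transpose_mulVec_extendZero _ _ _⟩
  have hker : LinearMap.ker e = LinearMap.ker f ⊓ LinearMap.ker g := by
    ext v
    have : e v = Sum.elim (g v) (f v) := by
      ext (i | i) <;> rfl
    simp only [LinearMap.mem_ker, Submodule.mem_inf, this]
    constructor
    · intro h
      exact ⟨funext fun i => congrFun h (Sum.inr i), funext fun i => congrFun h (Sum.inl i)⟩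
    · rintro ⟨h1, h2⟩
      rw [h1, h2]; ext (i | i) <;> rfl
  have h1 := LinearMap.finrank_range_add_finrank_ker f
  have h2 := LinearMap.finrank_range_add_finrank_ker e
  have h3 := LinearMap.finrank_range_add_finrank_ker (g ∘ₗ (LinearMap.ker f).subtype)
  have h4 : LinearMap.range (g ∘ₗ (LinearMap.ker f).subtype) = (LinearMap.ker f).map g := by
    rw [LinearMap.range_comp, Submodule.range_subtype]
  have h5 : Module.finrank ℝ (LinearMap.ker (g ∘ₗ (LinearMap.ker f).subtype)) =
      Module.finrank ℝ (LinearMap.ker e) := by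
    rw [hker, LinearMap.ker_comp, ← Submodule.finrank_map_subtype_eq, Submodule.map_comap_subtype]
  have r1 : rowRank C K = Module.finrank ℝ (LinearMap.range f) := by
    rw [rowRank, ← Matrix.rank_transpose]; rfl
  have r2 : rowRank (Matrix.fromCols B C) K = Module.finrank ℝ (LinearMap.range e) := by
    rw [rowRank, ← Matrix.rank_transpose]; rfl
  rw [h4, ← hS, h5] at h3
  omega

/-- `[B, B P + D]` is `[B, D]` times an invertible block triangular matrix, so its row ranks do not
depend on `P`. -/
lemma rowRank_fromCols_mul_add (B : Matrix (Fin m) (Fin p) ℝ) (D : Matrix (Fin m) (Fin k) ℝ)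
    (P : Matrix (Fin p) (Fin k) ℝ) (K : Set (Fin m)) :
    rowRank (Matrix.fromCols B (B * P + D)) K = rowRank (Matrix.fromCols B D) K := by
  let E : Matrix (Fin p ⊕ Fin k) (Fin p ⊕ Fin k) ℝ := Matrix.fromBlocks 1 P 0 1
  have h : Matrix.fromCols B (B * P + D) = Matrix.fromCols B D * E := by
    rw [Matrix.fromCols_mul_fromBlocks]
    simp
  have hE : IsUnit E.det := by simp [E]
  rw [rowRank, rowRank, h]
  exact Matrix.rank_mul_eq_left_of_isUnit_det E
    ((Matrix.fromCols B D).submatrix (Subtype.val : K → Fin m) id) hE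

end StableRank

/-! ### Minimum norm points -/

section MinNorm

variable {m k : ℕ}

lemma eNorm_eq_sqrt (x : Fin k → ℝ) : eNorm x = √(x ⬝ᵥ x) := by
  rw [eNorm, EuclideanSpace.norm_eq]
  simp [dotProduct, sq]

lemma eNorm_le_iff {x y : Fin k → ℝ} : eNorm x ≤ eNorm y ↔ x ⬝ᵥ x ≤ y ⬝ᵥ y := by
  rw [eNorm_eq_sqrt, eNorm_eq_sqrt, Real.sqrt_le_sqrt_iff]
  exact Finset.sum_nonneg fun i _ => mul_self_nonneg _

lemma continuous_eNorm : Continuous (eNorm : (Fin k → ℝ) → ℝ) := by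
  unfold eNorm
  fun_prop

lemma isClosed_poly (C : Matrix (Fin m) (Fin k) ℝ) (b : Fin m → ℝ) : IsClosed (poly C b) := by
  refine isClosed_le ?_ continuous_const
  fun_prop

lemma convex_poly (C : Matrix (Fin m) (Fin k) ℝ) (b : Fin m → ℝ) : Convex ℝ (poly C b) := by
  rw [← polyE_toE]
  exact convex_polyE C _

lemma minNormPoint_spec {C : Matrix (Fin m) (Fin k) ℝ} {b : Fin m → ℝ}
    (hne : (poly C b).Nonempty) :
    minNormPoint (poly C b) ∈ poly C b ∧
      ∀ δ' ∈ poly C b, eNorm (minNormPoint (poly C b)) ≤ eNorm δ' := by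
  obtain ⟨z, hz, hmin⟩ := exists_quadForm_min (1 : Matrix (Fin k) (Fin k) ℝ) (c := 1) one_pos
    (fun x => by simpa using sq_norm_le_dotProduct_self x) 0 (isClosed_poly C b) hne
  exact Classical.epsilon_spec (p := fun δ => δ ∈ poly C b ∧ ∀ δ' ∈ poly C b, eNorm δ ≤ eNorm δ')
    ⟨z, hz, fun z' hz' => eNorm_le_iff.mpr (by simpa using hmin z' hz')⟩

/-- The variational inequality at the minimum norm point gives `‖δ - z‖ ^ 2 ≤ ‖δ‖ ^ 2 - ‖z‖ ^ 2` in
the Euclidean norm. -/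
lemma eq_minNormPoint {C : Matrix (Fin m) (Fin k) ℝ} {b : Fin m → ℝ} {δ : Fin k → ℝ}
    (hδ : δ ∈ poly C b) (hle : eNorm δ ≤ eNorm (minNormPoint (poly C b))) :
    δ = minNormPoint (poly C b) := by
  obtain ⟨h1, h2⟩ := minNormPoint_spec ⟨δ, hδ⟩
  set z := minNormPoint (poly C b)
  have hv := quadForm_min_variational (x := 0) Matrix.isSymm_one (convex_poly C b) h1
    (fun z' hz' => by simpa using eNorm_le_iff.mp (h2 z' hz')) hδ
  have h3 := eNorm_le_iff.mp hle
  have h4 : (δ - z) ⬝ᵥ (δ - z) ≤ 0 := by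
    simp only [Matrix.one_mulVec, zero_sub, neg_dotProduct, dotProduct_sub, sub_dotProduct] at hv ⊢
    rw [dotProduct_comm δ z]
    linarith
  have h5 := (sq_norm_le_dotProduct_self (δ - z)).trans h4
  have h6 : ‖δ - z‖ = 0 := by nlinarith [norm_nonneg (δ - z)]
  exact sub_eq_zero.mp (norm_eq_zero.mp h6)

lemma norm_le_eNorm (x : Fin k → ℝ) : ‖x‖ ≤ eNorm x := by
  rw [eNorm_eq_sqrt]
  exact Real.le_sqrt_of_sq_le (sq_norm_le_dotProduct_self x)

/-- Under stable rank of the rows in the minimal activatable set, points of the limiting polyhedron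
at which no other row is active are limits of points of the approximating polyhedra. -/
lemma exists_tendsto_poly {Cs : ℕ → Matrix (Fin m) (Fin k) ℝ} {C : Matrix (Fin m) (Fin k) ℝ}
    {bs : ℕ → Fin m → ℝ} {b : Fin m → ℝ} (hC : Tendsto Cs atTop (𝓝 C))
    (hb : Tendsto bs atTop (𝓝 b)) (hne : ∀ᶠ q in atTop, (poly (Cs q) (bs q)).Nonempty)
    (hr : ∀ᶠ q in atTop, rowRank (Cs q) (minActivatable C (toE b)) =
      rowRank C (minActivatable C (toE b)))
    {δ : Fin k → ℝ} (hδ : δ ∈ poly C b)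
    (hlt : ∀ j ∉ minActivatable C (toE b), (C *ᵥ δ) j < b j) :
    ∃ δs : ℕ → Fin k → ℝ, Tendsto δs atTop (𝓝 δ) ∧ ∀ᶠ q in atTop, δs q ∈ poly (Cs q) (bs q) := by
  set K := minActivatable C (toE b) with hK
  -- A null combination, positive on `K`, is lifted to `ηs`. At any feasible point its weighted
  -- slack is `ηs q ⬝ᵥ bs q`, which vanishes in the limit, so the rows in `K` are asymptotically
  -- equalities.
  obtain ⟨η, e1, e2, e3, e4⟩ := exists_pos_on_minActivatable ⟨δ, hδ⟩
  obtain ⟨ηs, l1, l2⟩ := exists_tendsto_leftKer hC hr e2 e3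
  let δ' : ℕ → Fin k → ℝ := fun q => Classical.epsilon fun z => z ∈ poly (Cs q) (bs q)
  have hδ' : ∀ᶠ q in atTop, δ' q ∈ poly (Cs q) (bs q) := by
    filter_upwards [hne] with q hq using Classical.epsilon_spec hq
  have hpos : ∀ᶠ q in atTop, ∀ j ∈ K, 0 < ηs q j := by
    have : ∀ j, ∀ᶠ q in atTop, j ∈ K → 0 < ηs q j := fun j => by
      by_cases hj : j ∈ K
      · filter_upwards [((tendsto_pi_nhds.mp l1) j).eventually_const_lt (e1 j hj)] with q hq _ using hq
      · exact Eventually.of_forall fun q h => absurd h hj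
    filter_upwards [eventually_all.mpr this] with q hq j hj using hq j hj
  have hdot : Tendsto (fun q => ηs q ⬝ᵥ bs q) atTop (𝓝 0) := by
    rw [← e4]
    exact tendsto_finsetSum _ fun j _ => ((tendsto_pi_nhds.mp l1) j).mul ((tendsto_pi_nhds.mp hb) j)
  have hs : ∀ j ∈ K, Tendsto (fun q => bs q j - (Cs q *ᵥ δ' q) j) atTop (𝓝 0) := by
    intro j hj
    have h1 : Tendsto (fun q => ηs q j * (bs q j - (Cs q *ᵥ δ' q) j)) atTop (𝓝 0) := by
      refine squeeze_zero' ?_ ?_ hdot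
      · filter_upwards [hδ', hpos] with q h1 h2
        exact mul_nonneg (h2 j hj).le (sub_nonneg.mpr (h1 j))
      · filter_upwards [hδ', hpos, l2] with q h1 h2 h3
        have h4 : ηs q ⬝ᵥ (Cs q *ᵥ δ' q) = 0 := by
          rw [Matrix.dotProduct_mulVec, ← Matrix.mulVec_transpose, h3.2, zero_dotProduct]
        have h5 : ηs q ⬝ᵥ bs q = ∑ j, ηs q j * (bs q j - (Cs q *ᵥ δ' q) j) := by
          rw [← sub_zero (ηs q ⬝ᵥ bs q), ← h4, ← dotProduct_sub]; rfl
        rw [h5]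
        refine Finset.single_le_sum (f := fun j => ηs q j * (bs q j - (Cs q *ᵥ δ' q) j))
          (fun i _ => ?_) (Finset.mem_univ j)
        by_cases hi : i ∈ K
        · exact mul_nonneg (h2 i hi).le (sub_nonneg.mpr (h1 i))
        · simp [h3.1 i hi]
    have h2 := h1.div ((tendsto_pi_nhds.mp l1) j) (e1 j hj).ne'
    rw [zero_div] at h2
    refine h2.congr' ?_
    filter_upwards [hpos] with q hq
    simp only [Pi.div_apply]
    exact mul_div_cancel_left₀ _ (hq j hj).ne'
  have hCδ := tendsto_mulVec hC (tendsto_const_nhds (x := δ))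
  -- The small correction `us` makes `δ + us q` agree with the feasible point `δ' q` in the rows of
  -- `K`; the other rows are slack.
  obtain ⟨us, u1, u2⟩ := exists_tendsto_preimage hC hr (zs := fun q => δ' q - δ) (fun j hj => by
    have h1 := eq_of_mem_minActivatable (show δ ∈ polyE C (toE b) by rwa [polyE_toE]) hj
    simp only [toE, EReal.coe_eq_coe_iff] at h1
    have h2 := (((tendsto_pi_nhds.mp hb) j).sub (hs j hj)).sub ((tendsto_pi_nhds.mp hCδ) j)
    rw [h1, sub_zero, sub_self] at h2
    refine h2.congr fun q => ?_
    rw [Matrix.mulVec_sub, Pi.sub_apply]; ring)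
  have hlim : Tendsto (fun q => δ + us q) atTop (𝓝 δ) := by simpa using u1.const_add δ
  refine ⟨fun q => δ + us q, hlim, ?_⟩
  have hoff : ∀ᶠ q in atTop, ∀ j, j ∉ K → (Cs q *ᵥ (δ + us q)) j ≤ bs q j := by
    rw [eventually_all]
    intro j
    by_cases hj : j ∈ K
    · exact Eventually.of_forall fun q h => absurd hj h
    · filter_upwards [((tendsto_pi_nhds.mp (tendsto_mulVec hC hlim)) j).eventually_lt
        ((tendsto_pi_nhds.mp hb) j) (hlt j hj)] with q hq _ using hq.le
  filter_upwards [hoff, u2, hδ'] with q h1 h2 h3 j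
  by_cases hj : j ∈ K
  · rw [Matrix.mulVec_add, Pi.add_apply, h2 j hj, Matrix.mulVec_sub, Pi.sub_apply]
    have := h3 j
    linarith
  · exact h1 j hj

/-- Continuity of the minimum norm point under stable rank of the minimal activatable set. -/
lemma tendsto_minNormPoint {Cs : ℕ → Matrix (Fin m) (Fin k) ℝ} {C : Matrix (Fin m) (Fin k) ℝ}
    {bs : ℕ → Fin m → ℝ} {b : Fin m → ℝ} (hC : Tendsto Cs atTop (𝓝 C))
    (hb : Tendsto bs atTop (𝓝 b)) (hne : ∀ᶠ q in atTop, (poly (Cs q) (bs q)).Nonempty)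
    (hne' : (poly C b).Nonempty)
    (hr : ∀ᶠ q in atTop, rowRank (Cs q) (minActivatable C (toE b)) =
      rowRank C (minActivatable C (toE b))) :
    Tendsto (fun q => minNormPoint (poly (Cs q) (bs q))) atTop (𝓝 (minNormPoint (poly C b))) := by
  obtain ⟨hz, hzmin⟩ := minNormPoint_spec hne'
  set z := minNormPoint (poly C b) with hzdef
  obtain ⟨δ₀, h1, h2⟩ := exists_lt_off_minActivatable (C := C) (b := toE b) (by rwa [polyE_toE])
  -- Moving from `z` slightly towards `δ₀` makes all rows outside the minimal activatable set
  -- strict, so the perturbed point can be approximated by feasible points.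
  have hup : ∀ ε > 0, ∀ᶠ q in atTop, eNorm (minNormPoint (poly (Cs q) (bs q))) ≤ eNorm z + ε := by
    intro ε hε
    have hcont : Continuous fun t : ℝ => eNorm (t • δ₀ + (1 - t) • z) :=
      continuous_eNorm.comp (by fun_prop)
    have hlim : Tendsto (fun t : ℝ => eNorm (t • δ₀ + (1 - t) • z)) (𝓝[>] 0) (𝓝 (eNorm z)) := by
      simpa using (hcont.tendsto 0).mono_left nhdsWithin_le_nhds
    obtain ⟨t, ht1, ht2⟩ := ((hlim.eventually_lt_const (u := eNorm z + ε) (by linarith)).and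
      (Ioo_mem_nhdsGT (zero_lt_one' ℝ))).exists
    have e : ∀ j, (C *ᵥ (t • δ₀ + (1 - t) • z)) j = t * (C *ᵥ δ₀) j + (1 - t) * (C *ᵥ z) j :=
      fun j => by simp [Matrix.mulVec_add, Matrix.mulVec_smul]
    have ht3 : 0 ≤ 1 - t := by linarith [ht2.2]
    obtain ⟨δs, d1, d2⟩ := exists_tendsto_poly hC hb hne hr (δ := t • δ₀ + (1 - t) • z)
      (convex_poly C b (by rwa [← polyE_toE]) hz ht2.1.le ht3 (by ring))
      (fun j hj => by
        have := lt_convexComb (h2 j hj) (show (((C *ᵥ z) j : ℝ) : EReal) ≤ toE b j from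
          EReal.coe_le_coe_iff.mpr (hz j)) ht2.1 ht3 (by ring)
        rw [e]
        exact EReal.coe_lt_coe_iff.mp this)
    filter_upwards [hne, d2, ((continuous_eNorm.tendsto _).comp d1).eventually_lt_const ht1]
      with q q1 q2 q3
    exact ((minNormPoint_spec q1).2 _ q2).trans q3.le
  have hbd : ∀ᶠ q in atTop, minNormPoint (poly (Cs q) (bs q)) ∈
      Metric.closedBall (0 : Fin k → ℝ) (eNorm z + 1) := by
    filter_upwards [hup 1 one_pos] with q hq
    simpa using (norm_le_eNorm _).trans hq
  -- Every cluster point is feasible with norm at most that of `z`, hence equals `z`.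
  refine tendsto_of_subseq_tendsto fun ns hns => ?_
  obtain ⟨a, -, φ, hφ, hlim⟩ := tendsto_subseq_of_frequently_bounded
    (Metric.isBounded_closedBall) (hns.eventually hbd).frequently
  refine ⟨φ, ?_⟩
  have hsub : Tendsto (fun n => ns (φ n)) atTop atTop := hns.comp hφ.tendsto_atTop
  have ha : a ∈ poly C b := by
    refine le_of_tendsto_of_tendsto (tendsto_mulVec (hC.comp hsub) hlim) (hb.comp hsub) ?_
    filter_upwards [hsub.eventually hne] with q hq using (minNormPoint_spec hq).1
  have hle : eNorm a ≤ eNorm z := by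
    refine le_of_forall_pos_le_add fun ε hε => ?_
    refine le_of_tendsto ((continuous_eNorm.tendsto _).comp hlim) ?_
    exact hsub.eventually (hup ε hε)
  have := eq_minNormPoint ha hle
  rw [← hzdef] at this
  rw [← this]
  exact hlim

end MinNorm

/-! ### The standard Gaussian measure of a Euclidean space -/

section StdGaussian

open scoped ENNReal RealInnerProductSpace

variable {E : Type*} [NormedAddCommGroup E] [InnerProductSpace ℝ E]

/-- The density of the standard Gaussian measure. -/
def gaussDensity (E : Type*) [NormedAddCommGroup E] [InnerProductSpace ℝ E] (x : E) : ℝ :=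
  ((2 * Real.pi) ^ (Module.finrank ℝ E / 2 : ℝ))⁻¹ * Real.exp (-‖x‖ ^ 2 / 2)

lemma gaussDensity_nonneg (x : E) : 0 ≤ gaussDensity E x := by
  unfold gaussDensity; positivity

lemma continuous_gaussDensity : Continuous (gaussDensity E) := by
  unfold gaussDensity; fun_prop

variable [FiniteDimensional ℝ E] [MeasurableSpace E] [BorelSpace E]

lemma integrable_gaussDensity : Integrable (gaussDensity E) := by
  unfold gaussDensity
  refine Integrable.const_mul ?_ _
  have h := (GaussianFourier.integrable_cexp_neg_mul_sq_norm_add (V := E) (b := (1 / 2 : ℂ))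
    (by norm_num) 0 0).re
  refine h.congr (Eventually.of_forall fun x => ?_)
  have : (-(1 / 2 : ℂ) * (‖x‖ : ℂ) ^ 2 + 0 * ((inner ℝ (0 : E) x : ℝ) : ℂ)) =
      ((-‖x‖ ^ 2 / 2 : ℝ) : ℂ) := by
    push_cast; ring
  simp only [this]
  rw [← Complex.ofReal_exp]
  exact Complex.ofReal_re _

/-- The characteristic functions agree by the Fourier transform of the Gaussian density. -/
lemma stdGaussian_eq_withDensity :
    stdGaussian E = volume.withDensity fun x => ENNReal.ofReal (gaussDensity E x) := by
  have hfin : IsFiniteMeasure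
      (volume.withDensity fun x : E => ENNReal.ofReal (gaussDensity E x)) := by
    refine isFiniteMeasure_withDensity_ofReal integrable_gaussDensity.2
  refine Measure.ext_of_charFun ?_
  ext t
  rw [charFun_stdGaussian, charFun_apply,
    integral_withDensity_eq_integral_toReal_smul
      (continuous_gaussDensity.measurable.ennreal_ofReal) (by simp)]
  have h := GaussianFourier.integral_cexp_neg_mul_sq_norm_add (V := E) (b := (1 / 2 : ℂ))
    (by norm_num) Complex.I t
  have e : ∀ x : E, (ENNReal.ofReal (gaussDensity E x)).toReal •
      Complex.exp ((⟪x, t⟫ : ℝ) * Complex.I) =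
      (((2 * Real.pi) ^ (Module.finrank ℝ E / 2 : ℝ))⁻¹ : ℝ) *
        Complex.exp (-(1 / 2 : ℂ) * (‖x‖ : ℂ) ^ 2 + Complex.I * ((⟪t, x⟫ : ℝ) : ℂ)) := by
    intro x
    rw [ENNReal.toReal_ofReal (gaussDensity_nonneg x), Complex.exp_add, gaussDensity,
      Complex.real_smul, Complex.ofReal_mul, Complex.ofReal_exp, real_inner_comm, mul_assoc]
    congr 2
    · congr 1; push_cast; ring
    · rw [mul_comm]
  simp_rw [e]
  rw [integral_const_mul, h]
  have hpi : ((Real.pi : ℂ) / (1 / 2 : ℂ)) = ((2 * Real.pi : ℝ) : ℂ) := by push_cast; ring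
  have hexp : ((Module.finrank ℝ E : ℂ) / 2) = ((Module.finrank ℝ E / 2 : ℝ) : ℂ) := by push_cast; rfl
  rw [hpi, hexp, ← Complex.ofReal_cpow (by positivity), ← mul_assoc, ← Complex.ofReal_mul,
    inv_mul_cancel₀ (by positivity), Complex.ofReal_one, one_mul]
  congr 1
  rw [Complex.I_sq]
  ring

lemma stdGaussian_absolutelyContinuous : stdGaussian E ≪ (volume : Measure E) := by
  rw [stdGaussian_eq_withDensity]
  exact withDensity_absolutelyContinuous _ _

lemma lintegral_stdGaussian {f : E → ℝ≥0∞} (hf : Measurable f) :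
    ∫⁻ x, f x ∂(stdGaussian E) = ∫⁻ x, ENNReal.ofReal (gaussDensity E x) * f x := by
  rw [stdGaussian_eq_withDensity, lintegral_withDensity_eq_lintegral_mul _
    (continuous_gaussDensity.measurable.ennreal_ofReal) hf]
  rfl

/-- The density of the shifted standard Gaussian measure. -/
lemma stdGaussian_shift (c : E) {A : Set E} (hA : MeasurableSet A) :
    stdGaussian E {a | a - c ∈ A} =
      ∫⁻ a in A, ENNReal.ofReal (Real.exp (-⟪c, a⟫ - ‖c‖ ^ 2 / 2)) ∂(stdGaussian E) := by
  have hA' : MeasurableSet {a | a - c ∈ A} := (measurable_id.sub_const c) hA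
  rw [stdGaussian_eq_withDensity, withDensity_apply _ hA', ← stdGaussian_eq_withDensity,
    ← lintegral_indicator hA', ← lintegral_indicator hA, lintegral_stdGaussian
      ((Measurable.ennreal_ofReal (by fun_prop)).indicator hA),
    ← lintegral_add_right_eq_self _ c]
  refine lintegral_congr fun a => ?_
  by_cases ha : a ∈ A
  · rw [Set.indicator_of_mem (show a + c ∈ {a | a - c ∈ A} by simpa using ha),
      Set.indicator_of_mem ha, ← ENNReal.ofReal_mul (gaussDensity_nonneg a)]
    congr 1
    rw [gaussDensity, gaussDensity, mul_assoc, ← Real.exp_add]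
    congr 2
    rw [norm_add_sq_real, real_inner_comm]
    ring
  · rw [Set.indicator_of_notMem (show a + c ∉ {a | a - c ∈ A} by simpa using ha),
      Set.indicator_of_notMem ha, mul_zero]

/-- The standard Gaussian measure splits along orthogonal subspaces. -/
lemma stdGaussian_eq_map_prod (L : Submodule ℝ E) :
    stdGaussian E =
      ((stdGaussian L).prod (stdGaussian Lᗮ)).map fun z => (z.1 : E) + (z.2 : E) := by
  have hm : Measurable fun z : L × Lᗮ => (z.1 : E) + (z.2 : E) := by fun_prop
  have : IsProbabilityMeasure
    (((stdGaussian L).prod (stdGaussian Lᗮ)).map fun z => (z.1 : E) + (z.2 : E)) :=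
    Measure.isProbabilityMeasure_map hm.aemeasurable
  refine Measure.ext_of_charFun ?_
  ext t
  rw [charFun_apply, charFun_apply, integral_map hm.aemeasurable
    (Measurable.aestronglyMeasurable (by fun_prop))]
  have e : ∀ z : L × Lᗮ, Complex.exp ((⟪(z.1 : E) + (z.2 : E), t⟫ : ℝ) * Complex.I) =
      Complex.exp ((⟪z.1, L.orthogonalProjectionOnto t⟫ : ℝ) * Complex.I) *
        Complex.exp ((⟪z.2, Lᗮ.orthogonalProjectionOnto t⟫ : ℝ) * Complex.I) := by
    intro z
    rw [← Complex.exp_add, ← add_mul, ← Complex.ofReal_add, inner_add_left,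
      real_inner_comm, ← Submodule.inner_orthogonalProjectionOnto_eq_of_mem_right z.1 t,
      real_inner_comm t (z.2 : E), ← Submodule.inner_orthogonalProjectionOnto_eq_of_mem_right z.2 t,
      real_inner_comm z.1, real_inner_comm z.2]
  simp_rw [e]
  rw [integral_prod_mul (fun a : L => Complex.exp ((⟪a, L.orthogonalProjectionOnto t⟫ : ℝ) * Complex.I))
    (fun b : Lᗮ => Complex.exp ((⟪b, Lᗮ.orthogonalProjectionOnto t⟫ : ℝ) * Complex.I)),
    ← charFun_apply, ← charFun_apply, ← charFun_apply, charFun_stdGaussian, charFun_stdGaussian,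
    charFun_stdGaussian, ← Complex.exp_add]
  congr 1
  have h := L.norm_sq_eq_add_norm_sq_projection t
  rw [show (-(‖t‖ : ℂ) ^ 2 / 2) = ((-‖t‖ ^ 2 / 2 : ℝ) : ℂ) by push_cast; rfl, h]
  push_cast; ring

/-- The squared norm of a standard Gaussian vector is chi-squared. -/
lemma map_sq_norm_stdGaussian :
    (stdGaussian E).map (fun x => ‖x‖ ^ 2) = chiSq (Module.finrank ℝ E) := by
  rw [chiSq, stdGaussian, Measure.map_map (by fun_prop) (by fun_prop)]
  congr 1
  ext x
  have h := (stdOrthonormalBasis ℝ E).orthonormal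
  simp only [Function.comp_apply]
  rw [← real_inner_self_eq_norm_sq, h.inner_sum]
  simp [sq]

/-- Polar coordinates for the standard Gaussian measure. -/
lemma exists_polar_stdGaussian [Nontrivial E] :
    ∃ ν : Measure (Set.Ioi (0 : ℝ)), IsFiniteMeasure ν ∧ ∀ f : E → ℝ≥0∞, Measurable f →
      ∫⁻ x, f x ∂(stdGaussian E) =
        ∫⁻ u, ∫⁻ ρ : Set.Ioi (0 : ℝ), f ((ρ : ℝ) • (u : E)) ∂ν
          ∂(volume : Measure E).toSphere := by
  have hG : Measurable fun ρ : Set.Ioi (0 : ℝ) => ENNReal.ofReal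
      (((2 * Real.pi) ^ (Module.finrank ℝ E / 2 : ℝ))⁻¹ * Real.exp (-(ρ : ℝ) ^ 2 / 2)) :=
    Measurable.ennreal_ofReal (by fun_prop)
  set G : Set.Ioi (0 : ℝ) → ℝ≥0∞ := fun ρ => ENNReal.ofReal
      (((2 * Real.pi) ^ (Module.finrank ℝ E / 2 : ℝ))⁻¹ * Real.exp (-(ρ : ℝ) ^ 2 / 2)) with hGdef
  let ν := (Measure.volumeIoiPow (Module.finrank ℝ E - 1)).withDensity G
  have key : ∀ f : E → ℝ≥0∞, Measurable f → ∫⁻ x, f x ∂(stdGaussian E) =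
      ∫⁻ u, ∫⁻ ρ : Set.Ioi (0 : ℝ), f ((ρ : ℝ) • (u : E)) ∂ν ∂(volume : Measure E).toSphere := by
    intro f hf
    have hmp := (volume : Measure E).measurePreserving_homeomorphUnitSphereProd
    have hmp' := hmp.symm (homeomorphUnitSphereProd E).toMeasurableEquiv
    have hF : Measurable fun x : E => ENNReal.ofReal (gaussDensity E x) * f x :=
      (continuous_gaussDensity.measurable.ennreal_ofReal).mul hf
    rw [lintegral_stdGaussian hf]
    have hae : ∀ᵐ x ∂(volume : Measure E), x ∈ ({0}ᶜ : Set E) :=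
      compl_mem_ae_iff.mpr (measure_singleton 0)
    have h1 : ∫⁻ x : E, ENNReal.ofReal (gaussDensity E x) * f x =
        ∫⁻ x : ({0}ᶜ : Set E), ENNReal.ofReal (gaussDensity E x) * f x
          ∂(Measure.comap Subtype.val volume) := by
      rw [lintegral_subtype_comap (measurableSet_singleton 0).compl
        (fun x => ENNReal.ofReal (gaussDensity E x) * f x), Measure.restrict_eq_self_of_ae_mem hae]
    rw [h1, ← hmp'.lintegral_comp (f := fun x : ({0}ᶜ : Set E) =>
      ENNReal.ofReal (gaussDensity E x) * f x) (hF.comp measurable_subtype_coe), lintegral_prod]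
    · refine lintegral_congr fun u => ?_
      rw [lintegral_withDensity_eq_lintegral_mul _ hG (by fun_prop)]
      refine lintegral_congr fun ρ => ?_
      have hu : ‖(u : E)‖ = 1 := by simp
      have e : (((homeomorphUnitSphereProd E).toMeasurableEquiv.symm (u, ρ) : ({0}ᶜ : Set E)) : E) =
          (ρ : ℝ) • (u : E) := rfl
      simp only [e, Pi.mul_apply, hGdef]
      congr 2
      rw [gaussDensity, norm_smul, hu, mul_one, Real.norm_of_nonneg (le_of_lt ρ.2)]
    · refine Measurable.aemeasurable ?_
      exact (hF.comp measurable_subtype_coe).comp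
        (homeomorphUnitSphereProd E).toMeasurableEquiv.symm.measurable
  -- Finiteness of the radial measure: its product with the nonzero mass of the sphere is one.
  refine ⟨ν, ⟨?_⟩, key⟩
  have h := key (fun _ => 1) measurable_const
  simp only [lintegral_const, measure_univ, mul_one] at h
  by_contra hinf
  rw [not_lt, top_le_iff] at hinf
  rw [hinf, one_mul, ENNReal.top_mul (by
    rw [Ne, Measure.measure_univ_eq_zero]; exact Measure.toSphere_ne_zero _)] at h
  exact ENNReal.one_ne_top h

/-- Association inequality: the mass of an upper part under a decreasing density. -/
lemma setLIntegral_le_of_antitone {α : Type*} [MeasurableSpace α] (ν : Measure α)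
    [IsFiniteMeasure ν] {U W : Set α} (hU : MeasurableSet U) (hW : MeasurableSet W) (hUW : U ⊆ W)
    {g : α → ℝ≥0∞} (hg : ∀ u ∈ U, ∀ w ∈ W \ U, g u ≤ g w) {a : ℝ≥0∞} (ha : a ≤ 1)
    (hν : ν U ≤ a * ν W) : ∫⁻ x in U, g x ∂ν ≤ a * ∫⁻ x in W, g x ∂ν := by
  have hdiff : ∀ f : α → ℝ≥0∞, ∫⁻ x in W, f x ∂ν = ∫⁻ x in W \ U, f x ∂ν + ∫⁻ x in U, f x ∂ν := by
    intro f
    rw [← lintegral_union hU Set.disjoint_sdiff_left, Set.sdiff_union_of_subset hUW]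
  have hνW : ν W = ν (W \ U) + ν U := by simpa using hdiff fun _ => 1
  -- In this form the hypothesis compares `U` with its complement in `W`, and `s`, the supremum of
  -- `g` on `U`, separates the values of `g` on the two sets.
  have h1 : (1 - a) * ν U ≤ a * ν (W \ U) := by
    have hfin : a * ν U ≠ ⊤ := ENNReal.mul_ne_top (ne_top_of_le_ne_top ENNReal.one_ne_top ha)
      (measure_ne_top _ _)
    rw [ENNReal.sub_mul fun _ _ => measure_ne_top _ _, one_mul, tsub_le_iff_right, ← mul_add]
    rwa [hνW] at hν
  set s := ⨆ u ∈ U, g u with hs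
  have h2 : ∫⁻ x in U, g x ∂ν ≤ s * ν U := by
    calc _ ≤ ∫⁻ _ in U, s ∂ν := setLIntegral_mono' hU fun x hx => le_iSup₂ (f := fun u _ => g u) x hx
      _ = _ := by simp
  have h3 : s * ν (W \ U) ≤ ∫⁻ x in W \ U, g x ∂ν := by
    calc _ = ∫⁻ _ in W \ U, s ∂ν := by simp
      _ ≤ _ := setLIntegral_mono' (hW.diff hU) fun w hw => iSup₂_le fun u hu => hg u hu w hw
  calc ∫⁻ x in U, g x ∂ν = (1 - a) * ∫⁻ x in U, g x ∂ν + a * ∫⁻ x in U, g x ∂ν := by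
        rw [← add_mul, tsub_add_cancel_of_le ha, one_mul]
    _ ≤ a * ∫⁻ x in W \ U, g x ∂ν + a * ∫⁻ x in U, g x ∂ν := by
        refine add_le_add ?_ le_rfl
        calc (1 - a) * ∫⁻ x in U, g x ∂ν ≤ (1 - a) * (s * ν U) := by gcongr
          _ = s * ((1 - a) * ν U) := by ring
          _ ≤ s * (a * ν (W \ U)) := by gcongr
          _ = a * (s * ν (W \ U)) := by ring
          _ ≤ _ := by gcongr
    _ = a * ∫⁻ x in W, g x ∂ν := by rw [hdiff g, mul_add]

/-- In a shifted cone on which the shift has nonnegative inner products, the mass of the points far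
from the apex is no larger than for the unshifted full space. -/
lemma stdGaussian_shifted_cone_le [Nontrivial E] {N : Set E} (hN : MeasurableSet N)
    (hcone : ∀ t : ℝ, 0 < t → ∀ y ∈ N, t • y ∈ N) {c : E} (hc : ∀ y ∈ N, 0 ≤ ⟪c, y⟫)
    {U : Set ℝ} (hU : MeasurableSet U) (hUup : ∀ s ∈ U, ∀ t, s ≤ t → t ∈ U) {a : ℝ≥0∞} (ha : a ≤ 1)
    (hγ : stdGaussian E {y | ‖y‖ ∈ U} ≤ a) :
    stdGaussian E {x | x - c ∈ N ∧ ‖x - c‖ ∈ U} ≤ a * stdGaussian E {x | x - c ∈ N} := by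
  obtain ⟨ν, hνfin, hpol⟩ := exists_polar_stdGaussian (E := E)
  have hUE : MeasurableSet {y : E | ‖y‖ ∈ U} := measurable_norm hU
  have hUI : MeasurableSet {ρ : Set.Ioi (0 : ℝ) | (ρ : ℝ) ∈ U} := measurable_subtype_coe hU
  have hnorm : ∀ (u : Metric.sphere (0 : E) 1) (ρ : Set.Ioi (0 : ℝ)), ‖(ρ : ℝ) • (u : E)‖ = ρ := by
    intro u ρ
    have hu : ‖(u : E)‖ = 1 := by simp
    rw [norm_smul, hu, mul_one, Real.norm_of_nonneg (le_of_lt ρ.2)]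
  have hconeiff : ∀ (u : Metric.sphere (0 : E) 1) (ρ : Set.Ioi (0 : ℝ)),
      (ρ : ℝ) • (u : E) ∈ N ↔ (u : E) ∈ N := by
    intro u ρ
    refine ⟨fun h => ?_, fun h => hcone _ ρ.2 _ h⟩
    have := hcone _ (inv_pos.mpr ρ.2) _ h
    rwa [smul_smul, inv_mul_cancel₀ (ne_of_gt ρ.2), one_smul] at this
  have hσ0 : (volume : Measure E).toSphere Set.univ ≠ 0 := by
    rw [Ne, Measure.measure_univ_eq_zero]; exact Measure.toSphere_ne_zero _
  -- The event depends only on the norm, so in polar coordinates its Gaussian probability is the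
  -- fraction of radial mass in `U`.
  have hν : ν {ρ | (ρ : ℝ) ∈ U} ≤ a * ν Set.univ := by
    have h1 : stdGaussian E {y | ‖y‖ ∈ U} =
        ν {ρ | (ρ : ℝ) ∈ U} * (volume : Measure E).toSphere Set.univ := by
      rw [← lintegral_indicator_one hUE, hpol _ (measurable_one.indicator hUE)]
      have : ∀ u : Metric.sphere (0 : E) 1, ∫⁻ ρ : Set.Ioi (0 : ℝ),
          ({y : E | ‖y‖ ∈ U}.indicator 1 ((ρ : ℝ) • (u : E)) : ℝ≥0∞) ∂ν = ν {ρ | (ρ : ℝ) ∈ U} := by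
        intro u
        rw [← lintegral_indicator_one hUI]
        refine lintegral_congr fun ρ => ?_
        by_cases h : (ρ : ℝ) ∈ U
        · rw [Set.indicator_of_mem (show (ρ : ℝ) • (u : E) ∈ {y : E | ‖y‖ ∈ U} by simpa [hnorm]),
            Set.indicator_of_mem (show ρ ∈ {ρ : Set.Ioi (0 : ℝ) | (ρ : ℝ) ∈ U} from h)]
          rfl
        · rw [Set.indicator_of_notMem (show (ρ : ℝ) • (u : E) ∉ {y : E | ‖y‖ ∈ U} by simpa [hnorm]),
            Set.indicator_of_notMem (show ρ ∉ {ρ : Set.Ioi (0 : ℝ) | (ρ : ℝ) ∈ U} from h)]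
      simp_rw [this]
      simp
    have h2 : 1 = ν Set.univ * (volume : Measure E).toSphere Set.univ := by
      have h := hpol (fun _ => 1) measurable_const
      simpa using h
    rw [h1] at hγ
    have h3 : ν {ρ | (ρ : ℝ) ∈ U} * (volume : Measure E).toSphere Set.univ ≤
        (a * ν Set.univ) * (volume : Measure E).toSphere Set.univ := by
      rw [mul_assoc, ← h2, mul_one]; exact hγ
    exact (ENNReal.mul_le_mul_iff_left hσ0 (measure_ne_top _ _)).mp h3
  set g : E → ℝ≥0∞ := fun x => ENNReal.ofReal (Real.exp (-⟪c, x⟫ - ‖c‖ ^ 2 / 2)) with hg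
  have hgm : Measurable g := Measurable.ennreal_ofReal (by fun_prop)
  have e1 := stdGaussian_shift c (hN.inter hUE)
  have e2 := stdGaussian_shift c hN
  have e3 : {x | x - c ∈ N ∧ ‖x - c‖ ∈ U} = {x | x - c ∈ N ∩ {y : E | ‖y‖ ∈ U}} := rfl
  rw [e3, e1, e2, ← lintegral_indicator (hN.inter hUE), ← lintegral_indicator hN,
    hpol _ (hgm.indicator (hN.inter hUE)), hpol _ (hgm.indicator hN),
    ← lintegral_const_mul' _ _ (ne_top_of_le_ne_top ENNReal.one_ne_top ha)]
  refine lintegral_mono fun u => ?_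
  by_cases hu : (u : E) ∈ N
  · have h1 : ∀ ρ : Set.Ioi (0 : ℝ), (N ∩ {y : E | ‖y‖ ∈ U}).indicator g ((ρ : ℝ) • (u : E)) =
        {ρ : Set.Ioi (0 : ℝ) | (ρ : ℝ) ∈ U}.indicator (fun ρ => g ((ρ : ℝ) • (u : E))) ρ := by
      intro ρ
      have hρN := (hconeiff u ρ).mpr hu
      by_cases h : (ρ : ℝ) ∈ U
      · rw [Set.indicator_of_mem (show (ρ : ℝ) • (u : E) ∈ N ∩ {y : E | ‖y‖ ∈ U} from
            ⟨hρN, by simpa [hnorm]⟩),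
          Set.indicator_of_mem (show ρ ∈ {ρ : Set.Ioi (0 : ℝ) | (ρ : ℝ) ∈ U} from h)]
      · rw [Set.indicator_of_notMem (show (ρ : ℝ) • (u : E) ∉ N ∩ {y : E | ‖y‖ ∈ U} from
            fun h' => h (by simpa [hnorm] using h'.2)),
          Set.indicator_of_notMem (show ρ ∉ {ρ : Set.Ioi (0 : ℝ) | (ρ : ℝ) ∈ U} from h)]
    have h2 : ∀ ρ : Set.Ioi (0 : ℝ), N.indicator g ((ρ : ℝ) • (u : E)) = g ((ρ : ℝ) • (u : E)) := by
      intro ρ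
      rw [Set.indicator_of_mem ((hconeiff u ρ).mpr hu)]
    simp_rw [h1, h2]
    rw [lintegral_indicator hUI]
    -- On a ray in the cone, the density of the shifted measure decreases with the radius because
    -- `⟪c, u⟫ ≥ 0`, so the shift favours small radii.
    have h3 := setLIntegral_le_of_antitone ν hUI MeasurableSet.univ (Set.subset_univ _)
      (g := fun ρ => g ((ρ : ℝ) • (u : E))) ?_ ha hν
    · rwa [setLIntegral_univ] at h3
    intro ρ hρ s hs
    refine ENNReal.ofReal_le_ofReal (Real.exp_le_exp.mpr ?_)
    have hle : (s : ℝ) ≤ ρ := by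
      by_contra! h
      exact hs.2 (hUup _ hρ _ h.le)
    rw [inner_smul_right, inner_smul_right]
    have := mul_le_mul_of_nonneg_right hle (hc _ hu)
    linarith
  · have h1 : ∀ ρ : Set.Ioi (0 : ℝ), (N ∩ {y : E | ‖y‖ ∈ U}).indicator g ((ρ : ℝ) • (u : E)) = 0 := by
      intro ρ
      refine Set.indicator_of_notMem (fun h => hu ((hconeiff u ρ).mp h.1)) _
    simp [h1]

end StdGaussian

/-! ### Tails of the chi-squared and normal distributions -/

section Tails

open scoped ENNReal RealInnerProductSpace

instance isProbabilityMeasure_chiSq (s : ℕ) : IsProbabilityMeasure (chiSq s) :=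
  Measure.isProbabilityMeasure_map
    (by fun_prop : Measurable fun x : Fin s → ℝ => ∑ i, x i ^ 2).aemeasurable

/-- The upper tail of the chi-squared distribution. -/
def chiTail (s : ℕ) (t : ℝ) : ℝ := 1 - cdf (chiSq s) t

lemma chiTail_eq (s : ℕ) (t : ℝ) : chiTail s t = (chiSq s).real (Set.Ioi t) := by
  rw [chiTail, cdf_eq_real, ← Set.compl_Iic, probReal_compl_eq_one_sub measurableSet_Iic]

lemma chiTail_antitone (s : ℕ) : Antitone (chiTail s) := fun _ _ h =>
  sub_le_sub_left (monotone_cdf _ h) 1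

lemma measurable_chiTail (s : ℕ) : Measurable (chiTail s) := (chiTail_antitone s).measurable

/-- Right continuity of distribution functions. -/
lemma chiTail_le_of_forall_gt {s : ℕ} {t a : ℝ} (h : ∀ t' > t, chiTail s t' ≤ a) :
    chiTail s t ≤ a := by
  have h1 : Tendsto (chiTail s) (𝓝[>] t) (𝓝 (chiTail s t)) :=
    (((cdf (chiSq s)).right_continuous t).mono Set.Ioi_subset_Ici_self).tendsto.const_sub 1
  exact le_of_tendsto h1 (by filter_upwards [self_mem_nhdsWithin] with t' ht' using h t' ht')

/-- Spheres are Lebesgue null. With zero degrees of freedom there is an atom at 0. -/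
lemma chiSq_singleton {s : ℕ} (hs : 1 ≤ s) (t : ℝ) : chiSq s {t} = 0 := by
  have h := map_sq_norm_stdGaussian (E := EuclideanSpace ℝ (Fin s))
  rw [finrank_euclideanSpace_fin] at h
  rw [← h, Measure.map_apply (by fun_prop) (measurableSet_singleton t)]
  refine stdGaussian_absolutelyContinuous ?_
  have : Nonempty (Fin s) := ⟨⟨0, hs⟩⟩
  refine measure_mono_null (fun x hx => ?_)
    (Measure.addHaar_sphere volume (0 : EuclideanSpace ℝ (Fin s)) (√t))
  have hx' : ‖x‖ ^ 2 = t := hx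
  rw [mem_sphere_zero_iff_norm, ← hx', Real.sqrt_sq (norm_nonneg x)]

/-- The upper tail at the observed value is a p-value. By monotonicity and right continuity a
nonempty event is the closed half-line from its infimum, whose tail is at most `a`; there are no
atoms, and `a < 1` bounds the event below. -/
lemma chiSq_tail_le {s : ℕ} (hs : 1 ≤ s) {a : ℝ} (ha : a < 1) :
    chiSq s {t | chiTail s t ≤ a} ≤ ENNReal.ofReal a := by
  set U := {t | chiTail s t ≤ a} with hU
  rcases U.eq_empty_or_nonempty with h | h
  · simp [h]
  have hbd : BddBelow U := by
    have h1 := (tendsto_cdf_atBot (chiSq s)).eventually_lt_const (u := 1 - a) (by linarith)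
    obtain ⟨t₁, ht₁⟩ := h1.exists
    refine ⟨t₁, fun t ht => ?_⟩
    by_contra! hlt
    have h2 := monotone_cdf (chiSq s) hlt.le
    have h3 : 1 - cdf (chiSq s) t ≤ a := ht
    linarith
  set t₀ := sInf U
  have h0 : chiTail s t₀ ≤ a := by
    refine chiTail_le_of_forall_gt fun t' ht' => ?_
    obtain ⟨u, hu, hut⟩ := exists_lt_of_csInf_lt h ht'
    exact (chiTail_antitone s hut.le).trans hu
  calc chiSq s U ≤ chiSq s (Set.Ici t₀) := measure_mono fun t ht => csInf_le hbd ht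
    _ ≤ chiSq s ({t₀} ∪ Set.Ioi t₀) := by
        rw [Set.singleton_union, Set.Ioi_insert]
    _ ≤ chiSq s {t₀} + chiSq s (Set.Ioi t₀) := measure_union_le _ _
    _ = ENNReal.ofReal (chiTail s t₀) := by
        rw [chiSq_singleton hs, zero_add, chiTail_eq, ofReal_measureReal]
    _ ≤ _ := ENNReal.ofReal_le_ofReal h0

lemma stdGaussian_chiTail_le {E : Type*} [NormedAddCommGroup E] [InnerProductSpace ℝ E]
    [FiniteDimensional ℝ E] [MeasurableSpace E] [BorelSpace E] [Nontrivial E] {a : ℝ} (ha : a < 1) :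
    stdGaussian E {y | chiTail (Module.finrank ℝ E) (‖y‖ ^ 2) ≤ a} ≤ ENNReal.ofReal a := by
  have h := chiSq_tail_le (s := Module.finrank ℝ E) Module.finrank_pos ha
  rwa [← map_sq_norm_stdGaussian, Measure.map_apply (by fun_prop)
    (show MeasurableSet {t | chiTail (Module.finrank ℝ E) t ≤ a} from
      measurable_chiTail _ measurableSet_Iic)] at h

/-- One more squared coordinate can only increase the sum. -/
lemma chiTail_succ_le (s : ℕ) (t : ℝ) : chiTail s t ≤ chiTail (s + 1) t := by
  rw [chiTail_eq, chiTail_eq]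
  refine ENNReal.toReal_mono (measure_ne_top _ _) ?_
  have hmp := measurePreserving_piFinSuccAbove (fun _ : Fin (s + 1) => gaussianReal 0 1) 0
  rw [chiSq, chiSq, Measure.map_apply (by fun_prop) measurableSet_Ioi,
    Measure.map_apply (by fun_prop) measurableSet_Ioi]
  set A : Set (Fin s → ℝ) := (fun x => ∑ i, x i ^ 2) ⁻¹' Set.Ioi t with hA
  have hAm : MeasurableSet A := (by fun_prop : Measurable fun x : Fin s → ℝ => ∑ i, x i ^ 2)
    measurableSet_Ioi
  have h1 : (Measure.pi fun _ : Fin s => gaussianReal 0 1) A =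
      ((gaussianReal 0 1).prod (Measure.pi fun _ : Fin s => gaussianReal 0 1)) (Set.univ ×ˢ A) := by
    rw [Measure.prod_prod]; simp
  rw [h1, ← hmp.measure_preimage (MeasurableSet.univ.prod hAm).nullMeasurableSet]
  refine measure_mono fun x hx => ?_
  have hx' : t < ∑ i : Fin s, x i.succ ^ 2 := hx.2
  show t < ∑ i, x i ^ 2
  rw [Fin.sum_univ_succ]
  have := sq_nonneg (x 0)
  linarith

lemma chiTail_mono {r s : ℕ} (h : r ≤ s) (t : ℝ) : chiTail r t ≤ chiTail s t :=
  monotone_nat_of_le_succ (f := fun s => chiTail s t) (fun n => chiTail_succ_le n t) h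

lemma cdf_chiSq_of_neg (s : ℕ) {t : ℝ} (ht : t < 0) : cdf (chiSq s) t = 0 := by
  rw [cdf_eq_real, chiSq, map_measureReal_apply (by fun_prop) measurableSet_Iic]
  have : (fun x : Fin s → ℝ => ∑ i, x i ^ 2) ⁻¹' Set.Iic t = ∅ := by
    ext x
    have : 0 ≤ ∑ i, x i ^ 2 := Finset.sum_nonneg fun i _ => sq_nonneg _
    simp only [Set.mem_preimage, Set.mem_Iic, Set.mem_empty_iff_false, iff_false, not_le]
    linarith
  simp [this]

/-- With at least one degree of freedom no mass lies in `(-∞, 0]`, so the tail there is one. -/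
lemma pos_of_chiTail_lt_one {s : ℕ} (hs : 1 ≤ s) {t : ℝ} (h : chiTail s t < 1) : 0 < t := by
  by_contra! ht
  have h1 : cdf (chiSq s) 0 = 0 := by
    have h2 : (chiSq s) (Set.Iic 0) = 0 := by
      have : Set.Iic (0 : ℝ) = Set.Iio 0 ∪ {0} := by simp
      rw [this]
      refine measure_union_null ?_ (chiSq_singleton hs 0)
      rw [chiSq, Measure.map_apply (by fun_prop) measurableSet_Iio]
      convert measure_empty (μ := Measure.pi fun _ : Fin s => gaussianReal 0 1)
      ext x
      have : 0 ≤ ∑ i, x i ^ 2 := Finset.sum_nonneg fun i _ => sq_nonneg _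
      simpa using this
    rw [cdf_eq_real, measureReal_def, h2]; rfl
  have h2 := monotone_cdf (chiSq s) ht
  have h3 := cdf_nonneg (chiSq s) t
  rw [chiTail] at h
  linarith

lemma cv_nonneg (s : ℕ) {p : ℝ} (hp : p < 1) : 0 ≤ cv s p := by
  refine Real.sInf_nonneg fun x hx => ?_
  by_contra! hneg
  have : 1 - p ≤ cdf (chiSq s) x := hx
  rw [cdf_chiSq_of_neg s hneg] at this
  linarith

/-- Replaces critical values by tail probabilities, for which monotonicity in the degrees of freedom
and limits are easy. -/
lemma chiTail_le_of_cv_lt {s : ℕ} {p t : ℝ} (hp : 0 < p) (h : cv s p < t) : chiTail s t ≤ p := by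
  have hne : {x : ℝ | 1 - p ≤ cdf (chiSq s) x}.Nonempty := by
    obtain ⟨x, hx⟩ := ((tendsto_cdf_atTop (chiSq s)).eventually_const_lt
      (u := 1 - p) (by linarith)).exists
    exact ⟨x, hx.le⟩
  obtain ⟨x, hx, hxt⟩ := exists_lt_of_csInf_lt hne h
  have h1 : 1 - p ≤ cdf (chiSq s) x := hx
  have h2 := monotone_cdf (chiSq s) hxt.le
  rw [chiTail]
  linarith

lemma stdNormalCdf_mono : Monotone stdNormalCdf := fun _ _ h =>
  measureReal_mono fun _ hx => le_trans hx h

lemma stdNormalCdf_nonneg (t : EReal) : 0 ≤ stdNormalCdf t := measureReal_nonneg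

lemma stdNormalCdf_le_one (t : EReal) : stdNormalCdf t ≤ 1 := measureReal_le_one

lemma stdNormalCdf_coe (t : ℝ) : stdNormalCdf t = cdf (gaussianReal 0 1) t := by
  rw [stdNormalCdf, cdf_eq_real]
  simp [Set.Iic]

lemma stdNormalCdf_zero : stdNormalCdf 0 = 1 / 2 := by
  have h0 : stdNormalCdf 0 = (gaussianReal 0 1).real (Set.Iic 0) := by
    simpa [cdf_eq_real] using stdNormalCdf_coe 0
  have h1 : (gaussianReal 0 1).real (Set.Iic 0) = (gaussianReal 0 1).real (Set.Ici 0) := by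
    have : (gaussianReal 0 1).map (fun x => -x) = gaussianReal 0 1 := by
      rw [gaussianReal_map_neg, neg_zero]
    nth_rewrite 1 [← this]
    rw [map_measureReal_apply measurable_neg measurableSet_Iic]
    congr 1
    ext x; simp
  have h2 : (gaussianReal 0 1).real (Set.Iic 0) + (gaussianReal 0 1).real (Set.Ioi 0) = 1 := by
    rw [← Set.compl_Iic]
    exact probReal_add_probReal_compl measurableSet_Iic
  have h3 : (gaussianReal 0 1).real (Set.Ici (0 : ℝ)) = (gaussianReal 0 1).real (Set.Ioi 0) := by
    have : NullSingletonClass (gaussianReal 0 1) :=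
      nullSingletonClass_gaussianReal (by simp)
    exact measureReal_congr Ioi_ae_eq_Ici.symm
  rw [h0]
  linarith

lemma le_stdNormalCdf_of_forall_gt {t a b : ℝ}
    (h : ∀ t' : ℝ, t < t' → a ≤ b * stdNormalCdf (t' : EReal)) : a ≤ b * stdNormalCdf (t : EReal) := by
  have h1 : Tendsto (fun t' : ℝ => b * cdf (gaussianReal 0 1) t') (𝓝[>] t)
      (𝓝 (b * cdf (gaussianReal 0 1) t)) :=
    (((cdf (gaussianReal 0 1)).right_continuous t).mono Set.Ioi_subset_Ici_self).tendsto.const_mul b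
  rw [stdNormalCdf_coe]
  refine ge_of_tendsto h1 ?_
  filter_upwards [self_mem_nhdsWithin] with t' ht'
  rw [← stdNormalCdf_coe]
  exact h t' ht'

end Tails

/-! ### Normal cones and projections -/

section NormalCone

open scoped ENNReal RealInnerProductSpace

variable {E : Type*} [NormedAddCommGroup E] [InnerProductSpace ℝ E]

/-- The normal cone of `P` at `ν`. -/
def normalCone (P : Set E) (ν : E) : Set E := {y | ∀ z ∈ P, ⟪y, z - ν⟫ ≤ 0}

/-- `π` is the metric projection onto `P`. -/
def IsMetricProjection (P : Set E) (π : E → E) : Prop :=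
  ∀ x, π x ∈ P ∧ x - π x ∈ normalCone P (π x)

/-- Some ball of radius `t` contained in `P` contains `ν`. -/
def InnerBall (P : Set E) (ν : E) (t : ℝ) : Prop :=
  ∃ c, ‖ν - c‖ ≤ t ∧ Metric.closedBall c t ⊆ P

variable {P : Set E} {π : E → E}

/-- Add the obtuse-angle inequalities at `π x` and `ν`: the distance between the two points is zero.
-/
lemma IsMetricProjection.eq_of_mem (hπ : IsMetricProjection P π) {x ν : E} (hν : ν ∈ P)
    (h : x - ν ∈ normalCone P ν) : π x = ν := by
  have h1 := h _ (hπ x).1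
  have h2 := (hπ x).2 _ hν
  have h3 : ⟪π x - ν, π x - ν⟫ ≤ 0 := by
    have e : ⟪π x - ν, π x - ν⟫ = ⟪x - ν, π x - ν⟫ + ⟪x - π x, ν - π x⟫ := by
      have : ν - π x = -(π x - ν) := by abel
      rw [this, inner_neg_right, ← sub_eq_add_neg, ← inner_sub_left]
      congr 1; abel
    linarith
  rw [real_inner_self_eq_norm_sq] at h3
  have h4 : ‖π x - ν‖ = 0 := by nlinarith [norm_nonneg (π x - ν)]
  exact sub_eq_zero.mp (norm_eq_zero.mp h4)

lemma IsMetricProjection.eq_self (hπ : IsMetricProjection P π) {x : E} (hx : x ∈ P) : π x = x :=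
  hπ.eq_of_mem hx (by intro z _; simp)

lemma IsMetricProjection.norm_sub_le (hπ : IsMetricProjection P π) (x y : E) :
    ‖π x - π y‖ ≤ ‖x - y‖ := by
  have h1 := (hπ x).2 _ (hπ y).1
  have h2 := (hπ y).2 _ (hπ x).1
  have h3 : ‖π x - π y‖ ^ 2 ≤ ⟪x - y, π x - π y⟫ := by
    rw [← real_inner_self_eq_norm_sq]
    have e : ⟪x - y, π x - π y⟫ = ⟪π x - π y, π x - π y⟫ - ⟪x - π x, π y - π x⟫ -
        ⟪y - π y, π x - π y⟫ := by
      have : π y - π x = -(π x - π y) := by abel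
      rw [this, inner_neg_right, sub_neg_eq_add, ← inner_add_left, ← inner_sub_left]
      congr 1; abel
    linarith
  have h4 := real_inner_le_norm (x - y) (π x - π y)
  rcases (norm_nonneg (π x - π y)).eq_or_lt with h | h
  · rw [← h]; exact norm_nonneg _
  · nlinarith

lemma IsMetricProjection.continuous (hπ : IsMetricProjection P π) : Continuous π :=
  (LipschitzWith.of_dist_le_mul (K := 1) fun x y => by
    simpa [dist_eq_norm] using hπ.norm_sub_le x y).continuous

lemma smul_mem_normalCone {ν y : E} (hy : y ∈ normalCone P ν) {t : ℝ} (ht : 0 ≤ t) :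
    t • y ∈ normalCone P ν := fun z hz => by
  rw [real_inner_smul_left]
  exact mul_nonpos_of_nonneg_of_nonpos ht (hy z hz)

lemma isClosed_normalCone (ν : E) : IsClosed (normalCone P ν) := by
  have : normalCone P ν = ⋂ z ∈ P, {y | ⟪y, z - ν⟫ ≤ 0} := by
    ext; simp [normalCone]
  rw [this]
  exact isClosed_biInter fun z _ => isClosed_le (by fun_prop) continuous_const

/-- A common normal supports `P` at both points, which gives both inequalities; linearity extends
this to the span. So faces are orthogonal to their normal spaces. -/
lemma inner_sub_eq_zero_of_normalCone_eq {ν ν' : E} (hν : ν ∈ P) (hν' : ν' ∈ P)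
    (h : normalCone P ν = normalCone P ν') {y : E} (hy : y ∈ Submodule.span ℝ (normalCone P ν)) :
    ⟪y, ν' - ν⟫ = 0 := by
  induction hy using Submodule.span_induction with
  | mem y hy =>
    have h1 := hy _ hν'
    have h2 := (h ▸ hy : y ∈ normalCone P ν') _ hν
    have e : ν - ν' = -(ν' - ν) := by abel
    rw [e, inner_neg_right] at h2
    linarith
  | zero => simp
  | add a b _ _ ha hb => rw [inner_add_left, ha, hb, add_zero]
  | smul t a _ ha => rw [real_inner_smul_left, ha, mul_zero]

/-- The ball reaches `c + t y`, which cannot lie beyond the supporting hyperplane at `ν`; the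
equality case of Cauchy-Schwarz fixes the centre. -/
lemma InnerBall.sub_eq {ν : E} {t : ℝ} {c : E} (h1 : ‖ν - c‖ ≤ t)
    (h2 : Metric.closedBall c t ⊆ P) {y : E} (hy : y ∈ normalCone P ν) (hy1 : ‖y‖ = 1) :
    ν - c = t • y := by
  have ht : 0 ≤ t := (norm_nonneg _).trans h1
  have h3 := hy (c + t • y) (h2 (by
    rw [mem_closedBall_iff_norm, add_sub_cancel_left, norm_smul, hy1, mul_one,
      Real.norm_of_nonneg ht]))
  have h4 : t ≤ ⟪y, ν - c⟫ := by
    have e : c + t • y - ν = t • y - (ν - c) := by abel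
    rw [e, inner_sub_right, real_inner_smul_right, real_inner_self_eq_norm_sq, hy1] at h3
    linarith
  have h5 : ‖ν - c - t • y‖ ^ 2 ≤ 0 := by
    rw [norm_sub_sq_real, real_inner_smul_right, norm_smul, hy1, mul_one, Real.norm_of_nonneg ht,
      real_inner_comm]
    nlinarith [norm_nonneg (ν - c)]
  have h6 : ‖ν - c - t • y‖ = 0 := by nlinarith [norm_nonneg (ν - c - t • y)]
  exact sub_eq_zero.mp (norm_eq_zero.mp h6)

lemma InnerBall.closedBall_subset {ν : E} {t : ℝ} (h : InnerBall P ν t) {y : E}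
    (hy : y ∈ normalCone P ν) (hy1 : ‖y‖ = 1) : Metric.closedBall (ν - t • y) t ⊆ P := by
  obtain ⟨c, h1, h2⟩ := h
  have := InnerBall.sub_eq h1 h2 hy hy1
  rw [← this, sub_sub_cancel]
  exact h2

/-- A touching ball of positive radius determines the unit normal, so the normal cone is a ray. -/
lemma InnerBall.mem_normalCone_iff {ν : E} {t : ℝ} (ht : 0 < t) (h : InnerBall P ν t) {u : E}
    (hu : u ∈ normalCone P ν) (hu1 : ‖u‖ = 1) {y : E} :
    y ∈ normalCone P ν ↔ ∃ s : ℝ, 0 ≤ s ∧ y = s • u := by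
  constructor
  · intro hy
    by_cases hy0 : y = 0
    · exact ⟨0, le_rfl, by simp [hy0]⟩
    obtain ⟨c, h1, h2⟩ := h
    have e1 := InnerBall.sub_eq h1 h2 hu hu1
    have hyn : ‖y‖ ≠ 0 := norm_ne_zero_iff.mpr hy0
    have e2 := InnerBall.sub_eq h1 h2 (smul_mem_normalCone hy (inv_nonneg.mpr (norm_nonneg y)))
      (by rw [norm_smul, norm_inv, norm_norm, inv_mul_cancel₀ hyn])
    rw [e1] at e2
    have e3 : u = ‖y‖⁻¹ • y := smul_right_injective E ht.ne' e2
    exact ⟨‖y‖, norm_nonneg y, by rw [e3, smul_smul, mul_inv_cancel₀ hyn, one_smul]⟩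
  · rintro ⟨s, hs, rfl⟩
    exact smul_mem_normalCone hu hs

-- The set is the sum of the closed set of admissible centres and a compact ball.
open scoped Pointwise in
lemma isClosed_innerBall [FiniteDimensional ℝ E] (hcl : IsClosed P) (t : ℝ) :
    IsClosed {ν | InnerBall P ν t} := by
  have h1 : IsClosed {c : E | Metric.closedBall c t ⊆ P} := by
    have : {c : E | Metric.closedBall c t ⊆ P} =
        ⋂ v ∈ Metric.closedBall (0 : E) t, (fun c => c + v) ⁻¹' P := by
      ext c
      simp only [Set.mem_ofPred_eq, Set.mem_iInter, Set.mem_preimage]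
      constructor
      · intro h v hv
        exact h (by rw [mem_closedBall_iff_norm]; simpa using hv)
      · intro h z hz
        have := h (z - c) (by rwa [mem_closedBall_zero_iff, ← mem_closedBall_iff_norm])
        simpa using this
    rw [this]
    exact isClosed_biInter fun v _ => hcl.preimage (by fun_prop)
  have h2 : {ν | InnerBall P ν t} =
      {c : E | Metric.closedBall c t ⊆ P} + Metric.closedBall (0 : E) t := by
    ext ν
    simp only [Set.mem_ofPred_eq, Set.mem_add, InnerBall]
    constructor
    · rintro ⟨c, h3, h4⟩
      exact ⟨c, h4, ν - c, by simpa using h3, by abel⟩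
    · rintro ⟨c, h4, v, h3, rfl⟩
      exact ⟨c, by simpa using h3, h4⟩
  rw [h2]
  exact h1.add_right_of_isCompact (isCompact_closedBall 0 t)

/-- Having at least the normals in `N` is a closed condition. Equality is obtained by removing the
finitely many strictly larger cones. -/
lemma measurableSet_normalCone_eq [MeasurableSpace E] [BorelSpace E] (hcl : IsClosed P)
    (hfin : (normalCone P '' P).Finite) (N : Set E) :
    MeasurableSet {ν | ν ∈ P ∧ normalCone P ν = N} := by
  have hsub : ∀ N : Set E, IsClosed {ν | ν ∈ P ∧ N ⊆ normalCone P ν} := by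
    intro N
    have : {ν | ν ∈ P ∧ N ⊆ normalCone P ν} = P ∩ ⋂ y ∈ N, ⋂ z ∈ P, {ν | ⟪y, z - ν⟫ ≤ 0} := by
      ext ν
      simp [normalCone, Set.subset_def]
    rw [this]
    exact hcl.inter (isClosed_biInter fun y _ => isClosed_biInter fun z _ =>
      isClosed_le (by fun_prop) continuous_const)
  have : {ν | ν ∈ P ∧ normalCone P ν = N} = {ν | ν ∈ P ∧ N ⊆ normalCone P ν} \
      ⋃ N' ∈ {N' ∈ normalCone P '' P | N ⊂ N'}, {ν | ν ∈ P ∧ N' ⊆ normalCone P ν} := by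
    ext ν
    simp only [Set.mem_ofPred_eq, Set.mem_sdiff, Set.mem_iUnion, not_exists, not_and]
    constructor
    · rintro ⟨h1, rfl⟩
      exact ⟨⟨h1, le_rfl⟩, fun N' hN' _ h => hN'.2.not_subset h⟩
    · rintro ⟨⟨h1, h2⟩, h3⟩
      refine ⟨h1, ?_⟩
      by_contra hne
      exact h3 (normalCone P ν) ⟨⟨ν, h1, rfl⟩, h2.ssubset_of_ne (Ne.symm hne)⟩ h1 le_rfl
  rw [this]
  refine (hsub N).measurableSet.diff ?_
  exact (hfin.subset (Set.sep_subset _ _)).measurableSet_biUnion fun N' _ => (hsub N').measurableSet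

end NormalCone

/-! ### A finite-sample bound for Gaussian observations -/

section Crit

open scoped ENNReal RealInnerProductSpace

variable {E : Type*} [NormedAddCommGroup E] [InnerProductSpace ℝ E]

/-- The rejection region of the refined test in the Gaussian limit problem. -/
def critRegion (α : ℝ) (P : Set E) (π : E → E) : Set E :=
  {x | x ∉ P ∧
    (2 ≤ Module.finrank ℝ (Submodule.span ℝ (normalCone P (π x))) →
      chiTail (Module.finrank ℝ (Submodule.span ℝ (normalCone P (π x)))) (‖x - π x‖ ^ 2) ≤ α) ∧
    (Module.finrank ℝ (Submodule.span ℝ (normalCone P (π x))) = 1 →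
      chiTail 1 (‖x - π x‖ ^ 2) ≤ 2 * α ∧ ∀ t : ℝ, 0 < t →
        chiTail 1 (‖x - π x‖ ^ 2) ≤ 2 * α * stdNormalCdf (t : EReal) ∨ InnerBall P (π x) t)}

/-- The points of `P` with normal cone `N`. -/
def face (P N : Set E) : Set E := {ν | ν ∈ P ∧ normalCone P ν = N}

/-- The points outside `P` that are projected onto a point with normal cone `N`. -/
def outerCell (P : Set E) (π : E → E) (N : Set E) : Set E := {x | x ∉ P ∧ π x ∈ face P N}

/-- The points on inner normals of inscribed balls that touch the boundary of `P` at a point with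
normal cone `N`. -/
def innerCell (P N : Set E) : Set E :=
  {x | ∃ ν ∈ face P N, ∃ y ∈ N, ‖y‖ = 1 ∧ ∃ (t : ℚ) (s : ℝ), 0 < s ∧ s < t ∧ InnerBall P ν t ∧
    x = ν - s • y}

variable {P : Set E} {π : E → E}

lemma innerCell_subset (N : Set E) : innerCell P N ⊆ P := by
  rintro x ⟨ν, hν, y, hy, hy1, t, s, hs, hst, hb, rfl⟩
  refine hb.closedBall_subset (hν.2 ▸ hy) hy1 ?_
  rw [mem_closedBall_iff_norm]
  have : ν - s • y - (ν - (t : ℝ) • y) = ((t : ℝ) - s) • y := by rw [sub_smul]; abel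
  rw [this, norm_smul, hy1, mul_one, Real.norm_of_nonneg (by linarith)]
  linarith

/-- A point inside `P` can be counted in one cell only: if it is strictly between a touching point
and the centre of the touching ball, that boundary point is its unique nearest one, so two
representations coincide. -/
lemma eq_of_mem_innerCell {N N' : Set E} {x : E} (h : x ∈ innerCell P N)
    (h' : x ∈ innerCell P N') : N = N' := by
  obtain ⟨ν, hν, y, hy, hy1, t, s, hs, hst, hb, hx⟩ := h
  obtain ⟨ν', hν', y', hy', hy1', t', s', hs', hst', hb', hx'⟩ := h'
  -- Test the normal `y'` at `ν'` with the point of the ball around `ν - t • y` that is extreme in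
  -- direction `y'`. Used both ways, this forces `s = s'` and then `⟪y', y⟫ = 1`.
  have key : ∀ {ν ν' y y' : E} {t s s' : ℝ}, ‖y‖ = 1 → ‖y'‖ = 1 → y ∈ normalCone P ν →
      y' ∈ normalCone P ν' → 0 < s → s < t → InnerBall P ν t → x = ν - s • y → x = ν' - s' • y' →
      t - s' ≤ (t - s) * ⟪y', y⟫ := by
    intro ν ν' y y' t s s' hy1 hy1' hy hy' hs hst hb hx hx'
    have hz : ν - t • y + t • y' ∈ P := by
      refine hb.closedBall_subset hy hy1 ?_
      rw [mem_closedBall_iff_norm, add_sub_cancel_left, norm_smul, hy1', mul_one,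
        Real.norm_of_nonneg (by linarith)]
    have h1 := hy' _ hz
    have e : ν - t • y + t • y' - ν' = (t - s') • y' - (t - s) • y := by
      have e1 : ν = x + s • y := by rw [hx]; abel
      have e2 : ν' = x + s' • y' := by rw [hx']; abel
      rw [e1, e2, sub_smul, sub_smul]; abel
    rw [e, inner_sub_right, real_inner_smul_right, real_inner_smul_right,
      real_inner_self_eq_norm_sq, hy1'] at h1
    linarith
  have hin : ⟪y', y⟫ ≤ 1 := by
    have := real_inner_le_norm y' y
    rwa [hy1, hy1', mul_one] at this
  have k1 := key hy1 hy1' (hν.2.symm ▸ hy) (hν'.2.symm ▸ hy') hs hst hb hx hx'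
  have k2 := key hy1' hy1 (hν'.2.symm ▸ hy') (hν.2.symm ▸ hy) hs' hst' hb' hx' hx
  rw [real_inner_comm] at k2
  have hss : s = s' := by nlinarith
  have hone : ⟪y', y⟫ = 1 := by
    subst hss
    nlinarith
  have hyy : y' = y := (inner_eq_one_iff_of_norm_eq_one hy1' hy1).mp hone
  have : ν = ν' := by
    have e1 : ν = x + s • y := by rw [hx]; abel
    have e2 : ν' = x + s' • y' := by rw [hx']; abel
    rw [e1, e2, hss, hyy]
  rw [← hν.2, ← hν'.2, this]

lemma disjoint_cells {N N' : Set E} (hne : N ≠ N') :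
    Disjoint (outerCell P π N ∪ innerCell P N) (outerCell P π N' ∪ innerCell P N') := by
  rw [Set.disjoint_left]
  rintro x (h | h) (h' | h')
  · exact hne (h.2.2.symm.trans h'.2.2)
  · exact h.1 (innerCell_subset _ h')
  · exact h'.1 (innerCell_subset _ h)
  · exact hne (eq_of_mem_innerCell h h')

variable [FiniteDimensional ℝ E] [MeasurableSpace E] [BorelSpace E]

/-- Fubini: the components in `L` and its complement are independent standard Gaussians, so it is
enough to compare sections. -/
lemma stdGaussian_le_of_sections (L : Submodule ℝ E) {S₁ S₂ : Set E} (h₁ : MeasurableSet S₁)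
    (h₂ : MeasurableSet S₂) {a : ℝ≥0∞}
    (h : ∀ b : Lᗮ, stdGaussian L {x : L | (x : E) + b ∈ S₁} ≤
      a * stdGaussian L {x : L | (x : E) + b ∈ S₂}) :
    stdGaussian E S₁ ≤ a * stdGaussian E S₂ := by
  have hm : Measurable fun z : L × Lᗮ => (z.1 : E) + (z.2 : E) := by fun_prop
  rw [stdGaussian_eq_map_prod L, Measure.map_apply hm h₁, Measure.map_apply hm h₂,
    Measure.prod_apply_symm (hm h₁), Measure.prod_apply_symm (hm h₂),
    ← lintegral_const_mul _ (measurable_measure_prodMk_right (hm h₂))]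
  exact lintegral_mono fun b => h b

lemma map_inner_stdGaussian {u : E} (hu : ‖u‖ = 1) :
    (stdGaussian E).map (fun x => ⟪x, u⟫) = gaussianReal 0 1 := by
  have hm : Measurable fun x : E => ⟪x, u⟫ := by fun_prop
  have : IsProbabilityMeasure ((stdGaussian E).map (fun x => ⟪x, u⟫)) :=
    Measure.isProbabilityMeasure_map hm.aemeasurable
  refine Measure.ext_of_charFun ?_
  ext t
  rw [charFun_apply_real, integral_map hm.aemeasurable (by fun_prop), charFun_gaussianReal]
  have h := charFun_stdGaussian (t • u : E)
  rw [charFun_apply] at h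
  simp only [real_inner_smul_right] at h
  push_cast at h
  rw [h, norm_smul, hu, mul_one, ← Complex.ofReal_pow, Real.norm_eq_abs, sq_abs]
  simp [neg_div]

lemma gaussianReal_neg_preimage {S : Set ℝ} (hS : MeasurableSet S) :
    gaussianReal 0 1 {x | -x ∈ S} = gaussianReal 0 1 S := by
  have : (gaussianReal 0 1).map (fun x => -x) = gaussianReal 0 1 := by
    rw [gaussianReal_map_neg]; simp
  nth_rw 2 [← this]
  rw [Measure.map_apply measurable_neg hS]
  rfl

/-- By symmetry, one side carries half of the two-sided rejection probability. This factor is the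
source of `2 α`. -/
lemma gaussianReal_chiTail_le {a : ℝ} (ha : a < 1) :
    gaussianReal 0 1 {s | 0 < s ∧ chiTail 1 (s ^ 2) ≤ a} ≤ ENNReal.ofReal (a / 2) := by
  have hm : MeasurableSet {s : ℝ | chiTail 1 (s ^ 2) ≤ a} :=
    measurableSet_le ((measurable_chiTail 1).comp (by fun_prop)) measurable_const
  have h1 : gaussianReal 0 1 {s | chiTail 1 (s ^ 2) ≤ a} ≤ ENNReal.ofReal a := by
    obtain ⟨u, hu⟩ : ∃ u : EuclideanSpace ℝ (Fin 1), ‖u‖ = 1 := exists_norm_eq _ zero_le_one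
    have h2 := stdGaussian_chiTail_le (E := EuclideanSpace ℝ (Fin 1)) ha
    rw [← map_inner_stdGaussian hu, Measure.map_apply (by fun_prop) hm]
    refine le_trans (measure_mono fun x hx => ?_) h2
    simp only [Set.mem_ofPred_eq, Set.mem_preimage, finrank_euclideanSpace_fin] at hx ⊢
    refine (chiTail_antitone 1 ?_).trans hx
    have := abs_real_inner_le_norm x u
    rw [hu, mul_one] at this
    rw [← sq_abs]
    gcongr
  set A := {s : ℝ | 0 < s ∧ chiTail 1 (s ^ 2) ≤ a} with hA
  have hAm : MeasurableSet A := measurableSet_Ioi.inter hm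
  have h2 := gaussianReal_neg_preimage hAm
  have hd : Disjoint A {x | -x ∈ A} := by
    rw [Set.disjoint_left]
    intro x hx hx'
    have h3 : 0 < x := hx.1
    have h4 : 0 < -x := hx'.1
    linarith
  have h3 : gaussianReal 0 1 A + gaussianReal 0 1 A ≤ ENNReal.ofReal a := by
    nth_rw 2 [← h2]
    rw [← measure_union hd (measurable_neg hAm)]
    refine le_trans (measure_mono ?_) h1
    rintro x (hx | hx)
    · exact hx.2
    · simpa using hx.2
  rw [← two_mul] at h3
  have h4 : ENNReal.ofReal (a / 2) = ENNReal.ofReal a / 2 := by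
    rw [ENNReal.ofReal_div_of_pos (by norm_num)]; simp
  rw [h4, ENNReal.le_div_iff_mul_le (by simp) (by simp), mul_comm]
  exact h3

/-- By symmetry `Φ(τ)` is the mass of `(-τ, ∞)`; the point 0 is null. -/
lemma ofReal_stdNormalCdf_le (τ : ℝ) :
    ENNReal.ofReal (stdNormalCdf (τ : EReal)) ≤
      gaussianReal 0 1 {s | 0 < s ∨ s < 0 ∧ -s < τ} := by
  have : NullSingletonClass (gaussianReal 0 1) := nullSingletonClass_gaussianReal (by simp)
  have h1 : stdNormalCdf (τ : EReal) = (gaussianReal 0 1).real (Set.Iic τ) := by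
    rw [stdNormalCdf_coe, cdf_eq_real]
  rw [h1, ofReal_measureReal, ← measure_congr Iio_ae_eq_Iic, ← gaussianReal_neg_preimage
    measurableSet_Iio]
  refine le_trans (measure_mono (t := {s | 0 < s ∨ s < 0 ∧ -s < τ} ∪ {0}) ?_)
    ((measure_union_le _ _).trans (by simp))
  intro s hs
  simp only [Set.mem_ofPred_eq, Set.mem_Iio] at hs
  rcases lt_trichotomy s 0 with h | h | h
  · exact Or.inl (Or.inr ⟨h, hs⟩)
  · exact Or.inr h
  · exact Or.inl (Or.inl h)

end Crit

/-! ### Faces and cells -/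

section Strata

open scoped ENNReal RealInnerProductSpace

variable {E : Type*} [NormedAddCommGroup E] [InnerProductSpace ℝ E] [FiniteDimensional ℝ E]
  {P : Set E} {π : E → E}

/-- Points of a face differ by vectors orthogonal to its normals, so the component in `span N` is
constant. It is the apex `c` of every section of the cell. -/
lemma projection_eq_of_mem_face {N : Set E} {ν ν₀ : E} (hν : ν ∈ face P N)
    (hν₀ : ν₀ ∈ face P N) : (Submodule.span ℝ N).orthogonalProjectionOnto ν =
      (Submodule.span ℝ N).orthogonalProjectionOnto ν₀ := by
  refine ext_inner_right ℝ fun y => ?_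
  rw [Submodule.inner_orthogonalProjectionOnto_eq_of_mem_right,
    Submodule.inner_orthogonalProjectionOnto_eq_of_mem_right, ← sub_eq_zero, ← inner_sub_left,
    real_inner_comm]
  refine inner_sub_eq_zero_of_normalCone_eq hν₀.1 hν.1 (hν₀.2.trans hν.2.symm) ?_
  rw [hν₀.2]
  exact y.2

lemma add_eq_of_sub_mem {L : Submodule ℝ E} {a c : L} {b : Lᗮ} {ν : E}
    (h : (a : E) + b - ν ∈ L) (hc : L.orthogonalProjectionOnto ν = c) : ν = c + b := by
  have h1 : (L.orthogonalProjectionOnto ((a : E) + b - ν) : E) = (a : E) + b - ν :=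
    Submodule.starProjection_eq_self_iff.mpr h
  rw [map_sub, map_add, hc, Submodule.orthogonalProjectionOnto_mem_subspace_eq_self,
    Submodule.orthogonalProjectionOnto_eq_zero_iff.mpr b.2,
    add_zero, Submodule.coe_sub] at h1
  have : ν = (a : E) + b - ((a : E) + b - ν) := by abel
  rw [this, ← h1]; abel

/-- In the section through `b`, the points projected onto the face form the shifted cone `c + N`, or
nothing when `c + b` is not on the face. -/
lemma mem_face_proj_iff (hπ : IsMetricProjection P π) {N : Set E} {ν₀ : E} (hν₀ : ν₀ ∈ face P N)
    {c : Submodule.span ℝ N} (hc : (Submodule.span ℝ N).orthogonalProjectionOnto ν₀ = c)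
    (a : Submodule.span ℝ N) (b : (Submodule.span ℝ N)ᗮ) :
    π ((a : E) + b) ∈ face P N ↔ (c : E) + b ∈ face P N ∧ (a : E) - c ∈ N := by
  constructor
  · intro h
    have h1 := (hπ ((a : E) + b)).2
    rw [h.2] at h1
    have h2 := add_eq_of_sub_mem (Submodule.subset_span h1)
      ((projection_eq_of_mem_face h hν₀).trans hc)
    rw [h2] at h h1
    refine ⟨h, ?_⟩
    have e : (a : E) + b - (c + b) = a - c := by abel
    rwa [e] at h1
  · rintro ⟨h1, h2⟩
    have e : (a : E) + b - (c + b) = a - c := by abel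
    rw [hπ.eq_of_mem h1.1 (by rw [e, h1.2]; exact h2)]
    exact h1

lemma proj_eq_of_sub_mem (hπ : IsMetricProjection P π) {N : Set E}
    {a c : Submodule.span ℝ N} {b : (Submodule.span ℝ N)ᗮ} (h1 : (c : E) + b ∈ face P N)
    (h2 : (a : E) - c ∈ N) : π ((a : E) + b) = c + b := by
  have e : (a : E) + b - (c + b) = a - c := by abel
  exact hπ.eq_of_mem h1.1 (by rw [e, h1.2]; exact h2)

lemma add_mem_iff (hπ : IsMetricProjection P π) {N : Set E}
    {a c : Submodule.span ℝ N} {b : (Submodule.span ℝ N)ᗮ} (h1 : (c : E) + b ∈ face P N)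
    (h2 : (a : E) - c ∈ N) : (a : E) + b ∈ P ↔ a = c := by
  have h3 := proj_eq_of_sub_mem hπ h1 h2
  constructor
  · intro h
    rw [hπ.eq_self h] at h3
    exact Subtype.ext (add_right_cancel h3)
  · rintro rfl
    exact h1.1

/-- Test a normal at `ν₀` with the origin. Here the null hypothesis `0 ∈ P` enters. -/
lemma inner_projection_nonneg (h0 : (0 : E) ∈ P) {N : Set E} {ν₀ : E} (hν₀ : ν₀ ∈ face P N)
    (y : Submodule.span ℝ N) (hy : (y : E) ∈ N) :
    0 ≤ ⟪(Submodule.span ℝ N).orthogonalProjectionOnto ν₀, y⟫ := by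
  rw [Submodule.inner_orthogonalProjectionOnto_eq_of_mem_right, real_inner_comm]
  have h := (hν₀.2.symm ▸ hy : (y : E) ∈ normalCone P ν₀) 0 h0
  rw [zero_sub, inner_neg_right] at h
  linarith

variable [MeasurableSpace E] [BorelSpace E]

lemma measurableSet_outerCell (hcl : IsClosed P) (hπ : IsMetricProjection P π)
    (hfin : (normalCone P '' P).Finite) (N : Set E) : MeasurableSet (outerCell P π N) :=
  hcl.measurableSet.compl.inter
    (hπ.continuous.measurable (measurableSet_normalCone_eq hcl hfin N))

/-- The bound on cells without inscribed balls. -/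
lemma stdGaussian_outerCell_le (hcl : IsClosed P) (hπ : IsMetricProjection P π)
    (hfin : (normalCone P '' P).Finite) (h0 : (0 : E) ∈ P) {α : ℝ} (hα : α < 1) (N : Set E) :
    stdGaussian E {x | x ∈ outerCell P π N ∧
      chiTail (Module.finrank ℝ (Submodule.span ℝ N)) (‖x - π x‖ ^ 2) ≤ α} ≤
      ENNReal.ofReal α * stdGaussian E (outerCell P π N) := by
  rcases (outerCell P π N).eq_empty_or_nonempty with he | ⟨x₀, hx₀⟩
  · simp [he]
  have hν₀ := hx₀.2
  set ν₀ := π x₀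
  set L := Submodule.span ℝ N with hL
  set c := L.orthogonalProjectionOnto ν₀ with hc
  have hNcl : IsClosed N := hν₀.2 ▸ isClosed_normalCone _
  have hm := measurableSet_outerCell hcl hπ hfin N
  have hmT : MeasurableSet {x | chiTail (Module.finrank ℝ L) (‖x - π x‖ ^ 2) ≤ α} := by
    refine measurableSet_le ((measurable_chiTail _).comp ?_) measurable_const
    exact (((continuous_id.sub hπ.continuous).norm).pow 2).measurable
  -- A point outside `P` has a nonzero residual in `N`; polar coordinates in `L` need a positive
  -- dimension.
  have : Nontrivial L := by
    rw [Submodule.nontrivial_iff_ne_bot]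
    intro hbot
    have h1 := (hπ x₀).2
    rw [hν₀.2] at h1
    have h2 : x₀ - ν₀ ∈ L := Submodule.subset_span h1
    rw [hbot, Submodule.mem_bot, sub_eq_zero] at h2
    exact hx₀.1 (h2 ▸ hν₀.1)
  refine stdGaussian_le_of_sections L (hm.inter hmT) hm fun b => ?_
  by_cases hb : (c : E) + b ∈ face P N
  swap
  · have : {x : L | (x : E) + b ∈ outerCell P π N ∩
        {x | chiTail (Module.finrank ℝ L) (‖x - π x‖ ^ 2) ≤ α}} = ∅ := by
      ext a
      simp only [Set.mem_ofPred_eq, Set.mem_empty_iff_false, iff_false]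
      intro h
      exact hb ((mem_face_proj_iff hπ hν₀ rfl a b).mp h.1.2).1
    rw [this]; simp
  have hmem : ∀ a : L, (a : E) + b ∈ outerCell P π N ↔ (((a - c : L) : E) ∈ N ∧ a - c ≠ 0) := by
    intro a
    rw [outerCell, Set.mem_ofPred_eq, mem_face_proj_iff hπ hν₀ rfl a b, Submodule.coe_sub]
    constructor
    · rintro ⟨h1, -, h2⟩
      refine ⟨h2, fun h3 => h1 ((add_mem_iff hπ hb h2).mpr (sub_eq_zero.mp h3))⟩
    · rintro ⟨h1, h2⟩
      exact ⟨fun h3 => h2 (sub_eq_zero.mpr ((add_mem_iff hπ hb h1).mp h3)), hb, h1⟩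
  -- The apex is removed from the cone, as it belongs to `P` and not to the outer cell.
  have key := stdGaussian_shifted_cone_le (E := L) (N := {y : L | (y : E) ∈ N ∧ y ≠ 0})
    ((hNcl.preimage continuous_subtype_val).measurableSet.inter
      (measurableSet_singleton (0 : L)).compl) ?_ (c := c)
    (fun y hy => inner_projection_nonneg h0 hν₀ y hy.1)
    (U := {s | 0 ≤ s ∧ chiTail (Module.finrank ℝ L) (s ^ 2) ≤ α}) ?_ ?_
    (a := ENNReal.ofReal α) (by rw [ENNReal.ofReal_le_one]; exact hα.le) ?_
  · refine le_trans (measure_mono ?_) (key.trans_eq ?_)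
    · rintro a ⟨h1, h2⟩
      have h3 := (hmem a).mp h1
      refine ⟨h3, norm_nonneg _, ?_⟩
      have h4 : π ((a : E) + b) = c + b := proj_eq_of_sub_mem hπ hb h3.1
      simp only [Set.mem_ofPred_eq, h4] at h2
      have e : (a : E) + b - (c + b) = ((a - c : L) : E) := by push_cast; abel
      rw [e] at h2
      exact h2
    · congr 2
      ext a
      exact (hmem a).symm
  · rintro t ht y ⟨hy, hy0⟩
    refine ⟨?_, smul_ne_zero ht.ne' hy0⟩
    have := smul_mem_normalCone (hν₀.2.symm ▸ hy : (y : E) ∈ normalCone P ν₀) ht.le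
    rwa [hν₀.2] at this
  · exact measurableSet_Ici.inter
      (measurableSet_le ((measurable_chiTail _).comp (by fun_prop)) measurable_const)
  · rintro s ⟨hs, hs'⟩ t hst
    refine ⟨hs.trans hst, (chiTail_antitone _ ?_).trans hs'⟩
    gcongr
  · refine le_trans (measure_mono fun y hy => ?_) (stdGaussian_chiTail_le hα)
    exact hy.2

/-- The signed distances from a boundary point that belong to its cell, when `p t` tells whether a
ball of radius `t` is inscribed there. -/
def radialSet (p : ℚ → Prop) : Set ℝ := {s | 0 < s ∨ s < 0 ∧ ∃ t : ℚ, -s < t ∧ p t}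

lemma measurableSet_radialSet (p : ℚ → Prop) : MeasurableSet (radialSet p) := by
  have : radialSet p = Set.Ioi 0 ∪ (Set.Iio 0 ∩ ⋃ t : {t : ℚ // p t}, {s : ℝ | -s < (t : ℚ)}) := by
    ext s
    simp only [radialSet, Set.mem_ofPred_eq, Set.mem_union, Set.mem_Ioi, Set.mem_inter_iff,
      Set.mem_Iio, Set.mem_iUnion, Subtype.exists, exists_prop, and_comm]
  rw [this]
  exact measurableSet_Ioi.union (measurableSet_Iio.inter (MeasurableSet.iUnion fun t =>
    measurableSet_lt measurable_neg measurable_const))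

/-- The level factor is `Φ` of the supremum of the inscribed radii, or 1 if they are unbounded. It
bounds the mass of the enlarged section from below and the rejection level from above at once. -/
lemma exists_radial_level {α : ℝ} (hα : 0 < α) (p : ℚ → Prop) :
    ∃ q : ℝ, 0 ≤ q ∧ q ≤ 1 ∧ ENNReal.ofReal q ≤ gaussianReal 0 1 (radialSet p) ∧
      ∀ x : ℝ, chiTail 1 x ≤ 2 * α →
        (∀ t : ℚ, 0 < t → chiTail 1 x ≤ 2 * α * stdNormalCdf ((t : ℝ) : EReal) ∨ p t) →
        chiTail 1 x ≤ 2 * α * q := by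
  -- Including 0 keeps the supremum nonnegative when no ball is inscribed.
  set T : Set ℝ := {τ | τ = 0 ∨ ∃ r : ℚ, 0 < r ∧ p r ∧ τ = r} with hT
  have h0 : (0 : ℝ) ∈ T := Or.inl rfl
  have hlt : ∀ s : ℝ, s < 0 → ∀ τ ∈ T, -s < τ → s ∈ radialSet p := by
    rintro s hs τ (rfl | ⟨r, hr, hpr, rfl⟩) hsτ
    · linarith
    · exact Or.inr ⟨hs, r, hsτ, hpr⟩
  by_cases hB : BddAbove T
  · refine ⟨stdNormalCdf (sSup T : ℝ), stdNormalCdf_nonneg _, stdNormalCdf_le_one _,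
      (ofReal_stdNormalCdf_le _).trans (measure_mono ?_), fun x _ hx => ?_⟩
    · rintro s (hs | ⟨hs, hs'⟩)
      · exact Or.inl hs
      · obtain ⟨τ, hτ, hsτ⟩ := exists_lt_of_lt_csSup ⟨0, h0⟩ hs'
        exact hlt s hs τ hτ hsτ
    · refine le_stdNormalCdf_of_forall_gt fun t' ht' => ?_
      obtain ⟨r, hr1, hr2⟩ := exists_rat_btwn ht'
      have hr0 : (0 : ℚ) < r := by
        have : (0 : ℝ) < r := (le_csSup hB h0).trans_lt hr1
        exact_mod_cast this
      rcases hx r hr0 with h | h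
      · refine h.trans ?_
        have := stdNormalCdf_mono (EReal.coe_le_coe_iff.mpr hr2.le)
        gcongr
      · exact absurd (le_csSup hB (Or.inr ⟨r, hr0, h, rfl⟩)) (not_le.mpr hr1)
  · refine ⟨1, zero_le_one, le_rfl, ?_, fun x hx _ => by simpa using hx⟩
    have : NullSingletonClass (gaussianReal 0 1) := nullSingletonClass_gaussianReal (by simp)
    have h1 : gaussianReal 0 1 ({0}ᶜ : Set ℝ) = 1 := by
      rw [prob_compl_eq_one_iff (measurableSet_singleton 0)]; simp
    rw [ENNReal.ofReal_one, ← h1]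
    refine measure_mono fun s hs => ?_
    rcases lt_or_gt_of_ne (show s ≠ 0 from hs) with h | h
    · rw [not_bddAbove_iff] at hB
      obtain ⟨τ, hτ, hsτ⟩ := hB (-s)
      exact hlt s h τ hτ hsτ
    · exact Or.inl h

/-- The bound on cells with inscribed balls. -/
lemma stdGaussian_ball_cell_le (hcl : IsClosed P) (hπ : IsMetricProjection P π)
    (hfin : (normalCone P '' P).Finite) (h0 : (0 : E) ∈ P) {α : ℝ} (hα : 0 < α) (hα' : α < 1 / 2)
    {N : Set E} {u : E} (hu : u ∈ N) (hu1 : ‖u‖ = 1) {ν₁ : E} (hν₁ : ν₁ ∈ face P N) {t₁ : ℝ}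
    (ht₁ : 0 < t₁) (hb₁ : InnerBall P ν₁ t₁) :
    MeasurableSet (innerCell P N) ∧
    stdGaussian E {x | x ∈ outerCell P π N ∧ chiTail 1 (‖x - π x‖ ^ 2) ≤ 2 * α ∧
      ∀ t : ℚ, 0 < t → chiTail 1 (‖x - π x‖ ^ 2) ≤ 2 * α * stdNormalCdf ((t : ℝ) : EReal) ∨
        InnerBall P (π x) t} ≤
      ENNReal.ofReal α * stdGaussian E (outerCell P π N ∪ innerCell P N) := by
  have hN : ∀ y, y ∈ N ↔ ∃ s : ℝ, 0 ≤ s ∧ y = s • u := by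
    intro y
    rw [← hν₁.2]
    exact hb₁.mem_normalCone_iff ht₁ (hν₁.2.symm ▸ hu) hu1
  set L := Submodule.span ℝ N with hL
  have huL : u ∈ L := Submodule.subset_span hu
  set v : L := ⟨u, huL⟩ with hv
  have hv1 : ‖v‖ = 1 := hu1
  have hLu : ∀ a : L, (a : E) = ⟪a, v⟫ • u := by
    intro a
    have hle : L ≤ Submodule.span ℝ {u} := by
      rw [hL, Submodule.span_le]
      intro y hy
      obtain ⟨s, -, rfl⟩ := (hN y).mp hy
      exact Submodule.smul_mem _ _ (Submodule.mem_span_singleton_self u)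
    obtain ⟨s, hs⟩ := Submodule.mem_span_singleton.mp (hle a.2)
    have : ⟪a, v⟫ = s := by
      change ⟪(a : E), u⟫ = s
      rw [← hs, real_inner_smul_left, real_inner_self_eq_norm_sq, hu1]; simp
    rw [this, hs]
  have hNL : ∀ a : L, (a : E) ∈ N ↔ 0 ≤ ⟪a, v⟫ := by
    intro a
    rw [hN]
    constructor
    · rintro ⟨s, hs, h⟩
      change 0 ≤ ⟪(a : E), u⟫
      rw [h, real_inner_smul_left, real_inner_self_eq_norm_sq, hu1]; simpa using hs
    · intro h; exact ⟨_, h, hLu a⟩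
  have hNu : ∀ y ∈ N, ‖y‖ = 1 → y = u := by
    intro y hy hy1
    obtain ⟨s, hs, rfl⟩ := (hN y).mp hy
    rw [norm_smul, hu1, mul_one, Real.norm_of_nonneg hs] at hy1
    rw [hy1, one_smul]
  set c := L.orthogonalProjectionOnto ν₁ with hc
  -- In the section through `b`, the inner cell is the part of the line just inside the face, up to
  -- the inscribed radii. Rational radii make unions countable.
  have hinner : ∀ (a : L) (b : Lᗮ), (a : E) + b ∈ innerCell P N ↔
      (c : E) + b ∈ face P N ∧ ⟪a - c, v⟫ < 0 ∧ ∃ t : ℚ, -⟪a - c, v⟫ < t ∧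
        InnerBall P ((c : E) + b) t := by
    intro a b
    constructor
    · rintro ⟨ν, hν, y, hy, hy1, t, s, hs, hst, hbt, hx⟩
      obtain rfl := hNu y hy hy1
      have e : (a : E) + b - ν = (-s) • y := by rw [hx, neg_smul]; abel
      have hνe := add_eq_of_sub_mem (L := L) (e ▸ L.smul_mem _ huL)
        (projection_eq_of_mem_face hν hν₁)
      have e2 : ((a - c : L) : E) = (-s) • y := by
        rw [← e, hνe]; push_cast; abel
      have e3 : ⟪a - c, v⟫ = -s := by
        change ⟪((a - c : L) : E), y⟫ = -s
        rw [e2, real_inner_smul_left, real_inner_self_eq_norm_sq, hu1]; simp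
      change ν = (c : E) + b at hνe
      rw [e3, ← hνe]
      exact ⟨hν, by linarith, t, by simpa using hst, hbt⟩
    · rintro ⟨h1, h2, t, ht, hbt⟩
      refine ⟨_, h1, u, hu, hu1, t, -⟪a - c, v⟫, by linarith, ht, hbt, ?_⟩
      rw [neg_smul, ← hLu (a - c)]
      push_cast; abel
  have hdecomp : ∀ x : E, ∃ (a : L) (b : Lᗮ), a = L.orthogonalProjectionOnto x ∧
      x = a + b := fun x =>
    ⟨L.orthogonalProjectionOnto x, Lᗮ.orthogonalProjectionOnto x, rfl,
      (Submodule.starProjection_add_starProjection_orthogonal (K := L) x).symm⟩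
  have hmI : MeasurableSet (innerCell P N) := by
    have : innerCell P N = {x | x - L.orthogonalProjectionOnto x + c ∈ face P N} ∩
        ({x | ⟪L.orthogonalProjectionOnto x - c, v⟫ < 0} ∩ ⋃ t : ℚ,
          ({x | -⟪L.orthogonalProjectionOnto x - c, v⟫ < t} ∩
            {x | InnerBall P (x - L.orthogonalProjectionOnto x + c) t})) := by
      ext x
      obtain ⟨a, b, ha, hx⟩ := hdecomp x
      have e : x - L.orthogonalProjectionOnto x + c = (c : E) + b := by
        rw [← ha]; nth_rw 1 [hx]; abel
      have := hinner a b
      rw [← hx] at this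
      rw [this]
      simp only [Set.mem_inter_iff, Set.mem_iUnion, Set.mem_ofPred_eq, e, ha]
    have hf : Measurable fun x : E => x - L.orthogonalProjectionOnto x + (c : E) := by
      fun_prop
    rw [this]
    refine (hf (measurableSet_normalCone_eq hcl hfin N)).inter
      (MeasurableSet.inter (measurableSet_lt (by fun_prop) measurable_const)
        (MeasurableSet.iUnion fun t => MeasurableSet.inter
          (measurableSet_lt (by fun_prop) measurable_const)
          (hf (isClosed_innerBall hcl _).measurableSet)))
  refine ⟨hmI, ?_⟩
  have hmO := measurableSet_outerCell hcl hπ hfin N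
  have hmT : Measurable fun x => chiTail 1 (‖x - π x‖ ^ 2) :=
    (measurable_chiTail _).comp (((continuous_id.sub hπ.continuous).norm).pow 2).measurable
  have hmAll : MeasurableSet {x | ∀ t : ℚ, 0 < t → chiTail 1 (‖x - π x‖ ^ 2) ≤
      2 * α * stdNormalCdf ((t : ℝ) : EReal) ∨ InnerBall P (π x) t} := by
    have hall : {x | ∀ t : ℚ, 0 < t → chiTail 1 (‖x - π x‖ ^ 2) ≤
        2 * α * stdNormalCdf ((t : ℝ) : EReal) ∨ InnerBall P (π x) t} =
        ⋂ t : ℚ, ⋂ _ : 0 < t, ({x | chiTail 1 (‖x - π x‖ ^ 2) ≤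
          2 * α * stdNormalCdf ((t : ℝ) : EReal)} ∪ {x | InnerBall P (π x) t}) := by
      ext x; simp
    rw [hall]
    refine MeasurableSet.iInter fun t => MeasurableSet.iInter fun _ => MeasurableSet.union
      (measurableSet_le hmT measurable_const)
      (hπ.continuous.measurable (isClosed_innerBall hcl _).measurableSet)
  refine stdGaussian_le_of_sections L (hmO.inter (MeasurableSet.inter
    (measurableSet_le hmT measurable_const) hmAll)) (hmO.union hmI) fun b => ?_
  by_cases hb : (c : E) + b ∈ face P N
  swap
  · refine le_trans (measure_mono (t := ∅) ?_) (by simp)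
    intro a h
    exact hb ((mem_face_proj_iff hπ hν₁ rfl a b).mp h.1.2).1
  obtain ⟨q, hq0, hq1, hqW, hqU⟩ := exists_radial_level hα fun t : ℚ => InnerBall P ((c : E) + b) t
  set W := radialSet fun t : ℚ => InnerBall P ((c : E) + b) t with hW
  set U : Set ℝ := {s | 0 < s ∧ chiTail 1 (s ^ 2) ≤ 2 * α * q} with hU
  have hmW := measurableSet_radialSet fun t : ℚ => InnerBall P ((c : E) + b) t
  have hmU : MeasurableSet U := measurableSet_Ioi.inter
    (measurableSet_le ((measurable_chiTail _).comp (by fun_prop)) measurable_const)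
  have hmv : Measurable fun a : L => ⟪a, v⟫ := by fun_prop
  have hlaw : ∀ S : Set ℝ, MeasurableSet S →
      stdGaussian L {a | ⟪a, v⟫ ∈ S} = gaussianReal 0 1 S := by
    intro S hS
    rw [← map_inner_stdGaussian hv1, Measure.map_apply hmv hS]; rfl
  have hmem : ∀ a : L, (a : E) + b ∈ outerCell P π N ↔ 0 < ⟪a - c, v⟫ := by
    intro a
    rw [outerCell, Set.mem_ofPred_eq, mem_face_proj_iff hπ hν₁ rfl a b, ← hc,
      ← Submodule.coe_sub, hNL]
    constructor
    · rintro ⟨h1, -, h2⟩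
      refine lt_of_le_of_ne h2 fun h3 => h1 ?_
      refine (add_mem_iff hπ hb (by rw [← Submodule.coe_sub, hNL]; exact h2)).mpr ?_
      have := hLu (a - c)
      rw [← h3, zero_smul] at this
      exact sub_eq_zero.mp (Subtype.ext this)
    · intro h1
      refine ⟨fun h3 => ?_, hb, h1.le⟩
      rw [(add_mem_iff hπ hb (by rw [← Submodule.coe_sub, hNL]; exact h1.le)).mp h3] at h1
      simp at h1
  -- The association inequality on the line: `W` is the enlarged section and `U` its rejecting part,
  -- which lies farthest out, where the shifted density is smallest.
  have key := setLIntegral_le_of_antitone (stdGaussian L) (U := {a | ⟪a, v⟫ ∈ U})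
    (W := {a | ⟪a, v⟫ ∈ W}) (hmv hmU) (hmv hmW) (fun a ha => Or.inl ha.1)
    (g := fun a => ENNReal.ofReal (Real.exp (-⟪c, a⟫ - ‖c‖ ^ 2 / 2))) ?_
    (a := ENNReal.ofReal α) (by rw [ENNReal.ofReal_le_one]; linarith) ?_
  · have hmUL : MeasurableSet {a : L | ⟪a, v⟫ ∈ U} := hmv hmU
    have hmWL : MeasurableSet {a : L | ⟪a, v⟫ ∈ W} := hmv hmW
    rw [← stdGaussian_shift c hmUL, ← stdGaussian_shift c hmWL] at key
    refine le_trans (measure_mono ?_) (key.trans ?_)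
    · rintro a ⟨h1, h2, h3⟩
      have h4 := (hmem a).mp h1
      have h5 : π ((a : E) + b) = c + b :=
        proj_eq_of_sub_mem hπ hb (by rw [← Submodule.coe_sub, hNL]; exact h4.le)
      have e : (a : E) + b - (c + b) = ((a - c : L) : E) := by push_cast; abel
      have e2 : ‖((a - c : L) : E)‖ = ⟪a - c, v⟫ := by
        nth_rw 1 [hLu (a - c)]
        rw [norm_smul, hu1, mul_one, Real.norm_of_nonneg h4.le]
      simp only [Set.mem_ofPred_eq] at h2 h3
      rw [h5, e, e2] at h2
      simp only [h5, e, e2] at h3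
      exact ⟨h4, hqU _ h2 h3⟩
    · refine mul_le_mul_right (measure_mono ?_) _
      rintro a (h1 | ⟨h1, t, ht, hbt⟩)
      · exact Or.inl ((hmem a).mpr h1)
      · exact Or.inr ((hinner a b).mpr ⟨hb, h1, t, ht, hbt⟩)
  · intro a ha w hw
    have hcv : 0 ≤ ⟪c, v⟫ := inner_projection_nonneg h0 hν₁ v hu
    have hwa : ⟪w, v⟫ ≤ ⟪a, v⟫ := by
      by_contra! hlt
      refine hw.2 ⟨ha.1.trans hlt, (chiTail_antitone 1 ?_).trans ha.2⟩
      have := ha.1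
      gcongr
    have hval : ∀ z : L, ⟪c, z⟫ = ⟪z, v⟫ * ⟪c, v⟫ := by
      intro z
      have : z = ⟪z, v⟫ • v := Subtype.ext (hLu z)
      nth_rw 1 [this]
      rw [real_inner_smul_right]
    refine ENNReal.ofReal_le_ofReal (Real.exp_le_exp.mpr ?_)
    rw [hval a, hval w]
    nlinarith
  · rw [hlaw U hmU, hlaw W hmW]
    -- Without shift the rejecting part has mass at most `α q`, and `W` has mass at least `q`.
    refine (gaussianReal_chiTail_le (a := 2 * α * q) (by nlinarith)).trans ?_
    have : 2 * α * q / 2 = α * q := by ring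
    rw [this, ENNReal.ofReal_mul hα.le]
    gcongr

end Strata

/-! ### The level of the refined test in the Gaussian limit problem -/

section CritBound

open scoped ENNReal RealInnerProductSpace

variable {E : Type*} [NormedAddCommGroup E] [InnerProductSpace ℝ E] [FiniteDimensional ℝ E]
  [MeasurableSpace E] [BorelSpace E] {P : Set E} {π : E → E}

/-- Three kinds of cells: those without a unit normal are empty, those touched by a ball have a ray
of normals and use the enlarged cell, and on the others the refined level falls back to `α`. -/
lemma stdGaussian_critRegion_inter_le (hcl : IsClosed P) (hπ : IsMetricProjection P π)
    (hfin : (normalCone P '' P).Finite) (h0 : (0 : E) ∈ P) {α : ℝ} (hα : 0 < α) (hα' : α < 1 / 2)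
    (N : Set E) :
    MeasurableSet (innerCell P N) ∧ stdGaussian E (critRegion α P π ∩ outerCell P π N) ≤
      ENNReal.ofReal α * stdGaussian E (outerCell P π N ∪ innerCell P N) := by
  by_cases hu : ∃ u ∈ N, ‖u‖ = 1
  swap
  · push Not at hu
    have h1 : innerCell P N = ∅ := by
      ext x
      simp only [Set.mem_empty_iff_false, iff_false]
      rintro ⟨ν, hν, y, hy, hy1, -⟩
      exact hu y hy hy1
    have h2 : outerCell P π N = ∅ := by
      ext x
      simp only [Set.mem_empty_iff_false, iff_false]
      rintro ⟨h3, h4⟩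
      have hne : ‖x - π x‖ ≠ 0 := by
        rw [norm_ne_zero_iff, sub_ne_zero]
        intro h
        exact h3 (h ▸ h4.1)
      refine hu (‖x - π x‖⁻¹ • (x - π x)) ?_ ?_
      · rw [← h4.2]
        exact smul_mem_normalCone (hπ x).2 (by positivity)
      · rw [norm_smul, norm_inv, norm_norm, inv_mul_cancel₀ hne]
    simp [h1, h2]
  obtain ⟨u, hu, hu1⟩ := hu
  by_cases hb : ∃ ν ∈ face P N, ∃ t : ℝ, 0 < t ∧ InnerBall P ν t
  · obtain ⟨ν, hν, t, ht, hbt⟩ := hb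
    obtain ⟨h1, h2⟩ := stdGaussian_ball_cell_le hcl hπ hfin h0 hα hα' hu hu1 hν ht hbt
    refine ⟨h1, le_trans (measure_mono ?_) h2⟩
    rintro x ⟨h3, h4⟩
    have hr : Module.finrank ℝ (Submodule.span ℝ (normalCone P (π x))) = 1 := by
      rw [h4.2.2]
      have : Submodule.span ℝ N = Submodule.span ℝ {u} := by
        refine le_antisymm (Submodule.span_le.mpr fun y hy => ?_)
          (Submodule.span_mono (Set.singleton_subset_iff.mpr hu))
        rw [← hν.2, hbt.mem_normalCone_iff ht (hν.2.symm ▸ hu) hu1] at hy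
        obtain ⟨s, -, rfl⟩ := hy
        exact Submodule.smul_mem _ _ (Submodule.mem_span_singleton_self u)
      rw [this, finrank_span_singleton]
      rintro rfl
      simp at hu1
    exact ⟨h4, (h3.2.2 hr).1, fun t ht => (h3.2.2 hr).2 t (by exact_mod_cast ht)⟩
  · push Not at hb
    have h1 : innerCell P N = ∅ := by
      ext x
      simp only [Set.mem_empty_iff_false, iff_false]
      rintro ⟨ν, hν, y, hy, hy1, t, s, hs, hst, hbt, -⟩
      exact hb ν hν t (hs.trans hst) hbt
    refine ⟨by simp [h1], ?_⟩
    rw [h1, Set.union_empty]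
    refine le_trans (measure_mono ?_) (stdGaussian_outerCell_le hcl hπ hfin h0
      (by linarith : α < 1) N)
    rintro x ⟨h3, h4⟩
    refine ⟨h4, ?_⟩
    have hN := h4.2.2
    have h5 := h3.2
    rw [hN] at h5
    rcases Nat.lt_or_ge (Module.finrank ℝ (Submodule.span ℝ N)) 2 with hr | hr
    · have hr1 : Module.finrank ℝ (Submodule.span ℝ N) = 1 := by
        have : Module.finrank ℝ (Submodule.span ℝ N) ≠ 0 := by
          rw [Ne, Submodule.finrank_eq_zero]
          intro h
          have := Submodule.subset_span (R := ℝ) hu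
          rw [h, SetLike.mem_coe, Submodule.mem_bot] at this
          simp [this] at hu1
        omega
      rw [hr1]
      -- Without inscribed balls the bound with `Φ(t)` holds for all `t > 0`, and in the limit with
      -- `Φ(0) = 1 / 2`.
      have h6 : chiTail 1 (‖x - π x‖ ^ 2) ≤ 2 * α * stdNormalCdf ((0 : ℝ) : EReal) :=
        le_stdNormalCdf_of_forall_gt fun t ht =>
          ((h5.2 hr1).2 t ht).resolve_right (hb _ h4.2 t ht)
      rw [EReal.coe_zero, stdNormalCdf_zero] at h6
      linarith
    · exact h5.1 hr

/-- Each cell rejects at most the fraction `α` of its enlarged cell, and the enlarged cells are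
disjoint, so their total mass is at most one. -/
theorem stdGaussian_critRegion_le (hcl : IsClosed P) (hπ : IsMetricProjection P π)
    (hfin : (normalCone P '' P).Finite) (h0 : (0 : E) ∈ P) {α : ℝ} (hα : 0 < α)
    (hα' : α < 1 / 2) : stdGaussian E (critRegion α P π) ≤ ENNReal.ofReal α := by
  have hcell := stdGaussian_critRegion_inter_le hcl hπ hfin h0 hα hα'
  have hsub : critRegion α P π ⊆ ⋃ N ∈ hfin.toFinset, critRegion α P π ∩ outerCell P π N := by
    intro x hx
    simp only [Set.mem_iUnion, Set.Finite.mem_toFinset]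
    exact ⟨normalCone P (π x), ⟨π x, (hπ x).1, rfl⟩, hx, hx.1, (hπ x).1, rfl⟩
  calc stdGaussian E (critRegion α P π)
      ≤ ∑ N ∈ hfin.toFinset, stdGaussian E (critRegion α P π ∩ outerCell P π N) :=
        (measure_mono hsub).trans (measure_biUnion_finset_le _ _)
    _ ≤ ∑ N ∈ hfin.toFinset, ENNReal.ofReal α *
          stdGaussian E (outerCell P π N ∪ innerCell P N) :=
        Finset.sum_le_sum fun N _ => (hcell N).2
    _ = ENNReal.ofReal α *
          stdGaussian E (⋃ N ∈ hfin.toFinset, (outerCell P π N ∪ innerCell P N)) := by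
        rw [← Finset.mul_sum, measure_biUnion_finset (fun N _ N' _ h => disjoint_cells h)
          fun N _ => (measurableSet_outerCell hcl hπ hfin N).union (hcell N).1]
    _ ≤ ENNReal.ofReal α * 1 := by gcongr; exact prob_le_one
    _ = ENNReal.ofReal α := mul_one _

/-- The residual of the projection is generic in the span of the normal cone. -/
theorem stdGaussian_residual_mem_eq_zero (hπ : IsMetricProjection P π)
    (hfin : (normalCone P '' P).Finite) (S : Submodule ℝ E) :
    stdGaussian E {x | x - π x ∈ S ∧
      Module.finrank ℝ S < Module.finrank ℝ (Submodule.span ℝ (normalCone P (π x)))} = 0 := by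
  refine stdGaussian_absolutelyContinuous ?_
  have hsub : {x | x - π x ∈ S ∧
      Module.finrank ℝ S < Module.finrank ℝ (Submodule.span ℝ (normalCone P (π x)))} ⊆
      ⋃ N ∈ normalCone P '' P, {x | π x ∈ face P N ∧ x - π x ∈ S ∧
        Module.finrank ℝ S < Module.finrank ℝ (Submodule.span ℝ N)} := by
    intro x hx
    simp only [Set.mem_iUnion]
    exact ⟨normalCone P (π x), ⟨π x, (hπ x).1, rfl⟩, ⟨(hπ x).1, rfl⟩, hx⟩
  refine measure_mono_null hsub ((measure_biUnion_null_iff hfin.countable).mpr fun N _ => ?_)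
  rcases Set.eq_empty_or_nonempty {x | π x ∈ face P N ∧ x - π x ∈ S ∧
        Module.finrank ℝ S < Module.finrank ℝ (Submodule.span ℝ N)} with he | ⟨x₀, hx₀⟩
  · rw [he, measure_empty]
  -- Points projected to the same face differ by residuals in `S` and directions orthogonal to `span
  -- N`, so they lie in a translate of `V`. The dimension gap makes `V` a proper, hence null,
  -- subspace.
  set V := S ⊔ (Submodule.span ℝ N)ᗮ with hV
  have hVtop : V ≠ ⊤ := by
    intro h
    have h1 := Submodule.finrank_add_le_finrank_add_finrank S (Submodule.span ℝ N)ᗮ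
    have h2 := Submodule.finrank_add_finrank_orthogonal (Submodule.span ℝ N)
    rw [← hV, h, finrank_top] at h1
    have := hx₀.2.2
    omega
  have h0 : (volume : Measure E) (V : Set E) = 0 := Measure.addHaar_submodule _ _ hVtop
  rw [← measure_preimage_add_right volume (-π x₀)] at h0
  refine measure_mono_null ?_ h0
  intro x hx
  have e : x + -π x₀ = (x - π x) + (π x - π x₀) := by abel
  rw [Set.mem_preimage, e]
  refine V.add_mem (Submodule.mem_sup_left hx.2.1) (Submodule.mem_sup_right ?_)
  rw [Submodule.mem_orthogonal]
  intro y hy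
  refine inner_sub_eq_zero_of_normalCone_eq hx₀.1.1 hx.1.1 (hx₀.1.2.trans hx.1.2.symm) ?_
  rwa [hx₀.1.2]

end CritBound

/-! ### The test at a given sample size -/

section Test

variable {m p k : ℕ}

/-- Factor `S = X' X` and take `V = X'`, `W = V⁻¹`; no symmetric square root is needed. -/
lemma exists_whitening {S : Matrix (Fin p) (Fin p) ℝ} (hS : S.PosDef) :
    ∃ W V : Matrix (Fin p) (Fin p) ℝ, W * V = 1 ∧ V * W = 1 ∧ Wᵀ * W = S⁻¹ ∧ V * Vᵀ = S := by
  obtain ⟨X, hX⟩ : ∃ X : Matrix (Fin p) (Fin p) ℝ, S = Xᵀ * X := by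
    open scoped MatrixOrder in
    obtain ⟨X, hX⟩ := CStarAlgebra.nonneg_iff_eq_star_mul_self.mp hS.posSemidef.nonneg
    exact ⟨X, by rwa [Matrix.star_eq_conjTranspose, Matrix.conjTranspose_eq_transpose_of_trivial]
      at hX⟩
  have hdet : IsUnit (Xᵀ).det := by
    have h1 := (Matrix.isUnit_iff_isUnit_det S).mp hS.isUnit
    rw [hX, Matrix.det_mul] at h1
    exact isUnit_of_mul_isUnit_left h1
  refine ⟨(Xᵀ)⁻¹, Xᵀ, Matrix.nonsing_inv_mul _ hdet, Matrix.mul_nonsing_inv _ hdet, ?_, ?_⟩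
  · rw [hX, Matrix.mul_inv_rev, Matrix.transpose_nonsing_inv, Matrix.transpose_transpose]
  · rw [Matrix.transpose_transpose, ← hX]

lemma quad_transpose_mul (W : Matrix (Fin p) (Fin p) ℝ) (z : Fin p → ℝ) :
    quad (Wᵀ * W) z = (W *ᵥ z) ⬝ᵥ (W *ᵥ z) := by
  rw [quad, ← Matrix.mulVec_mulVec, Matrix.dotProduct_mulVec, ← Matrix.mulVec_transpose,
    Matrix.transpose_transpose]

lemma dotProduct_le_sqrt_mul (a b : Fin p → ℝ) : a ⬝ᵥ b ≤ √(a ⬝ᵥ a) * √(b ⬝ᵥ b) := by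
  rw [← Real.sqrt_mul (show 0 ≤ a ⬝ᵥ a from Finset.sum_nonneg fun i _ => mul_self_nonneg _)]
  refine Real.le_sqrt_of_sq_le ?_
  have := Finset.sum_mul_sq_le_sq_mul_sq Finset.univ a b
  simpa [dotProduct, sq] using this

/-- Cauchy-Schwarz in whitened coordinates. -/
lemma dotProduct_le_wNorm_mul {S : Matrix (Fin p) (Fin p) ℝ} (hS : S.PosDef) (a z : Fin p → ℝ) :
    a ⬝ᵥ z ≤ wNorm S a * √(quad S⁻¹ z) := by
  obtain ⟨W, V, -, hVW, hW, hV⟩ := exists_whitening hS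
  have h1 : a ⬝ᵥ z = (Vᵀ *ᵥ a) ⬝ᵥ (W *ᵥ z) := by
    rw [Matrix.mulVec_transpose, ← Matrix.dotProduct_mulVec, Matrix.mulVec_mulVec, hVW,
      Matrix.one_mulVec]
  have h2 : quad S a = (Vᵀ *ᵥ a) ⬝ᵥ (Vᵀ *ᵥ a) := by
    rw [← quad_transpose_mul, Matrix.transpose_transpose, hV]
  rw [wNorm, h1, h2, ← hW, quad_transpose_mul]
  exact dotProduct_le_sqrt_mul _ _

lemma quad_inv_mulVec {S : Matrix (Fin p) (Fin p) ℝ} (hS : S.PosDef) (b : Fin p → ℝ) :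
    quad S⁻¹ (S *ᵥ b) = quad S b := by
  have hdet := (Matrix.isUnit_iff_isUnit_det S).mp hS.isUnit
  rw [quad, Matrix.mulVec_mulVec, Matrix.nonsing_inv_mul _ hdet, Matrix.one_mulVec, quad,
    dotProduct_comm]

lemma quad_smul (S : Matrix (Fin p) (Fin p) ℝ) (t : ℝ) (z : Fin p → ℝ) :
    quad S (t • z) = t ^ 2 * quad S z := by
  rw [quad, Matrix.mulVec_smul, smul_dotProduct, dotProduct_smul, quad, smul_eq_mul, smul_eq_mul]
  ring

lemma quad_nonneg {S : Matrix (Fin p) (Fin p) ℝ} (hS : S.PosDef) (z : Fin p → ℝ) :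
    0 ≤ quad S z := by
  have := hS.posSemidef.dotProduct_mulVec_nonneg z
  simpa [quad] using this

lemma quad_pos {S : Matrix (Fin p) (Fin p) ℝ} (hS : S.PosDef) {z : Fin p → ℝ} (hz : z ≠ 0) :
    0 < quad S z := by
  have := hS.dotProduct_mulVec_pos hz
  simpa [quad] using this

/-- Evaluate the normal condition at a `δ` that activates only the minimal activatable set: the
multipliers are then supported there. -/
lemma IsProjection.exists_multiplier {S : Matrix (Fin p) (Fin p) ℝ} (hS : S.PosDef)
    {B : Matrix (Fin m) (Fin p) ℝ} {C : Matrix (Fin m) (Fin k) ℝ} {h : Fin m → EReal}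
    {x μ : Fin p → ℝ} (hμ : IsProjection S B C h x μ) :
    ∃ ψ : Fin m → ℝ, 0 ≤ ψ ∧ (∀ j ∉ minActivatable C (shiftE B h μ), ψ j = 0) ∧
      Bᵀ *ᵥ ψ = S⁻¹ *ᵥ (x - μ) ∧ Cᵀ *ᵥ ψ = 0 := by
  obtain ⟨δ₀, hδ₀⟩ := hμ.1
  obtain ⟨δ, hδ, hlt⟩ := exists_lt_off_minActivatable (C := C) (b := shiftE B h μ)
    ⟨δ₀, mem_polyE_shiftE_iff.mpr hδ₀⟩
  rw [mem_polyE_shiftE_iff] at hδ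
  refine exists_ppolyE_multiplier B C h hδ _ (fun j hj => ?_) _ fun ν' hν' =>
    quadForm_min_variational ?_ (convex_ppolyE B h C) hμ.1 hμ.2 hν'
  · refine lt_of_le_of_ne (hδ j) fun h1 => (hlt j hj).ne ?_
    rw [coe_eq_shiftE_iff]
    exact h1
  · have := hS.inv.isHermitian
    rwa [Matrix.IsHermitian, Matrix.conjTranspose_eq_transpose_of_trivial] at this

/-- The dimension of `B' {η ≥ 0 : η' C = 0, η' (B ν - h) = 0}`. -/
def coneDim (B : Matrix (Fin m) (Fin p) ℝ) (C : Matrix (Fin m) (Fin k) ℝ) (h : Fin m → ℝ)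
    (ν : Fin p → ℝ) : ℕ :=
  Set.finrank ℝ ((fun η : Fin m → ℝ => Bᵀ *ᵥ η) ''
    {η | 0 ≤ η ∧ η ᵥ* C = 0 ∧ η ⬝ᵥ (B *ᵥ ν - h) = 0})

lemma dotProduct_mulVec_eq_zero {C : Matrix (Fin m) (Fin k) ℝ} {η : Fin m → ℝ}
    (hη : η ᵥ* C = 0) (w : Fin k → ℝ) : η ⬝ᵥ (C *ᵥ w) = 0 := by
  rw [Matrix.dotProduct_mulVec, hη, zero_dotProduct]

lemma eq_zero_of_slack {η s : Fin m → ℝ} (hη : 0 ≤ η) (hs : s ≤ 0) (h : η ⬝ᵥ s = 0) {j : Fin m}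
    (hj : s j ≠ 0) : η j = 0 := by
  have h1 : ∑ i, -(η i * s i) = 0 := by rw [Finset.sum_neg_distrib, neg_eq_zero]; exact h
  rw [Finset.sum_eq_zero_iff_of_nonneg fun i _ => by
    have := mul_nonpos_of_nonneg_of_nonpos (hη i) (hs i)
    linarith] at h1
  have := h1 j (Finset.mem_univ j)
  simpa [hj] using this

/-- By complementary slackness the multipliers vanish off the active set of any feasible completion
`w`. -/
lemma coneDim_le_finrank_normSpan {B : Matrix (Fin m) (Fin p) ℝ} {C : Matrix (Fin m) (Fin k) ℝ}
    {h : Fin m → ℝ} {ν : Fin p → ℝ} {w : Fin k → ℝ} (hw : B *ᵥ ν + C *ᵥ w ≤ h) :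
    coneDim B C h ν ≤ Module.finrank ℝ (normSpan B C {j | (C *ᵥ w) j = (h - B *ᵥ ν) j}) := by
  refine Submodule.finrank_mono (Submodule.span_le.mpr ?_)
  rintro _ ⟨η, ⟨h0, hC, hη⟩, rfl⟩
  refine ⟨η, fun j hj => ?_, by rw [Matrix.mulVec_transpose, hC], rfl⟩
  refine eq_zero_of_slack (s := B *ᵥ ν + C *ᵥ w - h) h0 (sub_nonpos.mpr hw) ?_ ?_
  · have e : B *ᵥ ν + C *ᵥ w - h = (B *ᵥ ν - h) + C *ᵥ w := by abel
    rw [e, dotProduct_add, hη, dotProduct_mulVec_eq_zero hC, add_zero]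
  · intro h1
    refine hj ?_
    simp only [Pi.sub_apply, Pi.add_apply, Set.mem_ofPred_eq] at h1 ⊢
    linarith

lemma IsProjection.mem_cone {S : Matrix (Fin p) (Fin p) ℝ} (hS : S.PosDef)
    {B : Matrix (Fin m) (Fin p) ℝ} {C : Matrix (Fin m) (Fin k) ℝ} {h : Fin m → ℝ}
    {x μ : Fin p → ℝ} (hμ : IsProjection S B C (toE h) x μ) :
    S⁻¹ *ᵥ (x - μ) ∈ (fun η : Fin m → ℝ => Bᵀ *ᵥ η) ''
      {η | 0 ≤ η ∧ η ᵥ* C = 0 ∧ η ⬝ᵥ (B *ᵥ μ - h) = 0} := by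
  obtain ⟨ψ, h0, hoff, hB, hC⟩ := hμ.exists_multiplier hS
  rw [Matrix.mulVec_transpose] at hC
  refine ⟨ψ, ⟨h0, hC, ?_⟩, hB⟩
  obtain ⟨δ, hδ⟩ := hμ.1
  have h1 : ψ ⬝ᵥ (B *ᵥ μ + C *ᵥ δ - h) = 0 := by
    refine Finset.sum_eq_zero fun j _ => ?_
    by_cases hj : j ∈ minActivatable C (shiftE B (toE h) μ)
    · have h2 := eq_of_mem_minActivatable (mem_polyE_shiftE_iff.mpr hδ) hj
      rw [coe_eq_shiftE_iff] at h2
      have h3 : (B *ᵥ μ) j + (C *ᵥ δ) j = h j := EReal.coe_eq_coe_iff.mp h2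
      simp [h3]
    · simp [hoff j hj]
  have e : B *ᵥ μ + C *ᵥ δ - h = (B *ᵥ μ - h) + C *ᵥ δ := by abel
  rwa [e, dotProduct_add, dotProduct_mulVec_eq_zero hC, add_zero] at h1

/-- The weighted residual is a nonzero element of the cone. -/
lemma one_le_coneDim {S : Matrix (Fin p) (Fin p) ℝ} (hS : S.PosDef)
    {B : Matrix (Fin m) (Fin p) ℝ} {C : Matrix (Fin m) (Fin k) ℝ} {h : Fin m → ℝ}
    {x μ : Fin p → ℝ} (hμ : IsProjection S B C (toE h) x μ) (hne : x ≠ μ) :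
    1 ≤ coneDim B C h μ := by
  rw [coneDim, Set.finrank, Nat.one_le_iff_ne_zero, Ne, Submodule.finrank_eq_zero]
  intro hbot
  have h1 := Submodule.subset_span (R := ℝ) (hμ.mem_cone hS)
  rw [hbot, SetLike.mem_coe, Submodule.mem_bot] at h1
  have h2 := quad_pos hS.inv (sub_ne_zero.mpr hne)
  rw [quad, h1, dotProduct_zero] at h2
  exact lt_irrefl _ h2

end Test

/-! ### Degrees of freedom, refined levels and inscribed ellipsoids -/

namespace Model

variable {dC dμ dδ : ℕ} (M : Model dC dμ dδ) {n : ℕ} {e : Est dμ dδ} {μ : Fin dμ → ℝ}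
  {δ : Fin dδ → ℝ}

lemma IsSolution.isProjection (hn : 1 ≤ n) (h : M.IsSolution n e μ δ) :
    IsProjection (M.sigmaTilde n e) M.B (M.Cbar e) (toE (M.d n)) e.mu μ := by
  have hn' : (0 : ℝ) < n := by exact_mod_cast hn
  rw [IsProjection, ppolyE_toE]
  refine ⟨⟨δ, h.1⟩, ?_⟩
  rintro μ' ⟨δ', h'⟩
  have := h.2 μ' δ' h'
  rw [objective, objective] at this
  exact le_of_mul_le_mul_left this hn'

lemma IsSolution.T_eq (h : M.IsSolution n e μ δ) :
    M.T n e = n * quad (M.sigmaTilde n e)⁻¹ (e.mu - μ) := by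
  refine IsLeast.csInf_eq ⟨⟨μ, δ, h.1, rfl⟩, ?_⟩
  rintro t ⟨μ', δ', h', rfl⟩
  exact h.2 μ' δ' h'

lemma rHat_eq : M.rHat n e μ = coneDim M.B (M.Cbar e) (M.d n) μ := rfl

/-- By rank-nullity `sHat` is the dimension of all normals supported on the active set, and the
subtraction is not truncated. `rHat` counts only the span of nonnegative ones. -/
lemma rHat_le_sHat (h : M.IsSolution n e μ δ) : M.rHat n e μ ≤ M.sHat n e μ δ := by
  have h1 := coneDim_le_finrank_normSpan h.1
  have h2 := finrank_normSpan_add M.B (M.Cbar e) (M.activeSet n e μ δ)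
  have h3 : rowRank (Matrix.fromCols M.B (M.Cbar e)) (M.activeSet n e μ δ) =
    rowRank (Matrix.fromCols M.B M.D) (M.activeSet n e μ δ) := rowRank_fromCols_mul_add _ _ _ _
  rw [rHat_eq, sHat]
  rw [h3] at h2
  change _ ≤ Module.finrank ℝ (normSpan M.B (M.Cbar e) (M.activeSet n e μ δ)) at h1
  omega

lemma tauRow_nonneg {a p : ℕ} {S : Matrix (Fin p) (Fin p) ℝ} {A : Matrix (Fin a) (Fin p) ℝ}
    {g : Fin a → ℝ} {x : Fin p → ℝ} (hx : A *ᵥ x ≤ g) (i j : Fin a) :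
    0 ≤ tauRow n S A g x i j := by
  rw [tauRow]
  split_ifs with h
  · have h1 : 0 ≤ g j - A j ⬝ᵥ x := sub_nonneg.mpr (hx j)
    have h2 : 0 ≤ wNorm S (A i) := Real.sqrt_nonneg _
    exact EReal.coe_nonneg.mpr (by positivity)
  · exact le_top

/-- Feasibility makes every inactivity nonnegative, so `Φ` is evaluated where it lies in `[1/2, 1]`.
-/
lemma refinedLevel_mem (h : M.IsSolution n e μ δ) {α β : ℝ} (hα : 0 < α)
    (hβ : M.IsRefinedLevel n α e μ δ β) : β ∈ Set.Icc α (2 * α) := by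
  by_cases h1 : M.sHat n e μ δ = 1 ∧ M.rHat n e μ = 1
  · obtain ⟨dA, H, i, -, hpoly, -, -, rfl⟩ := hβ.1 h1
    have hμ : μ ∈ poly (H * M.B) (H *ᵥ M.d n) := hpoly ▸ ⟨δ, h.1⟩
    have h2 : 0 ≤ tau n (M.sigmaTilde n e) (H * M.B) (H *ᵥ M.d n) μ i :=
      le_iInf fun j => tauRow_nonneg hμ _ _
    have h3 := stdNormalCdf_mono h2
    rw [stdNormalCdf_zero] at h3
    have h4 := stdNormalCdf_le_one (tau n (M.sigmaTilde n e) (H * M.B) (H *ᵥ M.d n) μ i)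
    exact ⟨by nlinarith, by nlinarith⟩
  · rw [hβ.2 h1]
    exact ⟨le_rfl, by linarith⟩

/-- Up to scale, an ellipsoid of radius `t` is inscribed in the projected constraint set and
touches its boundary at `μ`. -/
lemma exists_inscribed_of_lt_tau (hn : 1 ≤ n) {S : Matrix (Fin dμ) (Fin dμ) ℝ} (hS : S.PosDef)
    {a : ℕ} {A : Matrix (Fin a) (Fin dμ) ℝ} {g : Fin a → ℝ} {i : Fin a} (hμ : A *ᵥ μ ≤ g)
    (hi : (A *ᵥ μ) i = g i) (hi0 : A i ≠ 0) {t : ℝ} (ht : 0 < t)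
    (hτ : (t : EReal) ≤ tau n S A g μ i) :
    ∃ c, n * quad S⁻¹ (μ - c) ≤ t ^ 2 ∧
      ∀ μ', n * quad S⁻¹ (μ' - c) ≤ t ^ 2 → A *ᵥ μ' ≤ g := by
  have hn' : (0 : ℝ) < n := by exact_mod_cast hn
  have hsn : 0 < √(n : ℝ) := Real.sqrt_pos.mpr hn'
  have hai : 0 < wNorm S (A i) := Real.sqrt_pos.mpr (quad_pos hS hi0)
  set s := t / √(n : ℝ) with hs
  have hs0 : 0 < s := div_pos ht hsn
  have hs2 : n * s ^ 2 = t ^ 2 := by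
    rw [hs, div_pow, Real.sq_sqrt hn'.le]; field_simp
  -- The centre lies one radius inside, along the inner normal of row `i` in the metric of `S⁻¹`, so
  -- that the ellipsoid touches that constraint at `μ`.
  set c := μ - (s / wNorm S (A i)) • (S *ᵥ A i) with hc
  refine ⟨c, ?_, fun μ' hμ' j => ?_⟩
  · rw [hc, sub_sub_cancel, quad_smul, quad_inv_mulVec hS, div_pow, wNorm,
      Real.sq_sqrt (quad_nonneg hS _), div_mul_cancel₀ _ (quad_pos hS hi0).ne', hs2]
  · have h1 : A j ⬝ᵥ (μ' - c) ≤ wNorm S (A j) * s := by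
      refine (dotProduct_le_wNorm_mul hS _ _).trans ?_
      refine mul_le_mul_of_nonneg_left ?_ (Real.sqrt_nonneg _)
      refine Real.sqrt_le_iff.mpr ⟨hs0.le, ?_⟩
      rw [← hs2] at hμ'
      exact le_of_mul_le_mul_left hμ' hn'
    have hsymm : A j ⬝ᵥ (S *ᵥ A i) = A i ⬝ᵥ (S *ᵥ A j) := by
      have : Sᵀ = S := by
        have := hS.isHermitian
        rwa [Matrix.IsHermitian, Matrix.conjTranspose_eq_transpose_of_trivial] at this
      rw [Matrix.dotProduct_mulVec, ← Matrix.mulVec_transpose, this, dotProduct_comm]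
    have h2 : A j ⬝ᵥ c = A j ⬝ᵥ μ - s / wNorm S (A i) * (A i ⬝ᵥ (S *ᵥ A j)) := by
      rw [hc, dotProduct_sub, dotProduct_smul, hsymm, smul_eq_mul]
    have hfeas : A j ⬝ᵥ μ ≤ g j := hμ j
    -- The left side is the excess of the maximum of row `j` over the ellipsoid beyond its value at
    -- `μ`; `t ≤ τ` bounds it by the slack. For `j = i` the denominator is zero, so leaving `i` out
    -- of the infimum does no harm.
    have h3 : s / wNorm S (A i) *
        (wNorm S (A i) * wNorm S (A j) - A i ⬝ᵥ (S *ᵥ A j)) ≤ g j - A j ⬝ᵥ μ := by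
      by_cases hden : 0 < wNorm S (A i) * wNorm S (A j) - A i ⬝ᵥ (S *ᵥ A j)
      · have hji : j ≠ i := by
          rintro rfl
          have : quad S (A j) = A j ⬝ᵥ (S *ᵥ A j) := rfl
          rw [wNorm, Real.mul_self_sqrt (quad_nonneg hS _), this, sub_self] at hden
          exact lt_irrefl _ hden
        have h4 : (t : EReal) ≤ tauRow n S A g μ i j :=
          hτ.trans (iInf_le (fun j : {j : Fin a // j ≠ i} => tauRow n S A g μ i j) ⟨j, hji⟩)
        rw [tauRow, if_pos hden, EReal.coe_le_coe_iff, le_div_iff₀ hden] at h4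
        rw [div_mul_eq_mul_div, div_le_iff₀ hai, hs, div_mul_eq_mul_div, div_le_iff₀ hsn]
        linarith
      · refine le_trans (mul_nonpos_of_nonneg_of_nonpos (by positivity) (not_lt.mp hden)) ?_
        linarith
    have h4 : s / wNorm S (A i) * (wNorm S (A i) * wNorm S (A j)) = wNorm S (A j) * s := by
      field_simp
    have h5 : (A *ᵥ μ') j = A j ⬝ᵥ (μ' - c) + A j ⬝ᵥ c := by
      rw [← dotProduct_add, sub_add_cancel]; rfl
    rw [mul_sub, h4] at h3
    rw [h5, h2]
    linarith

/-- What a rejection implies. -/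
lemma reject_spec (hn : 1 ≤ n) (hS : (M.sigmaTilde n e).PosDef) (h : M.IsSolution n e μ δ)
    {α β : ℝ} (hα : 0 < α) (hα' : α < 1 / 2) (hβ : M.IsRefinedLevel n α e μ δ β)
    (hrej : cv (M.sHat n e μ δ) β < M.T n e) :
    0 < M.T n e ∧ ∀ r ≤ M.rHat n e μ, (2 ≤ r → chiTail r (M.T n e) ≤ α) ∧
      (r = 1 → chiTail 1 (M.T n e) ≤ 2 * α ∧ ∀ t : ℝ, 0 < t →
        chiTail 1 (M.T n e) ≤ 2 * α * stdNormalCdf (t : EReal) ∨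
          ∃ c, n * quad (M.sigmaTilde n e)⁻¹ (μ - c) ≤ t ^ 2 ∧
            ∀ μ', n * quad (M.sigmaTilde n e)⁻¹ (μ' - c) ≤ t ^ 2 →
              μ' ∈ ppoly M.B (M.d n) (M.Cbar e)) := by
  have hβI := M.refinedLevel_mem h hα hβ
  have hT := lt_of_le_of_lt (cv_nonneg (M.sHat n e μ δ) (p := β) (by linarith [hβI.2])) hrej
  refine ⟨hT, fun r hr => ?_⟩
  have hrs := M.rHat_le_sHat h
  -- Since `r ≤ rHat ≤ sHat`, the tail with `r` degrees of freedom is the smallest, so rejection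
  -- carries over to every such `r`.
  have hchi : chiTail r (M.T n e) ≤ β :=
    (chiTail_mono (hr.trans hrs) _).trans (chiTail_le_of_cv_lt (hα.trans_le hβI.1) hrej)
  refine ⟨fun h2 => ?_, ?_⟩
  · rwa [hβ.2 (by omega)] at hchi
  · rintro rfl
    refine ⟨hchi.trans hβI.2, fun t ht => ?_⟩
    by_cases h1 : M.sHat n e μ δ = 1 ∧ M.rHat n e μ = 1
    · obtain ⟨dA, H, i, -, hpoly, hi, hi0, hβe⟩ := hβ.1 h1
      have hμ : μ ∈ poly (H * M.B) (H *ᵥ M.d n) := hpoly ▸ ⟨δ, h.1⟩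
      rcases le_total (tau n (M.sigmaTilde n e) (H * M.B) (H *ᵥ M.d n) μ i) (t : EReal)
        with hτ | hτ
      · left
        rw [hβe] at hchi
        refine hchi.trans ?_
        have := stdNormalCdf_mono hτ
        gcongr
      · right
        rw [hpoly]
        exact exists_inscribed_of_lt_tau hn hS hμ hi hi0 ht hτ
    -- In the unrefined case the level is `α`, which is at most `2 α Φ(t)` because `Φ(t) ≥ 1 / 2`.
    · left
      rw [hβ.2 h1] at hchi
      have h3 := stdNormalCdf_mono (EReal.coe_nonneg.mpr ht.le)
      rw [stdNormalCdf_zero] at h3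
      nlinarith

end Model

/-! ### Limits of quadratic forms -/

section QuadLimits

variable {p : ℕ} {β : Type*} {l : Filter β}

lemma exists_quad_lower {W : Matrix (Fin p) (Fin p) ℝ} (hW : W.PosDef) :
    ∃ c : ℝ, 0 < c ∧ ∀ z, c * ‖z‖ ^ 2 ≤ quad W z := by
  obtain ⟨X, Y, -, hYX, hX, -⟩ := exists_whitening hW.inv
  rw [Matrix.nonsing_inv_nonsing_inv _ ((Matrix.isUnit_iff_isUnit_det W).mp hW.isUnit)] at hX
  set a := ∑ i, ∑ j, |Y i j - (0 : Matrix (Fin p) (Fin p) ℝ) i j| with ha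
  have ha0 : 0 ≤ a := Finset.sum_nonneg fun i _ => Finset.sum_nonneg fun j _ => abs_nonneg _
  refine ⟨(a ^ 2 + 1)⁻¹, by positivity, fun z => ?_⟩
  have h1 := abs_mulVec_sub_le Y 0 (X *ᵥ z)
  rw [Matrix.zero_mulVec, sub_zero, Matrix.mulVec_mulVec, hYX, Matrix.one_mulVec, ← ha] at h1
  have h2 := sq_norm_le_dotProduct_self (X *ᵥ z)
  rw [← quad_transpose_mul, hX] at h2
  rw [inv_mul_le_iff₀ (by positivity)]
  have h3 : ‖z‖ ^ 2 ≤ (a * ‖X *ᵥ z‖) ^ 2 := by gcongr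
  have h4 : 0 ≤ quad W z := quad_nonneg hW z
  nlinarith [sq_nonneg a, sq_nonneg (‖X *ᵥ z‖)]

lemma tendsto_quad {Ws : β → Matrix (Fin p) (Fin p) ℝ} {W : Matrix (Fin p) (Fin p) ℝ}
    (hW : Tendsto Ws l (𝓝 W)) {zs : β → Fin p → ℝ} {z : Fin p → ℝ} (hz : Tendsto zs l (𝓝 z)) :
    Tendsto (fun q => quad (Ws q) (zs q)) l (𝓝 (quad W z)) := by
  unfold quad dotProduct
  exact tendsto_finsetSum _ fun i _ => (tendsto_pi_nhds.mp hz i).mul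
    (tendsto_pi_nhds.mp (tendsto_mulVec hW hz) i)

lemma exists_quad_lower_of_tendsto {Ws : β → Matrix (Fin p) (Fin p) ℝ}
    {W : Matrix (Fin p) (Fin p) ℝ} (hWs : Tendsto Ws l (𝓝 W)) (hW : W.PosDef) :
    ∃ c : ℝ, 0 < c ∧ ∀ᶠ q in l, ∀ z, c * ‖z‖ ^ 2 ≤ quad (Ws q) z := by
  obtain ⟨c, hc, hcW⟩ := exists_quad_lower hW
  have h1 : Tendsto (fun q => (p : ℝ) * ∑ i, ∑ j, |W i j - Ws q i j|) l (𝓝 0) := by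
    have : Tendsto (fun q => (p : ℝ) * ∑ i, ∑ j, |W i j - Ws q i j|) l
        (𝓝 ((p : ℝ) * ∑ i, ∑ j, |W i j - W i j|)) :=
      (tendsto_finsetSum _ fun i _ => tendsto_finsetSum _ fun j _ =>
        (((tendsto_pi_nhds.mp (tendsto_pi_nhds.mp hWs i) j).const_sub _).abs)).const_mul _
    simpa using this
  refine ⟨c / 2, half_pos hc, ?_⟩
  filter_upwards [h1.eventually_lt_const (half_pos hc)] with q hq z
  have h2 := abs_mulVec_sub_le W (Ws q) z
  have h3 : z ⬝ᵥ (W *ᵥ z - Ws q *ᵥ z) ≤ p * (‖z‖ * ‖W *ᵥ z - Ws q *ᵥ z‖) := by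
    calc z ⬝ᵥ (W *ᵥ z - Ws q *ᵥ z) ≤ ∑ _i : Fin p, ‖z‖ * ‖W *ᵥ z - Ws q *ᵥ z‖ := by
          refine Finset.sum_le_sum fun i _ => (le_abs_self _).trans ?_
          rw [abs_mul]
          exact mul_le_mul (norm_le_pi_norm z i) (norm_le_pi_norm (W *ᵥ z - Ws q *ᵥ z) i)
            (abs_nonneg _) (norm_nonneg _)
      _ = p * (‖z‖ * ‖W *ᵥ z - Ws q *ᵥ z‖) := by simp
  have h4 := hcW z
  rw [dotProduct_sub] at h3
  have h5 : (p : ℝ) * (‖z‖ * ‖W *ᵥ z - Ws q *ᵥ z‖) ≤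
      ((p : ℝ) * ∑ i, ∑ j, |W i j - Ws q i j|) * ‖z‖ ^ 2 := by
    have : (0 : ℝ) ≤ p * ‖z‖ := by positivity
    nlinarith [mul_le_mul_of_nonneg_left h2 this]
  have h6 : ((p : ℝ) * ∑ i, ∑ j, |W i j - Ws q i j|) * ‖z‖ ^ 2 ≤ c / 2 * ‖z‖ ^ 2 := by gcongr
  unfold quad at h4 ⊢
  linarith

lemma tendsto_matrix_inv {Ss : β → Matrix (Fin p) (Fin p) ℝ} {S : Matrix (Fin p) (Fin p) ℝ}
    (hSs : Tendsto Ss l (𝓝 S)) (hS : S.PosDef) :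
    Tendsto (fun q => (Ss q)⁻¹) l (𝓝 S⁻¹) := by
  have hdet : S.det ≠ 0 := ((Matrix.isUnit_iff_isUnit_det S).mp hS.isUnit).ne_zero
  simp only [Matrix.inv_def, Ring.inverse_eq_inv']
  have h1 : Tendsto (fun q => (Ss q).det) l (𝓝 S.det) :=
    ((continuous_id.matrix_det).tendsto S).comp hSs
  have h2 : Tendsto (fun q => (Ss q).adjugate) l (𝓝 S.adjugate) :=
    ((continuous_id.matrix_adjugate).tendsto S).comp hSs
  exact (h1.inv₀ hdet).smul h2

/-- Coercivity of the quadratic form is stable under small perturbations; symmetry is part of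
`PosDef` and must be supplied. -/
lemma eventually_posDef {Ss : β → Matrix (Fin p) (Fin p) ℝ} {S : Matrix (Fin p) (Fin p) ℝ}
    (hSs : Tendsto Ss l (𝓝 S)) (hS : S.PosDef) (hsymm : ∀ᶠ q in l, (Ss q).IsSymm) :
    ∀ᶠ q in l, (Ss q).PosDef := by
  obtain ⟨c, hc, h⟩ := exists_quad_lower_of_tendsto hSs hS
  filter_upwards [h, hsymm] with q hq hq'
  refine Matrix.PosDef.of_dotProduct_mulVec_pos ?_ fun z hz => ?_
  · rw [Matrix.IsHermitian, Matrix.conjTranspose_eq_transpose_of_trivial]; exact hq'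
  · have h1 : 0 < c * ‖z‖ ^ 2 := by
      have := norm_pos_iff.mpr hz
      positivity
    simpa [quad] using h1.trans_le (hq z)

lemma IsProjection.unique {m k : ℕ} {S : Matrix (Fin p) (Fin p) ℝ} (hS : S.PosDef)
    {B : Matrix (Fin m) (Fin p) ℝ} {C : Matrix (Fin m) (Fin k) ℝ} {h : Fin m → EReal}
    {x μ ν : Fin p → ℝ} (hμ : IsProjection S B C h x μ) (hν : ν ∈ ppolyE B h C)
    (hle : quad S⁻¹ (x - ν) ≤ quad S⁻¹ (x - μ)) : ν = μ := by
  have hsymm : (S⁻¹).IsSymm := by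
    have := hS.inv.isHermitian
    rwa [Matrix.IsHermitian, Matrix.conjTranspose_eq_transpose_of_trivial] at this
  have h1 := quadForm_min_variational hsymm (convex_ppolyE B h C) hμ.1 hμ.2 hν
  have h2 := quadForm_add S⁻¹ hsymm (μ - ν) (x - μ)
  have e : μ - ν + (x - μ) = x - ν := by abel
  have e2 : ν - μ = -(μ - ν) := by abel
  rw [e] at h2
  rw [e2, dotProduct_neg, dotProduct_comm] at h1
  by_contra hne
  have h3 := quad_pos hS.inv (sub_ne_zero.mpr (Ne.symm hne))
  unfold quad at h3 hle
  linarith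

lemma exists_isProjection {m k : ℕ} {S : Matrix (Fin p) (Fin p) ℝ} (hS : S.PosDef)
    (B : Matrix (Fin m) (Fin p) ℝ) (C : Matrix (Fin m) (Fin k) ℝ) {h : Fin m → EReal}
    (h0 : ∀ j, 0 ≤ h j) (x : Fin p → ℝ) : ∃ μ, IsProjection S B C h x μ := by
  obtain ⟨c, hc, hq⟩ := exists_quad_lower hS.inv
  obtain ⟨μ, h1, h2⟩ := exists_quadForm_min S⁻¹ hc hq x
    (isClosed_ppolyE B (fun j => ((EReal.bot_lt_zero).trans_le (h0 j)).ne') C)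
    ⟨0, 0, fun j => by simpa using h0 j⟩
  exact ⟨μ, h1, h2⟩

end QuadLimits

/-! ### The local limit of the projected constraint sets -/

section LocalLimit

variable {m p k : ℕ} {β : Type*}

/-- The scaled constraint sets `{ν : B ν + C w ≤ h for some w}` converge along `l` in the sense
that `C` and `h` do and that the multipliers of the limit problem have supports on which the rank
of `C` is stable. The vector `κ` is a combination of rows that vanish identically. -/
structure LocalLimit (B : Matrix (Fin m) (Fin p) ℝ) (Cs : β → Matrix (Fin m) (Fin k) ℝ)
    (C : Matrix (Fin m) (Fin k) ℝ) (hs : β → Fin m → ℝ) (h : Fin m → EReal)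
    (S : Matrix (Fin p) (Fin p) ℝ) (κ : Fin m → ℝ) (l : Filter β) : Prop where
  tendsto_mat : Tendsto Cs l (𝓝 C)
  nonneg : ∀ q, 0 ≤ hs q
  tendsto_rhs : ∀ j, Tendsto (fun q => ((hs q j : ℝ) : EReal)) l (𝓝 (h j))
  posDef : S.PosDef
  kappa_nonneg : 0 ≤ κ
  kappa_left : Bᵀ *ᵥ κ = 0
  kappa_mat : ∀ q, (Cs q)ᵀ *ᵥ κ = 0
  kappa_rhs : ∀ q, κ ⬝ᵥ hs q = 0
  rank : ∀ (x ν : Fin p → ℝ) (ψ : Fin m → ℝ), IsProjection S B C h x ν → 0 ≤ ψ →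
    (∀ j ∉ minActivatable C (shiftE B h ν), ψ j = 0) → Bᵀ *ᵥ ψ = S⁻¹ *ᵥ (x - ν) →
    Cᵀ *ᵥ ψ = 0 → ∀ᶠ q in l, rowRank (Cs q) {j | 0 < ψ j + κ j} = rowRank C {j | 0 < ψ j + κ j}

variable {B : Matrix (Fin m) (Fin p) ℝ} {Cs : β → Matrix (Fin m) (Fin k) ℝ}
  {C : Matrix (Fin m) (Fin k) ℝ} {hs : β → Fin m → ℝ} {h : Fin m → EReal}
  {S : Matrix (Fin p) (Fin p) ℝ} {κ : Fin m → ℝ} {l : Filter β}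

lemma LocalLimit.rhs_nonneg [l.NeBot] (H : LocalLimit B Cs C hs h S κ l) (j : Fin m) : 0 ≤ h j :=
  ge_of_tendsto' (H.tendsto_rhs j) fun q => EReal.coe_nonneg.mpr (H.nonneg q j)

lemma LocalLimit.rhs_eq_zero (H : LocalLimit B Cs C hs h S κ l) {j : Fin m} (hj : 0 < κ j)
    (q : β) : hs q j = 0 := by
  have h1 := (Finset.sum_eq_zero_iff_of_nonneg fun i _ =>
    mul_nonneg (H.kappa_nonneg i) (H.nonneg q i)).mp (H.kappa_rhs q) j (Finset.mem_univ j)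
  exact (mul_eq_zero.mp h1).resolve_left hj.ne'

lemma LocalLimit.mono (H : LocalLimit B Cs C hs h S κ l) {l' : Filter β} (hl : l' ≤ l) :
    LocalLimit B Cs C hs h S κ l' where
  tendsto_mat := H.tendsto_mat.mono_left hl
  nonneg := H.nonneg
  tendsto_rhs j := (H.tendsto_rhs j).mono_left hl
  posDef := H.posDef
  kappa_nonneg := H.kappa_nonneg
  kappa_left := H.kappa_left
  kappa_mat := H.kappa_mat
  kappa_rhs := H.kappa_rhs
  rank x ν ψ h1 h2 h3 h4 h5 := hl (H.rank x ν ψ h1 h2 h3 h4 h5)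

/-- Limits of points in the constraint sets belong to the limit set. -/
lemma LocalLimit.mem_of_tendsto [l.NeBot] (H : LocalLimit B Cs C hs h S κ l)
    {νs : β → Fin p → ℝ} {ν' : Fin p → ℝ} (hν : Tendsto νs l (𝓝 ν'))
    (hmem : ∀ᶠ q in l, νs q ∈ ppoly B (hs q) (Cs q)) : ν' ∈ ppolyE B h C := by
  -- Project the limit point onto the limit set; passing lifted multipliers to the limit will show
  -- that the residual is zero.
  obtain ⟨ν, hproj⟩ := exists_isProjection H.posDef B C H.rhs_nonneg ν'
  obtain ⟨ψ, hψ0, hψK, hψB, hψC⟩ := hproj.exists_multiplier H.posDef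
  obtain ⟨w, hw⟩ := hproj.1
  have hκC : Cᵀ *ᵥ κ = 0 := tendsto_nhds_unique
    (tendsto_mulVec (tendsto_transpose H.tendsto_mat) tendsto_const_nhds)
    (tendsto_const_nhds.congr fun q => (H.kappa_mat q).symm)
  -- Adding `κ` enlarges the support to one with stable rank without changing the `B`-combination.
  obtain ⟨ηs, hηs, hker⟩ := exists_tendsto_leftKer H.tendsto_mat
    (H.rank ν' ν ψ hproj hψ0 hψK hψB hψC) (η := ψ + κ)
    (fun j hj => by
      have h1 : ψ j + κ j ≤ 0 := not_lt.mp hj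
      have h2 := hψ0 j
      have h3 := H.kappa_nonneg j
      simp only [Pi.zero_apply] at h2 h3
      exact le_antisymm h1 (add_nonneg h2 h3))
    (by rw [Matrix.mulVec_add, hψC, hκC, add_zero])
  have hpos : ∀ᶠ q in l, 0 ≤ ηs q := by
    have : ∀ᶠ q in l, ∀ j, 0 < ψ j + κ j → 0 ≤ ηs q j := by
      rw [eventually_all]
      intro j
      by_cases hj : 0 < ψ j + κ j
      · filter_upwards [(tendsto_pi_nhds.mp hηs j).eventually_const_lt hj] with q hq _ using hq.le
      · exact Eventually.of_forall fun q hj' => absurd hj' hj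
    filter_upwards [this, hker] with q h1 h2 j
    by_cases hj : 0 < ψ j + κ j
    · exact h1 j hj
    · exact (h2.1 j hj).ge
  -- Infinite limits of `hs` do no harm: rows with `ψ j > 0` are active and so have a finite limit,
  -- rows with `κ j > 0` have `hs q j = 0`, and elsewhere `ηs q j` is eventually zero.
  have hrhs : Tendsto (fun q => ηs q ⬝ᵥ hs q) l (𝓝 (ψ ⬝ᵥ (B *ᵥ ν + C *ᵥ w))) := by
    refine tendsto_finsetSum _ fun j _ => ?_
    rcases (H.kappa_nonneg j).eq_or_lt with hκ | hκ
    · rcases (hψ0 j).eq_or_lt with hψ | hψ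
      · have : ∀ᶠ q in l, ηs q j * hs q j = 0 := by
          filter_upwards [hker] with q hq
          rw [hq.1 j (by simp only [Pi.zero_apply] at hκ hψ; simp [← hκ, ← hψ]), zero_mul]
        simp only [Pi.zero_apply] at hψ
        rw [← hψ, zero_mul]
        exact tendsto_const_nhds.congr' (by filter_upwards [this] with q hq using hq.symm)
      · have h1 : j ∈ minActivatable C (shiftE B h ν) := by
          by_contra hj
          exact hψ.ne' (hψK j hj)
        have h2 := eq_of_mem_minActivatable (mem_polyE_shiftE_iff.mpr hw) h1
        rw [coe_eq_shiftE_iff] at h2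
        have h3 := H.tendsto_rhs j
        rw [← h2, EReal.tendsto_coe] at h3
        have h4 := (tendsto_pi_nhds.mp hηs j).mul h3
        simp only [Pi.zero_apply] at hκ
        simpa [← hκ] using h4
    · have h1 := H.rhs_eq_zero hκ
      have h2 : ψ j * (B *ᵥ ν + C *ᵥ w) j = 0 := by
        rcases (hψ0 j).eq_or_lt with hψ | hψ
        · simp only [Pi.zero_apply] at hψ
          rw [← hψ, zero_mul]
        · have h3 : j ∈ minActivatable C (shiftE B h ν) := by
            by_contra hj
            exact hψ.ne' (hψK j hj)
          have h4 := eq_of_mem_minActivatable (mem_polyE_shiftE_iff.mpr hw) h3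
          rw [coe_eq_shiftE_iff] at h4
          have h5 := H.tendsto_rhs j
          rw [← h4, EReal.tendsto_coe] at h5
          have h6 := tendsto_nhds_unique h5 (tendsto_const_nhds.congr fun q => (h1 q).symm)
          rw [Pi.add_apply, h6, mul_zero]
      rw [h2]
      exact tendsto_const_nhds.congr fun q => by rw [h1 q, mul_zero]
  have hlhs : Tendsto (fun q => ηs q ⬝ᵥ (B *ᵥ νs q)) l (𝓝 ((ψ + κ) ⬝ᵥ (B *ᵥ ν'))) :=
    tendsto_finsetSum _ fun j _ => (tendsto_pi_nhds.mp hηs j).mul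
      (tendsto_pi_nhds.mp (tendsto_mulVec tendsto_const_nhds hν) j)
  have hle : (ψ + κ) ⬝ᵥ (B *ᵥ ν') ≤ ψ ⬝ᵥ (B *ᵥ ν + C *ᵥ w) := by
    refine le_of_tendsto_of_tendsto hlhs hrhs ?_
    filter_upwards [hker, hpos, hmem] with q h1 h2 h3
    obtain ⟨v, hv⟩ := h3
    have h4 : ηs q ⬝ᵥ (B *ᵥ νs q + Cs q *ᵥ v) ≤ ηs q ⬝ᵥ hs q :=
      Finset.sum_le_sum fun j _ => mul_le_mul_of_nonneg_left (hv j) (h2 j)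
    have h5 := h1.2
    rw [Matrix.mulVec_transpose] at h5
    rwa [dotProduct_add, dotProduct_mulVec_eq_zero h5, add_zero] at h4
  rw [Matrix.mulVec_transpose] at hψC
  have hκB := H.kappa_left
  rw [Matrix.mulVec_transpose] at hκB
  rw [dotProduct_add, dotProduct_mulVec_eq_zero hψC, add_zero, add_dotProduct,
    dotProduct_mulVec_eq_zero hκB, add_zero, Matrix.dotProduct_mulVec, Matrix.dotProduct_mulVec,
    ← Matrix.mulVec_transpose, hψB] at hle
  have h7 : quad S⁻¹ (ν' - ν) ≤ 0 := by
    rw [quad, dotProduct_comm, dotProduct_sub]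
    linarith
  have h8 : ν' - ν = 0 := by
    by_contra hne
    exact absurd (quad_pos H.posDef.inv hne) (not_lt.mpr h7)
  rw [sub_eq_zero.mp h8]
  exact hproj.1

/-- Points of the limit set are limits of points in the constraint sets. -/
lemma exists_tendsto_ppoly {D : Matrix (Fin m) (Fin k) ℝ} {Ps : ℕ → Matrix (Fin p) (Fin k) ℝ}
    {P : Matrix (Fin p) (Fin k) ℝ} (hP : Tendsto Ps atTop (𝓝 P)) {hs : ℕ → Fin m → ℝ}
    (h0 : ∀ q, 0 ≤ hs q) (hlim : ∀ j, Tendsto (fun q => ((hs q j : ℝ) : EReal)) atTop (𝓝 (h j)))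
    {ν : Fin p → ℝ} (hν : ν ∈ ppolyE B h (B * P + D)) :
    ∃ νs : ℕ → Fin p → ℝ, Tendsto νs atTop (𝓝 ν) ∧
      ∀ᶠ q in atTop, νs q ∈ ppoly B (hs q) (B * Ps q + D) := by
  obtain ⟨w, hw⟩ := hν
  -- The substitution `a + P w` turns the constraint into one with the fixed matrix `[B, D]`, so
  -- Hoffman's bound applies without any rank condition.
  have e : ∀ (P : Matrix (Fin p) (Fin k) ℝ) (a : Fin p → ℝ) (w : Fin k → ℝ),
      B *ᵥ a + (B * P + D) *ᵥ w = Matrix.fromCols B D *ᵥ Sum.elim (a + P *ᵥ w) w := by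
    intro P a w
    rw [Matrix.fromCols_mulVec_sumElim, Matrix.mulVec_add, Matrix.add_mulVec,
      ← Matrix.mulVec_mulVec, add_assoc]
  obtain ⟨zs, hzs, hfeas⟩ := exists_tendsto_feasible (Matrix.fromCols B D) h0 hlim
    (z := Sum.elim (ν + P *ᵥ w) w) (fun j => by rw [← e]; exact hw j)
  have hz1 : Tendsto (fun q => zs q ∘ Sum.inl) atTop (𝓝 (ν + P *ᵥ w)) :=
    tendsto_pi_nhds.mpr fun i => tendsto_pi_nhds.mp hzs (Sum.inl i)
  have hz2 : Tendsto (fun q => zs q ∘ Sum.inr) atTop (𝓝 w) :=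
    tendsto_pi_nhds.mpr fun i => tendsto_pi_nhds.mp hzs (Sum.inr i)
  refine ⟨fun q => zs q ∘ Sum.inl - Ps q *ᵥ (zs q ∘ Sum.inr), ?_, ?_⟩
  · have := hz1.sub (tendsto_mulVec hP hz2)
    rwa [add_sub_cancel_right] at this
  · filter_upwards [hfeas] with q hq
    refine ⟨zs q ∘ Sum.inr, ?_⟩
    rw [e, sub_add_cancel, Sum.elim_comp_inl_inr]
    exact hq

end LocalLimit

/-! ### Limits along ultrafilters -/

section UltraLimit

variable {m p k : ℕ}

/-- Ultrafilters replace repeated extraction of subsequences: bounded functions converge. -/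
lemma exists_tendsto_of_norm_le {β F : Type*} [NormedAddCommGroup F] [ProperSpace F]
    {l : Ultrafilter β} {f : β → F} {R : ℝ} (hb : ∀ᶠ q in (l : Filter β), ‖f q‖ ≤ R) :
    ∃ z, Tendsto f l (𝓝 z) := by
  obtain ⟨z, -, hz⟩ := (isCompact_closedBall (0 : F) R).ultrafilter_le_nhds (l.map f) (by
    rw [Ultrafilter.coe_map, le_principal_iff, mem_map]
    filter_upwards [hb] with q hq
    simpa using hq)
  exact ⟨z, hz⟩

variable {B : Matrix (Fin m) (Fin p) ℝ} {D : Matrix (Fin m) (Fin k) ℝ}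
  {Ps : ℕ → Matrix (Fin p) (Fin k) ℝ} {P : Matrix (Fin p) (Fin k) ℝ}
  {hs : ℕ → Fin m → ℝ} {h : Fin m → EReal} {Ss : ℕ → Matrix (Fin p) (Fin p) ℝ}
  {S : Matrix (Fin p) (Fin p) ℝ} {κ : Fin m → ℝ} {l : Ultrafilter ℕ}
  {xs νs : ℕ → Fin p → ℝ} {x ν : Fin p → ℝ}

/-- Feasible points approximating `ν` bound the optimal values. The limit of the projections lies in
the limit set and does at least as well as `ν`, so it is `ν` by uniqueness. -/
lemma tendsto_projection (hl : (l : Filter ℕ) ≤ atTop)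
    (H : LocalLimit B (fun q => B * Ps q + D) (B * P + D) hs h S κ atTop)
    (hP : Tendsto Ps atTop (𝓝 P)) (hS : Tendsto Ss l (𝓝 S)) (hx : Tendsto xs l (𝓝 x))
    (hproj : ∀ᶠ q in (l : Filter ℕ),
      IsProjection (Ss q) B (B * Ps q + D) (toE (hs q)) (xs q) (νs q))
    (hν : IsProjection S B (B * P + D) h x ν) : Tendsto νs l (𝓝 ν) := by
  obtain ⟨νt, hνt, hmem⟩ := exists_tendsto_ppoly hP H.nonneg H.tendsto_rhs hν.1
  have hSi := tendsto_matrix_inv hS H.posDef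
  have hT := tendsto_quad hSi (hx.sub (hνt.mono_left hl))
  have hle : ∀ᶠ q in (l : Filter ℕ),
      quad (Ss q)⁻¹ (xs q - νs q) ≤ quad (Ss q)⁻¹ (xs q - νt q) := by
    filter_upwards [hproj, hl hmem] with q h1 h2
    exact h1.2 _ (by rw [ppolyE_toE]; exact h2)
  obtain ⟨c, hc, hlow⟩ := exists_quad_lower_of_tendsto hSi H.posDef.inv
  obtain ⟨z, hz⟩ := exists_tendsto_of_norm_le (l := l) (f := fun q => xs q - νs q)
    (R := √((quad S⁻¹ (x - ν) + 1) / c)) (by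
      filter_upwards [hle, hlow, hT.eventually_le_const (lt_add_one _)] with q h1 h2 h3
      refine Real.le_sqrt_of_sq_le ?_
      rw [le_div_iff₀ hc]
      linarith [h2 (xs q - νs q)])
  have hν' : Tendsto νs l (𝓝 (x - z)) := by
    have := hx.sub hz
    simpa using this
  have hmem' := (H.mono hl).mem_of_tendsto hν' (by
    filter_upwards [hproj] with q h1
    rw [← ppolyE_toE]
    exact h1.1)
  have h4 := le_of_tendsto_of_tendsto (tendsto_quad hSi (hx.sub hν')) hT hle
  rwa [hν.unique H.posDef hmem' h4] at hν'

lemma transpose_fromCols_mulVec (η : Fin m → ℝ) :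
    (Matrix.fromCols B D)ᵀ *ᵥ η = Sum.elim (Bᵀ *ᵥ η) (Dᵀ *ᵥ η) := by
  rw [Matrix.transpose_fromCols, Matrix.fromRows_mulVec]

lemma transpose_mul_add_mulVec (Q : Matrix (Fin p) (Fin k) ℝ) (η : Fin m → ℝ) :
    (B * Q + D)ᵀ *ᵥ η = Qᵀ *ᵥ (Bᵀ *ᵥ η) + Dᵀ *ᵥ η := by
  rw [Matrix.transpose_add, Matrix.transpose_mul, Matrix.add_mulVec, Matrix.mulVec_mulVec]

/-- Multipliers can be chosen bounded by the residual of the projection. -/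
lemma exists_bounded_multiplier (B : Matrix (Fin m) (Fin p) ℝ) (D : Matrix (Fin m) (Fin k) ℝ) :
    ∃ c : ℝ, 0 ≤ c ∧ ∀ (Q : Matrix (Fin p) (Fin k) ℝ) (g : Fin m → ℝ)
      (S : Matrix (Fin p) (Fin p) ℝ) (x ν : Fin p → ℝ), S.PosDef →
      IsProjection S B (B * Q + D) (toE g) x ν →
      ∃ ψ : Fin m → ℝ, 0 ≤ ψ ∧ (B * Q + D)ᵀ *ᵥ ψ = 0 ∧ ψ ⬝ᵥ (B *ᵥ ν - g) = 0 ∧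
        Bᵀ *ᵥ ψ = S⁻¹ *ᵥ (x - ν) ∧
        ‖ψ‖ ≤ c * ‖(Sum.elim (S⁻¹ *ᵥ (x - ν)) (-(Qᵀ *ᵥ (S⁻¹ *ᵥ (x - ν)))) : Fin p ⊕ Fin k → ℝ)‖ := by
  -- Applying the bound to `[B, D]` instead of `[B, B Q + D]` gives a constant that does not depend
  -- on `Q`.
  obtain ⟨c, hc, hb⟩ := exists_multiplier_bound (Matrix.fromCols B D)
  refine ⟨c, hc, fun Q g S x ν hS hproj => ?_⟩
  obtain ⟨ψ, ⟨h0, hC, hsl⟩, hB⟩ := hproj.mem_cone hS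
  obtain ⟨ψ', h0', hsupp, hG, hn⟩ := hb ψ h0
  simp only at hB
  rw [transpose_fromCols_mulVec, transpose_fromCols_mulVec] at hG
  rw [transpose_fromCols_mulVec] at hn
  have hB' : Bᵀ *ᵥ ψ' = Bᵀ *ᵥ ψ := by
    have := congrArg (fun f => f ∘ Sum.inl) hG
    simpa using this
  have hD' : Dᵀ *ᵥ ψ' = Dᵀ *ᵥ ψ := by
    have := congrArg (fun f => f ∘ Sum.inr) hG
    simpa using this
  have hC0 : (B * Q + D)ᵀ *ᵥ ψ = 0 := by rw [Matrix.mulVec_transpose, hC]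
  have hC' : (B * Q + D)ᵀ *ᵥ ψ' = 0 := by
    rw [transpose_mul_add_mulVec, hB', hD', ← transpose_mul_add_mulVec, hC0]
  have hDψ : Dᵀ *ᵥ ψ = -(Qᵀ *ᵥ (S⁻¹ *ᵥ (x - ν))) := by
    rw [transpose_mul_add_mulVec, hB] at hC0
    exact eq_neg_of_add_eq_zero_right hC0
  refine ⟨ψ', h0', hC', ?_, hB'.trans hB, by rwa [hB, hDψ] at hn⟩
  obtain ⟨w, hw⟩ := hproj.1
  have e : B *ᵥ ν + (B * Q + D) *ᵥ w - g = (B *ᵥ ν - g) + (B * Q + D) *ᵥ w := by abel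
  have h1 : ψ ⬝ᵥ (B *ᵥ ν + (B * Q + D) *ᵥ w - g) = 0 := by
    rw [e, dotProduct_add, hsl, dotProduct_mulVec_eq_zero hC, add_zero]
  have h2 : ψ' ⬝ᵥ (B *ᵥ ν + (B * Q + D) *ᵥ w - g) = 0 := by
    refine Finset.sum_eq_zero fun j _ => ?_
    by_cases hj : (B *ᵥ ν + (B * Q + D) *ᵥ w - g) j = 0
    · rw [hj, mul_zero]
    · rw [hsupp j (eq_zero_of_slack h0 (fun i => sub_nonpos.mpr
        (EReal.coe_le_coe_iff.mp (hw i))) h1 hj), zero_mul]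
  rw [Matrix.mulVec_transpose] at hC'
  rwa [e, dotProduct_add, dotProduct_mulVec_eq_zero hC', add_zero] at h2

/-- Complementary slackness in the limit. -/
lemma LocalLimit.slack_of_tendsto {Cs : ℕ → Matrix (Fin m) (Fin k) ℝ}
    {C : Matrix (Fin m) (Fin k) ℝ} {l : Filter ℕ} [l.NeBot] (H : LocalLimit B Cs C hs h S κ l)
    (hν : Tendsto νs l (𝓝 ν)) {ψs : ℕ → Fin m → ℝ} {ψ : Fin m → ℝ} (hψ : Tendsto ψs l (𝓝 ψ))
    (h0 : ∀ᶠ q in l, 0 ≤ ψs q) (hsl : ∀ᶠ q in l, ψs q ⬝ᵥ (B *ᵥ νs q - hs q) = 0)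
    (hC : Cᵀ *ᵥ ψ = 0) {j : Fin m} (hj : j ∉ minActivatable C (shiftE B h ν)) : ψ j = 0 := by
  have hψ0 : 0 ≤ ψ := ge_of_tendsto hψ h0
  rw [Matrix.mulVec_transpose] at hC
  have hB : Tendsto (fun q => ψs q ⬝ᵥ (B *ᵥ νs q)) l (𝓝 (ψ ⬝ᵥ (B *ᵥ ν))) :=
    tendsto_finsetSum _ fun j _ => (tendsto_pi_nhds.mp hψ j).mul
      (tendsto_pi_nhds.mp (tendsto_mulVec tendsto_const_nhds hν) j)
  have hterm : ∀ᶠ q in l, ψs q ⬝ᵥ hs q = ψs q ⬝ᵥ (B *ᵥ νs q) := by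
    filter_upwards [hsl] with q hq
    rw [dotProduct_sub] at hq
    linarith
  -- the right-hand side is finite on the support of the multiplier
  have hfin : ∀ i, 0 < ψ i → h i ≠ ⊤ := by
    intro i hi htop
    have h1 := H.tendsto_rhs i
    rw [htop, EReal.tendsto_coe_nhds_top_iff] at h1
    have h2 : Tendsto (fun q => ψs q i * hs q i) l atTop :=
      (tendsto_pi_nhds.mp hψ i).pos_mul_atTop hi h1
    have h3 : Tendsto (fun q => ψs q ⬝ᵥ (B *ᵥ νs q)) l atTop := by
      refine tendsto_atTop_mono' l ?_ h2
      filter_upwards [hterm, h0] with q h4 h5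
      rw [← h4]
      exact Finset.single_le_sum (f := fun i => ψs q i * hs q i)
        (fun i _ => mul_nonneg (h5 i) (H.nonneg q i)) (Finset.mem_univ i)
    exact not_tendsto_nhds_of_tendsto_atTop h3 _ hB
  have hreal : ∀ i, 0 < ψ i → h i = ((h i).toReal : EReal) := fun i hi =>
    (EReal.coe_toReal (hfin i hi) (EReal.bot_lt_zero.trans_le (H.rhs_nonneg i)).ne').symm
  -- Only an inequality survives the limit, as terms off the support of `ψ` are nonnegative but may
  -- not vanish. Feasibility gives the reverse inequality at every `w`, which forces equality row by
  -- row.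
  have hsum : ∑ i, ψ i * (h i).toReal ≤ ψ ⬝ᵥ (B *ᵥ ν) := by
    classical
    have h1 : Tendsto (fun q => ∑ i with 0 < ψ i, ψs q i * hs q i) l
        (𝓝 (∑ i with 0 < ψ i, ψ i * (h i).toReal)) := by
      refine tendsto_finsetSum _ fun i hi => (tendsto_pi_nhds.mp hψ i).mul ?_
      have h2 := H.tendsto_rhs i
      rw [hreal i (Finset.mem_filter.mp hi).2, EReal.tendsto_coe] at h2
      exact h2
    have h3 : ∑ i, ψ i * (h i).toReal = ∑ i with 0 < ψ i, ψ i * (h i).toReal := by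
      refine (Finset.sum_filter_of_ne fun i _ hne => ?_).symm
      exact lt_of_le_of_ne (hψ0 i) fun h4 => hne (by rw [← h4]; simp)
    rw [h3]
    refine le_of_tendsto_of_tendsto h1 hB ?_
    filter_upwards [hterm, h0] with q h4 h5
    rw [← h4]
    exact Finset.sum_le_univ_sum_of_nonneg fun i => mul_nonneg (h5 i) (H.nonneg q i)
  by_contra hne
  have hpos : 0 < ψ j := lt_of_le_of_ne (hψ0 j) (Ne.symm hne)
  refine hj fun J hJ => ?_
  obtain ⟨w, hw, rfl⟩ := hJ
  rw [mem_polyE_shiftE_iff] at hw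
  have hle : ∀ i, ψ i * (B *ᵥ ν + C *ᵥ w) i ≤ ψ i * (h i).toReal := by
    intro i
    rcases (hψ0 i).eq_or_lt with h1 | h1
    · simp only [Pi.zero_apply] at h1
      rw [← h1, zero_mul, zero_mul]
    · refine mul_le_mul_of_nonneg_left ?_ h1.le
      have h2 := hw i
      rwa [hreal i h1, EReal.coe_le_coe_iff] at h2
  have hge : ∑ i, ψ i * (h i).toReal ≤ ∑ i, ψ i * (B *ᵥ ν + C *ᵥ w) i := by
    refine hsum.trans_eq ?_
    change _ = ψ ⬝ᵥ (B *ᵥ ν + C *ᵥ w)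
    rw [dotProduct_add, dotProduct_mulVec_eq_zero hC, add_zero]
  have heq := (Finset.sum_eq_sum_iff_of_le fun i _ => hle i).mp
    (le_antisymm (Finset.sum_le_sum fun i _ => hle i) hge) j (Finset.mem_univ j)
  have h3 := mul_left_cancel₀ hpos.ne' heq
  rw [Set.mem_ofPred_eq, coe_eq_shiftE_iff, hreal j hpos, EReal.coe_eq_coe_iff]
  exact h3

/-- The span of the multiplier cone contains all combinations of rows on the support of a
multiplier. -/
lemma finrank_normSpan_le_coneDim {C : Matrix (Fin m) (Fin k) ℝ} {g : Fin m → ℝ}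
    {w : Fin k → ℝ} {K : Set (Fin m)} {ψ : Fin m → ℝ} (hw : B *ᵥ ν + C *ᵥ w ≤ g)
    (h0 : 0 ≤ ψ) (hC : Cᵀ *ᵥ ψ = 0) (hsl : ψ ⬝ᵥ (B *ᵥ ν - g) = 0) (hK : ∀ j ∈ K, 0 < ψ j) :
    Module.finrank ℝ (normSpan B C K) ≤ coneDim B C g ν := by
  rw [Matrix.mulVec_transpose] at hC
  have e : B *ᵥ ν + C *ᵥ w - g = (B *ᵥ ν - g) + C *ᵥ w := by abel
  refine Submodule.finrank_mono ?_
  rintro _ ⟨η, hη, hCη, rfl⟩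
  rw [Matrix.mulVec_transpose] at hCη
  have hηsl : η ⬝ᵥ (B *ᵥ ν - g) = 0 := by
    have h1 : ψ ⬝ᵥ (B *ᵥ ν + C *ᵥ w - g) = 0 := by
      rw [e, dotProduct_add, hsl, dotProduct_mulVec_eq_zero hC, add_zero]
    have h2 : η ⬝ᵥ (B *ᵥ ν + C *ᵥ w - g) = 0 := by
      refine Finset.sum_eq_zero fun j _ => ?_
      by_cases hj : j ∈ K
      · by_cases hs : (B *ᵥ ν + C *ᵥ w - g) j = 0
        · rw [hs, mul_zero]
        · exact absurd (eq_zero_of_slack h0 (sub_nonpos.mpr hw) h1 hs) (hK j hj).ne'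
      · rw [hη j hj, zero_mul]
    rwa [e, dotProduct_add, dotProduct_mulVec_eq_zero hCη, add_zero] at h2
  -- As `ψ` is positive on `K`, a small step along `η` stays in the cone, so `η` is a multiple of a
  -- difference of two cone elements.
  obtain ⟨ε, hε, hpos⟩ : ∃ ε : ℝ, 0 < ε ∧ 0 ≤ ψ + ε • η := by
    have : ∀ᶠ ε in 𝓝[>] (0 : ℝ), ∀ j, 0 ≤ ψ j + ε * η j := by
      rw [eventually_all]
      intro j
      by_cases hj : j ∈ K
      · have h1 : Tendsto (fun ε : ℝ => ψ j + ε * η j) (𝓝[>] 0) (𝓝 (ψ j + 0 * η j)) :=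
          ((tendsto_id.mono_left nhdsWithin_le_nhds).mul_const _).const_add _
        rw [zero_mul, add_zero] at h1
        filter_upwards [h1.eventually_const_lt (hK j hj)] with ε hε using hε.le
      · exact Eventually.of_forall fun ε => by rw [hη j hj, mul_zero, add_zero]; exact h0 j
    obtain ⟨ε, h1, h2⟩ := (this.and self_mem_nhdsWithin).exists
    exact ⟨ε, h2, h1⟩
  have h1 : Bᵀ *ᵥ ψ ∈ Submodule.span ℝ ((fun η : Fin m → ℝ => Bᵀ *ᵥ η) ''
      {η | 0 ≤ η ∧ η ᵥ* C = 0 ∧ η ⬝ᵥ (B *ᵥ ν - g) = 0}) :=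
    Submodule.subset_span ⟨ψ, ⟨h0, hC, hsl⟩, rfl⟩
  have h2 : Bᵀ *ᵥ (ψ + ε • η) ∈ Submodule.span ℝ ((fun η : Fin m → ℝ => Bᵀ *ᵥ η) ''
      {η | 0 ≤ η ∧ η ᵥ* C = 0 ∧ η ⬝ᵥ (B *ᵥ ν - g) = 0}) :=
    Submodule.subset_span ⟨ψ + ε • η, ⟨hpos, by
      rw [Matrix.add_vecMul, Matrix.smul_vecMul, hC, hCη, smul_zero, add_zero], by
      rw [add_dotProduct, smul_dotProduct, hsl, hηsl, smul_zero, add_zero]⟩, rfl⟩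
  have h3 : Bᵀ *ᵥ η = ε⁻¹ • (Bᵀ *ᵥ (ψ + ε • η) - Bᵀ *ᵥ ψ) := by
    rw [Matrix.mulVec_add, add_sub_cancel_left, Matrix.mulVec_smul, smul_smul,
      inv_mul_cancel₀ hε.ne', one_smul]
  rw [h3]
  exact Submodule.smul_mem _ _ (Submodule.sub_mem _ h2 h1)

/-- The dimensions of the multiplier cones are eventually at least the dimension of a space that
contains the residual of the limit projection. -/
lemma exists_normSpan_le_coneDim (hl : (l : Filter ℕ) ≤ atTop)
    (H : LocalLimit B (fun q => B * Ps q + D) (B * P + D) hs h S κ atTop)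
    (hP : Tendsto Ps atTop (𝓝 P)) (hS : Tendsto Ss l (𝓝 S))
    (hSpd : ∀ᶠ q in (l : Filter ℕ), (Ss q).PosDef) (hx : Tendsto xs l (𝓝 x))
    (hproj : ∀ᶠ q in (l : Filter ℕ),
      IsProjection (Ss q) B (B * Ps q + D) (toE (hs q)) (xs q) (νs q))
    (hν : IsProjection S B (B * P + D) h x ν) :
    ∃ K : Set (Fin m), S⁻¹ *ᵥ (x - ν) ∈ normSpan B (B * P + D) K ∧
      ∀ᶠ q in (l : Filter ℕ), Module.finrank ℝ (normSpan B (B * P + D) K) ≤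
        coneDim B (B * Ps q + D) (hs q) (νs q) := by
  have hνs := tendsto_projection hl H hP hS hx hproj hν
  have hSi := tendsto_matrix_inv hS H.posDef
  have hPl := hP.mono_left hl
  obtain ⟨c, hc, hbd⟩ := exists_bounded_multiplier B D
  have hex : ∀ᶠ q in (l : Filter ℕ), ∃ ψ : Fin m → ℝ, 0 ≤ ψ ∧ (B * Ps q + D)ᵀ *ᵥ ψ = 0 ∧
      ψ ⬝ᵥ (B *ᵥ νs q - hs q) = 0 ∧ Bᵀ *ᵥ ψ = (Ss q)⁻¹ *ᵥ (xs q - νs q) ∧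
      ‖ψ‖ ≤ c * ‖(Sum.elim ((Ss q)⁻¹ *ᵥ (xs q - νs q))
        (-((Ps q)ᵀ *ᵥ ((Ss q)⁻¹ *ᵥ (xs q - νs q)))) : Fin p ⊕ Fin k → ℝ)‖ := by
    filter_upwards [hproj, hSpd] with q h1 h2 using hbd _ _ _ _ _ h2 h1
  obtain ⟨ψs, hψs⟩ := hex.choice
  have hy := tendsto_mulVec hSi (hx.sub hνs)
  have hg : Tendsto (fun q => (Sum.elim ((Ss q)⁻¹ *ᵥ (xs q - νs q))
      (-((Ps q)ᵀ *ᵥ ((Ss q)⁻¹ *ᵥ (xs q - νs q)))) : Fin p ⊕ Fin k → ℝ)) l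
      (𝓝 (Sum.elim (S⁻¹ *ᵥ (x - ν)) (-(Pᵀ *ᵥ (S⁻¹ *ᵥ (x - ν)))))) := by
    have h2 := (tendsto_mulVec (tendsto_transpose hPl) hy).neg
    refine tendsto_pi_nhds.mpr ?_
    rintro (i | i)
    · exact tendsto_pi_nhds.mp hy i
    · exact tendsto_pi_nhds.mp h2 i
  obtain ⟨ψ, hψ⟩ := exists_tendsto_of_norm_le (l := l) (f := ψs)
    (R := c * (‖(Sum.elim (S⁻¹ *ᵥ (x - ν)) (-(Pᵀ *ᵥ (S⁻¹ *ᵥ (x - ν)))) :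
      Fin p ⊕ Fin k → ℝ)‖ + 1)) (by
    filter_upwards [hψs, hg.norm.eventually_le_const (lt_add_one _)] with q h1 h2
    exact h1.2.2.2.2.trans (mul_le_mul_of_nonneg_left h2 hc))
  have hψ0 : 0 ≤ ψ := ge_of_tendsto hψ (by filter_upwards [hψs] with q hq using hq.1)
  have hCl := (H.mono hl).tendsto_mat
  have hψC : (B * P + D)ᵀ *ᵥ ψ = 0 := tendsto_nhds_unique
    (tendsto_mulVec (tendsto_transpose hCl) hψ)
    (tendsto_const_nhds.congr' (by filter_upwards [hψs] with q hq using hq.2.1.symm))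
  have hψB : Bᵀ *ᵥ ψ = S⁻¹ *ᵥ (x - ν) := tendsto_nhds_unique
    (tendsto_mulVec tendsto_const_nhds hψ)
    (hy.congr' (by filter_upwards [hψs] with q hq using hq.2.2.2.1.symm))
  have hψK : ∀ j ∉ minActivatable (B * P + D) (shiftE B h ν), ψ j = 0 := fun j hj =>
    (H.mono hl).slack_of_tendsto hνs hψ (by filter_upwards [hψs] with q hq using hq.1)
      (by filter_upwards [hψs] with q hq using hq.2.2.1) hψC hj
  have hκC : (B * P + D)ᵀ *ᵥ κ = 0 := tendsto_nhds_unique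
    (tendsto_mulVec (tendsto_transpose H.tendsto_mat) tendsto_const_nhds)
    (tendsto_const_nhds.congr fun q => (H.kappa_mat q).symm)
  have hrank := hl (H.rank x ν ψ hν hψ0 hψK hψB hψC)
  -- The set is the support of the limit multiplier enlarged by `κ`; the sample multipliers plus `κ`
  -- are eventually positive on it.
  refine ⟨{j | 0 < ψ j + κ j}, ⟨ψ + κ, fun j hj => ?_, ?_, ?_⟩, ?_⟩
  · have h1 : ψ j + κ j ≤ 0 := not_lt.mp hj
    have h2 := hψ0 j
    have h3 := H.kappa_nonneg j
    simp only [Pi.zero_apply] at h2 h3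
    exact le_antisymm h1 (add_nonneg h2 h3)
  · rw [Matrix.mulVec_add, hψC, hκC, add_zero]
  · rw [Matrix.mulVec_add, hψB, H.kappa_left, add_zero]
  have hpos : ∀ᶠ q in (l : Filter ℕ), ∀ j, 0 < ψ j + κ j → 0 < ψs q j + κ j := by
    rw [eventually_all]
    intro j
    by_cases hj : 0 < ψ j + κ j
    · filter_upwards [((tendsto_pi_nhds.mp hψ j).add_const (κ j)).eventually_const_lt hj]
        with q hq _ using hq
    · exact Eventually.of_forall fun q hj' => absurd hj' hj
  filter_upwards [hpos, hψs, hproj, hrank] with q h1 h2 h3 h4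
  obtain ⟨w, hw⟩ := h3.1
  have h5 := finrank_normSpan_le_coneDim (B := B) (C := B * Ps q + D) (g := hs q) (ν := νs q)
    (w := w) (K := {j | 0 < ψ j + κ j}) (ψ := ψs q + κ) (fun j => EReal.coe_le_coe_iff.mp (hw j))
    (add_nonneg h2.1 H.kappa_nonneg) (by rw [Matrix.mulVec_add, h2.2.1, H.kappa_mat q, add_zero])
    (by
      have hκB := H.kappa_left
      rw [Matrix.mulVec_transpose] at hκB
      rw [add_dotProduct, h2.2.2.1, zero_add, dotProduct_sub, H.kappa_rhs q,
        dotProduct_mulVec_eq_zero hκB, sub_zero]) h1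
  -- The sample and limit spans have equal dimension: the rank of `[B, C]` is the same for all `C =
  -- B Q + D`, and that of `C` is stable.
  have h6 := finrank_normSpan_add B (B * Ps q + D) {j | 0 < ψ j + κ j}
  have h7 := finrank_normSpan_add B (B * P + D) {j | 0 < ψ j + κ j}
  rw [rowRank_fromCols_mul_add] at h6 h7
  omega

end UltraLimit

/-! ### The limit of the rejection region -/

section LimitRegion

open scoped ENNReal RealInnerProductSpace

variable {m p k : ℕ}

/-- The vector `W z` as an element of Euclidean space. -/
def whiten (W : Matrix (Fin p) (Fin p) ℝ) (z : Fin p → ℝ) : EuclideanSpace ℝ (Fin p) :=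
  WithLp.toLp 2 (W *ᵥ z)

variable {W V S : Matrix (Fin p) (Fin p) ℝ}

lemma whiten_sub (W : Matrix (Fin p) (Fin p) ℝ) (a b : Fin p → ℝ) :
    whiten W (a - b) = whiten W a - whiten W b := by
  rw [whiten, Matrix.mulVec_sub]; rfl

lemma whiten_mulVec (hWV : W * V = 1) (y : EuclideanSpace ℝ (Fin p)) :
    whiten W (V *ᵥ y.ofLp) = y := by
  rw [whiten, Matrix.mulVec_mulVec, hWV, Matrix.one_mulVec]

lemma mulVec_whiten (hVW : V * W = 1) (z : Fin p → ℝ) : V *ᵥ (whiten W z).ofLp = z := by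
  rw [whiten, Matrix.mulVec_mulVec, hVW, Matrix.one_mulVec]

lemma inner_whiten (y : EuclideanSpace ℝ (Fin p)) (z : Fin p → ℝ) :
    ⟪y, whiten W z⟫ = (Wᵀ *ᵥ y.ofLp) ⬝ᵥ z := by
  rw [EuclideanSpace.inner_eq_star_dotProduct, whiten, Matrix.mulVec_transpose,
    ← Matrix.dotProduct_mulVec, star_trivial, dotProduct_comm]

lemma transpose_mulVec_whiten (hW : Wᵀ * W = S⁻¹) (z : Fin p → ℝ) :
    Wᵀ *ᵥ (whiten W z).ofLp = S⁻¹ *ᵥ z := by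
  rw [whiten, Matrix.mulVec_mulVec, hW]

lemma sq_norm_whiten (hW : Wᵀ * W = S⁻¹) (z : Fin p → ℝ) : ‖whiten W z‖ ^ 2 = quad S⁻¹ z := by
  rw [← real_inner_self_eq_norm_sq, inner_whiten, transpose_mulVec_whiten hW, dotProduct_comm]
  rfl

/-- The projected constraint set in whitened coordinates. -/
def whitenedSet (V : Matrix (Fin p) (Fin p) ℝ) (B : Matrix (Fin m) (Fin p) ℝ)
    (C : Matrix (Fin m) (Fin k) ℝ) (h : Fin m → EReal) : Set (EuclideanSpace ℝ (Fin p)) :=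
  {y | V *ᵥ y.ofLp ∈ ppolyE B h C}

/-- The projection onto the projected constraint set in whitened coordinates. -/
def whitenedProj (W V S : Matrix (Fin p) (Fin p) ℝ) (B : Matrix (Fin m) (Fin p) ℝ)
    (C : Matrix (Fin m) (Fin k) ℝ) (h : Fin m → EReal) (y : EuclideanSpace ℝ (Fin p)) :
    EuclideanSpace ℝ (Fin p) :=
  whiten W (Classical.epsilon fun μ => IsProjection S B C h (V *ᵥ y.ofLp) μ)

/-- The vectors that correspond to `normSpan` in whitened coordinates. -/
def whitenedSpan (W V : Matrix (Fin p) (Fin p) ℝ) (hWV : W * V = 1) (hVW : V * W = 1)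
    (B : Matrix (Fin m) (Fin p) ℝ) (C : Matrix (Fin m) (Fin k) ℝ) (K : Set (Fin m)) :
    Submodule ℝ (EuclideanSpace ℝ (Fin p)) :=
  (normSpan B C K).map ((WithLp.linearEquiv 2 ℝ (Fin p → ℝ)).trans
    (Matrix.toLin'OfInv (M := Vᵀ) (M' := Wᵀ)
      (by rw [← Matrix.transpose_mul, hWV, Matrix.transpose_one])
      (by rw [← Matrix.transpose_mul, hVW, Matrix.transpose_one]))).symm.toLinearMap

variable {B : Matrix (Fin m) (Fin p) ℝ} {C : Matrix (Fin m) (Fin k) ℝ} {h : Fin m → EReal}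

lemma mem_whitenedSpan (hWV : W * V = 1) (hVW : V * W = 1) {K : Set (Fin m)}
    {y : EuclideanSpace ℝ (Fin p)} :
    y ∈ whitenedSpan W V hWV hVW B C K ↔ Wᵀ *ᵥ y.ofLp ∈ normSpan B C K := by
  rw [whitenedSpan, Submodule.mem_map_equiv, LinearEquiv.symm_symm, LinearEquiv.trans_apply]
  exact Iff.rfl

lemma finrank_whitenedSpan (hWV : W * V = 1) (hVW : V * W = 1) (K : Set (Fin m)) :
    Module.finrank ℝ (whitenedSpan W V hWV hVW B C K) = Module.finrank ℝ (normSpan B C K) :=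
  LinearEquiv.finrank_map_eq _ _

lemma isSymm_inv (hS : S.PosDef) : (S⁻¹).IsSymm := by
  have := hS.inv.isHermitian
  rwa [Matrix.IsHermitian, Matrix.conjTranspose_eq_transpose_of_trivial] at this

lemma whiten_mem_whitenedSet (hVW : V * W = 1) {z : Fin p → ℝ} :
    whiten W z ∈ whitenedSet V B C h ↔ z ∈ ppolyE B h C := by
  rw [whitenedSet, Set.mem_ofPred_eq, mulVec_whiten hVW]

lemma isClosed_whitenedSet (h0 : ∀ j, 0 ≤ h j) : IsClosed (whitenedSet V B C h) := by
  refine (isClosed_ppolyE B (fun j => (EReal.bot_lt_zero.trans_le (h0 j)).ne') C).preimage ?_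
  exact Continuous.matrix_mulVec continuous_const (PiLp.continuous_ofLp 2 _)

lemma whitenedProj_whiten (hS : S.PosDef) (hVW : V * W = 1) (h0 : ∀ j, 0 ≤ h j)
    {x ν : Fin p → ℝ} (hν : IsProjection S B C h x ν) :
    whitenedProj W V S B C h (whiten W x) = whiten W ν := by
  rw [whitenedProj, mulVec_whiten hVW]
  have h1 : IsProjection S B C h x (Classical.epsilon fun μ => IsProjection S B C h x μ) :=
    Classical.epsilon_spec (exists_isProjection hS B C h0 x)
  rw [hν.unique hS h1.1 (h1.2 _ hν.1)]

lemma isMetricProjection_whitenedProj (hS : S.PosDef) (hWV : W * V = 1) (hVW : V * W = 1)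
    (hW : Wᵀ * W = S⁻¹) (h0 : ∀ j, 0 ≤ h j) :
    IsMetricProjection (whitenedSet V B C h) (whitenedProj W V S B C h) := by
  intro y
  obtain ⟨x, rfl⟩ : ∃ x, y = whiten W x := ⟨_, (whiten_mulVec hWV y).symm⟩
  obtain ⟨ν, hν⟩ := exists_isProjection hS B C h0 x
  rw [whitenedProj_whiten hS hVW h0 hν]
  refine ⟨(whiten_mem_whitenedSet hVW).mpr hν.1, fun z hz => ?_⟩
  obtain ⟨v, rfl⟩ : ∃ v, z = whiten W v := ⟨_, (whiten_mulVec hWV z).symm⟩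
  rw [← whiten_sub, ← whiten_sub, inner_whiten, transpose_mulVec_whiten hW]
  exact quadForm_min_variational (isSymm_inv hS) (convex_ppolyE B h C) hν.1 hν.2
    ((whiten_mem_whitenedSet hVW).mp hz)

/-- The normal cone depends only on the minimal activatable set at the point, one of finitely many
sets of rows. -/
lemma finite_normalCone_whitenedSet (hWV : W * V = 1) (hVW : V * W = 1) :
    (normalCone (whitenedSet V B C h) '' whitenedSet V B C h).Finite := by
  refine (Set.finite_range fun K : Set (Fin m) => {y : EuclideanSpace ℝ (Fin p) |
    ∃ ψ : Fin m → ℝ, 0 ≤ ψ ∧ (∀ j ∉ K, ψ j = 0) ∧ Bᵀ *ᵥ ψ = Wᵀ *ᵥ y.ofLp ∧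
      Cᵀ *ᵥ ψ = 0}).subset ?_
  rintro _ ⟨y₀, hy₀, rfl⟩
  obtain ⟨ν, rfl⟩ : ∃ x, y₀ = whiten W x := ⟨_, (whiten_mulVec hWV y₀).symm⟩
  rw [whiten_mem_whitenedSet hVW] at hy₀
  refine ⟨minActivatable C (shiftE B h ν), ?_⟩
  ext y
  constructor
  · rintro ⟨ψ, hψ0, hψK, hψB, hψC⟩ z hz
    obtain ⟨v, rfl⟩ : ∃ v, z = whiten W v := ⟨_, (whiten_mulVec hWV z).symm⟩
    rw [whiten_mem_whitenedSet hVW] at hz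
    rw [← whiten_sub, inner_whiten, ← hψB, Matrix.mulVec_transpose, ← Matrix.dotProduct_mulVec]
    obtain ⟨w, hw⟩ := hy₀
    obtain ⟨w', hw'⟩ := hz
    rw [Matrix.mulVec_transpose] at hψC
    have h1 : ψ ⬝ᵥ (B *ᵥ (v - ν)) = ψ ⬝ᵥ ((B *ᵥ v + C *ᵥ w') - (B *ᵥ ν + C *ᵥ w)) := by
      rw [dotProduct_sub, dotProduct_add, dotProduct_add, dotProduct_mulVec_eq_zero hψC,
        dotProduct_mulVec_eq_zero hψC, add_zero, add_zero, Matrix.mulVec_sub, dotProduct_sub]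
    rw [h1]
    refine Finset.sum_nonpos fun j _ => ?_
    by_cases hj : j ∈ minActivatable C (shiftE B h ν)
    · have h2 := eq_of_mem_minActivatable (mem_polyE_shiftE_iff.mpr hw) hj
      rw [coe_eq_shiftE_iff] at h2
      have h3 := hw' j
      rw [← h2, EReal.coe_le_coe_iff] at h3
      exact mul_nonpos_of_nonneg_of_nonpos (hψ0 j) (sub_nonpos.mpr h3)
    · rw [hψK j hj, zero_mul]
  · intro hy
    obtain ⟨δ₀, hδ₀⟩ := hy₀
    obtain ⟨δ, hδ, hlt⟩ := exists_lt_off_minActivatable (C := C) (b := shiftE B h ν)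
      ⟨δ₀, mem_polyE_shiftE_iff.mpr hδ₀⟩
    rw [mem_polyE_shiftE_iff] at hδ
    refine exists_ppolyE_multiplier B C h hδ _ (fun j hj => ?_) _ fun ν' hν' => ?_
    · refine lt_of_le_of_ne (hδ j) fun h1 => (hlt j hj).ne ?_
      rw [coe_eq_shiftE_iff]
      exact h1
    · rw [← inner_whiten, whiten_sub]
      exact hy _ ((whiten_mem_whitenedSet hVW).mpr hν')

/-- The limit of the rejection region, in whitened coordinates: the rejection region of the limit
problem and the points whose residual lies in one of finitely many spaces of deficient
dimension. -/
def limitRegion (α : ℝ) (W V S : Matrix (Fin p) (Fin p) ℝ) (hWV : W * V = 1) (hVW : V * W = 1)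
    (B : Matrix (Fin m) (Fin p) ℝ) (C : Matrix (Fin m) (Fin k) ℝ) (h : Fin m → EReal) :
    Set (EuclideanSpace ℝ (Fin p)) :=
  critRegion α (whitenedSet V B C h) (whitenedProj W V S B C h) ∪
    ⋃ K : Set (Fin m), {y | y - whitenedProj W V S B C h y ∈ whitenedSpan W V hWV hVW B C K ∧
      Module.finrank ℝ (whitenedSpan W V hWV hVW B C K) < Module.finrank ℝ (Submodule.span ℝ
        (normalCone (whitenedSet V B C h) (whitenedProj W V S B C h y)))}

/-- The residual sets of deficient dimension are null, and the origin belongs to the constraint set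
as `h ≥ 0`. -/
lemma stdGaussian_limitRegion_le (hS : S.PosDef) (hWV : W * V = 1) (hVW : V * W = 1)
    (hW : Wᵀ * W = S⁻¹) (h0 : ∀ j, 0 ≤ h j) {α : ℝ} (hα : 0 < α) (hα' : α < 1 / 2) :
    stdGaussian (EuclideanSpace ℝ (Fin p)) (limitRegion α W V S hWV hVW B C h) ≤
      ENNReal.ofReal α := by
  have hπ := isMetricProjection_whitenedProj (B := B) (C := C) hS hWV hVW hW h0
  have hfin := finite_normalCone_whitenedSet (B := B) (C := C) (h := h) hWV hVW
  refine (measure_union_le _ _).trans ?_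
  rw [measure_iUnion_null fun K => stdGaussian_residual_mem_eq_zero hπ hfin _, add_zero]
  refine stdGaussian_critRegion_le (isClosed_whitenedSet h0) hπ hfin ?_ hα hα'
  exact ⟨0, fun j => by simpa using h0 j⟩

variable {D : Matrix (Fin m) (Fin k) ℝ}
  {Ps : ℕ → Matrix (Fin p) (Fin k) ℝ} {P : Matrix (Fin p) (Fin k) ℝ}
  {hs : ℕ → Fin m → ℝ} {Ss : ℕ → Matrix (Fin p) (Fin p) ℝ} {κ : Fin m → ℝ} {l : Ultrafilter ℕ}
  {xs νs : ℕ → Fin p → ℝ} {x ν : Fin p → ℝ}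

/-- Limits of inscribed ellipsoids are inscribed in the limit set. -/
lemma innerBall_of_tendsto (hVW : V * W = 1) (hWV : W * V = 1) (hW : Wᵀ * W = S⁻¹)
    {Cs : ℕ → Matrix (Fin m) (Fin k) ℝ} (H : LocalLimit B Cs C hs h S κ l)
    (hS : Tendsto Ss l (𝓝 S)) (hνs : Tendsto νs l (𝓝 ν)) {t : ℝ} (ht : 0 < t)
    (hball : ∀ᶠ q in (l : Filter ℕ), ∃ c, quad (Ss q)⁻¹ (νs q - c) ≤ t ^ 2 ∧
      ∀ ν', quad (Ss q)⁻¹ (ν' - c) ≤ t ^ 2 → ν' ∈ ppoly B (hs q) (Cs q)) :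
    InnerBall (whitenedSet V B C h) (whiten W ν) t := by
  have hSi := tendsto_matrix_inv hS H.posDef
  obtain ⟨a, ha, hlow⟩ := exists_quad_lower_of_tendsto hSi H.posDef.inv
  obtain ⟨cs, hcs⟩ := hball.choice
  obtain ⟨z, hz⟩ := exists_tendsto_of_norm_le (l := l) (f := fun q => νs q - cs q)
    (R := √(t ^ 2 / a)) (by
      filter_upwards [hcs, hlow] with q h1 h2
      refine Real.le_sqrt_of_sq_le ?_
      rw [le_div_iff₀ ha]
      linarith [h2 (νs q - cs q), h1.1])
  have hc : Tendsto cs l (𝓝 (ν - z)) := by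
    have := hνs.sub hz
    simpa using this
  set c := ν - z with hcdef
  -- Strict interior points of the limit ellipsoid are eventually in the sample ellipsoids; its
  -- boundary follows by closedness.
  have hlt : ∀ v : Fin p → ℝ, quad S⁻¹ v < t ^ 2 → c + v ∈ ppolyE B h C := by
    intro v hv
    refine H.mem_of_tendsto (νs := fun q => cs q + v) (hc.add_const v) ?_
    filter_upwards [hcs, (tendsto_quad hSi (tendsto_const_nhds (x := v))).eventually_le_const hv]
      with q h1 h2
    exact h1.2 _ (by rwa [add_sub_cancel_left])
  refine ⟨whiten W c, ?_, fun y hy => ?_⟩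
  · have h1 : quad S⁻¹ (ν - c) ≤ t ^ 2 := le_of_tendsto (tendsto_quad hSi (hνs.sub hc))
      (by filter_upwards [hcs] with q hq using hq.1)
    rw [← whiten_sub]
    rw [← sq_norm_whiten hW] at h1
    exact le_of_sq_le_sq h1 ht.le
  · obtain ⟨v, rfl⟩ : ∃ x, y = whiten W x := ⟨_, (whiten_mulVec hWV y).symm⟩
    rw [mem_closedBall_iff_norm, ← whiten_sub] at hy
    rw [whiten_mem_whitenedSet hVW]
    have hcl : IsClosed (ppolyE B h C) :=
      isClosed_ppolyE B (fun j => (EReal.bot_lt_zero.trans_le (H.rhs_nonneg j)).ne') C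
    have hlim : Tendsto (fun s : ℝ => c + s • (v - c)) (𝓝[<] 1) (𝓝 (c + (1 : ℝ) • (v - c))) :=
      ((tendsto_id.mono_left nhdsWithin_le_nhds).smul_const _).const_add _
    rw [one_smul, add_sub_cancel] at hlim
    refine hcl.mem_of_tendsto hlim ?_
    filter_upwards [Ioo_mem_nhdsLT (show (0 : ℝ) < 1 by norm_num)] with s hs'
    refine hlt _ ?_
    rw [quad_smul, ← sq_norm_whiten hW]
    have h3 : ‖whiten W (v - c)‖ ^ 2 ≤ t ^ 2 := by gcongr
    have h4 : s ^ 2 < 1 := by nlinarith [hs'.1, hs'.2]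
    have h5 : 0 < t ^ 2 := by positivity
    nlinarith [sq_nonneg s, sq_nonneg ‖whiten W (v - c)‖]

/-- The set where a nonincreasing right-continuous function is at most `a` is closed. -/
lemma chiTail_le_of_tendsto {Ts : ℕ → ℝ} {T : ℝ} {l : Filter ℕ} [l.NeBot] (hT : Tendsto Ts l (𝓝 T))
    {r : ℕ} {a : ℝ} (h : ∀ᶠ q in l, chiTail r (Ts q) ≤ a) : chiTail r T ≤ a := by
  refine chiTail_le_of_forall_gt fun t' ht' => ?_
  obtain ⟨q, h1, h2⟩ := ((hT.eventually_le_const ht').and h).exists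
  exact (chiTail_antitone r h1).trans h2

/-- Limits of points at which the test rejects belong to the limit of the rejection region. -/
theorem mem_limitRegion_of_reject (hl : (l : Filter ℕ) ≤ atTop) (hWV : W * V = 1)
    (hVW : V * W = 1) (hW : Wᵀ * W = S⁻¹)
    (H : LocalLimit B (fun q => B * Ps q + D) (B * P + D) hs h S κ atTop)
    (hP : Tendsto Ps atTop (𝓝 P)) (hS : Tendsto Ss l (𝓝 S))
    (hSpd : ∀ᶠ q in (l : Filter ℕ), (Ss q).PosDef) (hx : Tendsto xs l (𝓝 x))
    (hproj : ∀ᶠ q in (l : Filter ℕ),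
      IsProjection (Ss q) B (B * Ps q + D) (toE (hs q)) (xs q) (νs q))
    {α : ℝ} (hα' : α < 1 / 2)
    (hrej : ∀ᶠ q in (l : Filter ℕ), 0 < quad (Ss q)⁻¹ (xs q - νs q) ∧
      ∀ r ≤ coneDim B (B * Ps q + D) (hs q) (νs q),
        (2 ≤ r → chiTail r (quad (Ss q)⁻¹ (xs q - νs q)) ≤ α) ∧
        (r = 1 → chiTail 1 (quad (Ss q)⁻¹ (xs q - νs q)) ≤ 2 * α ∧ ∀ t : ℝ, 0 < t →
          chiTail 1 (quad (Ss q)⁻¹ (xs q - νs q)) ≤ 2 * α * stdNormalCdf (t : EReal) ∨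
            ∃ c, quad (Ss q)⁻¹ (νs q - c) ≤ t ^ 2 ∧
              ∀ ν', quad (Ss q)⁻¹ (ν' - c) ≤ t ^ 2 →
                ν' ∈ ppoly B (hs q) (B * Ps q + D))) :
    whiten W x ∈ limitRegion α W V S hWV hVW B (B * P + D) h := by
  have h0 := H.rhs_nonneg
  obtain ⟨ν, hν⟩ := exists_isProjection H.posDef B (B * P + D) h0 x
  have hνs := tendsto_projection hl H hP hS hx hproj hν
  have hT := tendsto_quad (tendsto_matrix_inv hS H.posDef) (hx.sub hνs)
  obtain ⟨K, hK, hdim⟩ := exists_normSpan_le_coneDim hl H hP hS hSpd hx hproj hν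
  have hπ := whitenedProj_whiten (W := W) (V := V) H.posDef hVW h0 hν
  -- If the space holding the residual is smaller than the normal space, the point is in the null
  -- part of the region. Otherwise the limit degrees of freedom are eventually at most `coneDim`, as
  -- the rejection condition requires.
  by_cases hr : Module.finrank ℝ (whitenedSpan W V hWV hVW B (B * P + D) K) <
      Module.finrank ℝ (Submodule.span ℝ
        (normalCone (whitenedSet V B (B * P + D) h) (whiten W ν)))
  · refine Or.inr (Set.mem_iUnion.mpr ⟨K, ?_, ?_⟩)
    · rw [hπ, ← whiten_sub, mem_whitenedSpan, transpose_mulVec_whiten hW]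
      exact hK
    · rw [hπ]; exact hr
  left
  rw [finrank_whitenedSpan, not_lt] at hr
  have hone : ∀ᶠ q in (l : Filter ℕ), 1 ≤ coneDim B (B * Ps q + D) (hs q) (νs q) := by
    filter_upwards [hSpd, hproj, hrej] with q h1 h2 h3
    refine one_le_coneDim h1 h2 ?_
    intro h4
    have h5 := h3.1
    rw [h4, sub_self] at h5
    simp [quad] at h5
  have hTW : ‖whiten W x - whiten W ν‖ ^ 2 = quad S⁻¹ (x - ν) := by
    rw [← whiten_sub, sq_norm_whiten hW]
  -- The case `r = 1` applies to every rejection. In the limit it yields a positive statistic, so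
  -- the point is outside the constraint set.
  have h2α : chiTail 1 (quad S⁻¹ (x - ν)) ≤ 2 * α := chiTail_le_of_tendsto hT (by
    filter_upwards [hrej, hone] with q h1 h2 using ((h1.2 1 h2).2 rfl).1)
  refine ⟨fun hmem => ?_, ?_⟩
  · rw [whiten_mem_whitenedSet hVW] at hmem
    have h1 : quad S⁻¹ (x - ν) ≤ 0 := by
      have := hν.2 x hmem
      simpa [quad] using this
    exact absurd (pos_of_chiTail_lt_one le_rfl (lt_of_le_of_lt h2α (by linarith))) (not_lt.mpr h1)
  rw [hπ, hTW]
  refine ⟨fun h2 => chiTail_le_of_tendsto hT ?_, fun h1 => ⟨h2α, fun t ht => ?_⟩⟩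
  · filter_upwards [hrej, hdim] with q h3 h4 using (h3.2 _ (hr.trans h4)).1 h2
  · have hor : ∀ᶠ q in (l : Filter ℕ),
        chiTail 1 (quad (Ss q)⁻¹ (xs q - νs q)) ≤ 2 * α * stdNormalCdf (t : EReal) ∨
        ∃ c, quad (Ss q)⁻¹ (νs q - c) ≤ t ^ 2 ∧ ∀ ν', quad (Ss q)⁻¹ (ν' - c) ≤ t ^ 2 →
          ν' ∈ ppoly B (hs q) (B * Ps q + D) := by
      filter_upwards [hrej, hone] with q h3 h4 using ((h3.2 1 h4).2 rfl).2 t ht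
    -- Along an ultrafilter one of the alternatives holds eventually, and each is closed under
    -- limits.
    rcases Ultrafilter.eventually_or.mp hor with h3 | h3
    · exact Or.inl (chiTail_le_of_tendsto hT h3)
    · exact Or.inr (innerBall_of_tendsto hVW hWV hW (H.mono hl) hS hνs ht h3)

end LimitRegion

/-! ### Local coordinates -/

section Scale

variable {m p k : ℕ} {B : Matrix (Fin m) (Fin p) ℝ} {C : Matrix (Fin m) (Fin k) ℝ}
  {S : Matrix (Fin p) (Fin p) ℝ} {d h : Fin m → ℝ} {s : ℝ} {μ₀ x μ : Fin p → ℝ} {δ₀ : Fin k → ℝ}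

/-- Rescale `δ` around `δ₀` together with `μ` around `μ₀`. -/
lemma smul_sub_mem_ppoly_iff (hs : 0 < s) (hh : h = s • (d - (B *ᵥ μ₀ + C *ᵥ δ₀))) :
    s • (μ - μ₀) ∈ ppoly B h C ↔ μ ∈ ppoly B d C := by
  have key : ∀ δ, B *ᵥ (s • (μ - μ₀)) + C *ᵥ (s • (δ - δ₀)) ≤ h ↔ B *ᵥ μ + C *ᵥ δ ≤ d := by
    intro δ
    have e : B *ᵥ (s • (μ - μ₀)) + C *ᵥ (s • (δ - δ₀)) =
        s • ((B *ᵥ μ + C *ᵥ δ) - (B *ᵥ μ₀ + C *ᵥ δ₀)) := by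
      rw [Matrix.mulVec_smul, Matrix.mulVec_smul, Matrix.mulVec_sub, Matrix.mulVec_sub, ← smul_add]
      congr 1; abel
    rw [e, hh, smul_le_smul_iff_of_pos_left hs, sub_le_sub_iff_right]
  constructor
  · rintro ⟨w, hw⟩
    refine ⟨δ₀ + s⁻¹ • w, (key _).mp ?_⟩
    rwa [add_sub_cancel_left, smul_smul, mul_inv_cancel₀ hs.ne', one_smul]
  · rintro ⟨δ, hδ⟩
    exact ⟨_, (key δ).mpr hδ⟩

lemma exists_eq_smul_sub (hs : 0 < s) (μ₀ ν : Fin p → ℝ) : ∃ μ, ν = s • (μ - μ₀) :=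
  ⟨μ₀ + s⁻¹ • ν, by rw [add_sub_cancel_left, smul_smul, mul_inv_cancel₀ hs.ne', one_smul]⟩

lemma quad_smul_sub_sub (S : Matrix (Fin p) (Fin p) ℝ) (s : ℝ) (a b c : Fin p → ℝ) :
    quad S (s • (a - c) - s • (b - c)) = s ^ 2 * quad S (a - b) := by
  rw [← smul_sub, sub_sub_sub_cancel_right, quad_smul]

lemma IsProjection.smul_sub (hs : 0 < s) (hh : h = s • (d - (B *ᵥ μ₀ + C *ᵥ δ₀)))
    (hμ : IsProjection S B C (toE d) x μ) :
    IsProjection S B C (toE h) (s • (x - μ₀)) (s • (μ - μ₀)) := by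
  rw [IsProjection, ppolyE_toE] at hμ ⊢
  refine ⟨(smul_sub_mem_ppoly_iff hs hh).mpr hμ.1, fun ν' hν' => ?_⟩
  obtain ⟨μ', rfl⟩ := exists_eq_smul_sub hs μ₀ ν'
  rw [quad_smul_sub_sub, quad_smul_sub_sub]
  exact mul_le_mul_of_nonneg_left (hμ.2 _ ((smul_sub_mem_ppoly_iff hs hh).mp hν')) (sq_nonneg s)

/-- The cone is unchanged because its elements annihilate `C`, so the shift by `C δ₀` is invisible.
-/
lemma coneDim_smul_sub (hs : 0 < s) (hh : h = s • (d - (B *ᵥ μ₀ + C *ᵥ δ₀))) :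
    coneDim B C h (s • (μ - μ₀)) = coneDim B C d μ := by
  rw [coneDim, coneDim]
  congr 2
  ext η
  simp only [Set.mem_ofPred_eq]
  refine and_congr_right fun _ => and_congr_right fun hC => ?_
  have e : B *ᵥ (s • (μ - μ₀)) - h = s • ((B *ᵥ μ - d) + C *ᵥ δ₀) := by
    rw [hh, Matrix.mulVec_smul, Matrix.mulVec_sub, ← _root_.smul_sub]
    congr 1; abel
  rw [e, dotProduct_smul, dotProduct_add, dotProduct_mulVec_eq_zero hC, add_zero, smul_eq_mul,
    mul_eq_zero, or_iff_right hs.ne']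

end Scale

/-! ### The loading matrix and the asymptotic variance -/

section Loading

variable {dμ dδ : ℕ}

lemma transpose_loading_mulVec (δ : Fin dδ → ℝ) (μ : Fin dμ → ℝ) (P : Matrix (Fin dμ) (Fin dδ) ℝ) :
    (loading δ : Matrix (VecIdx dμ dδ) (Fin dμ) ℝ)ᵀ *ᵥ (stackVec μ P).ofLp = μ + P *ᵥ δ := by
  ext i
  simp only [Matrix.mulVec, dotProduct, Fintype.sum_sum_type, loading, Matrix.transpose_apply,
    Matrix.fromRows_apply_inl, Matrix.fromRows_apply_inr, stackVec, Sum.elim_inl, Sum.elim_inr,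
    Matrix.of_apply, Fintype.sum_prod_type, Pi.add_apply, Matrix.one_apply]
  congr 1
  · simp
  · refine Finset.sum_congr rfl fun j _ => ?_
    simp [mul_comm]

lemma stackVec_smul (t : ℝ) (μ : Fin dμ → ℝ) (P : Matrix (Fin dμ) (Fin dδ) ℝ) :
    t • stackVec μ P = stackVec (t • μ) (t • P) := by
  ext i
  rcases i with i | i <;> simp [stackVec]

lemma continuous_loading : Continuous fun δ : Fin dδ → ℝ =>
    (loading δ : Matrix (VecIdx dμ dδ) (Fin dμ) ℝ) := by
  refine continuous_pi fun q => continuous_pi fun i => ?_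
  rcases q with q | q
  · exact continuous_const
  · exact (continuous_apply q.1).mul continuous_const

lemma tendsto_transpose_mul_mul {β ι κ : Type*} [Fintype ι] {l : Filter β}
    {As : β → Matrix ι κ ℝ} {A : Matrix ι κ ℝ} {Ωs : β → Matrix ι ι ℝ} {Ω : Matrix ι ι ℝ}
    (hA : Tendsto As l (𝓝 A)) (hΩ : Tendsto Ωs l (𝓝 Ω)) :
    Tendsto (fun q => (As q)ᵀ * Ωs q * As q) l (𝓝 (Aᵀ * Ω * A)) := by
  have hc : Continuous fun z : Matrix ι κ ℝ × Matrix ι ι ℝ => z.1ᵀ * z.2 * z.1 :=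
    (continuous_fst.matrix_transpose.matrix_mul continuous_snd).matrix_mul continuous_fst
  have h := hc.continuousAt.tendsto.comp (hA.prodMk_nhds hΩ)
  exact h

lemma tendsto_sandwich {β : Type*} {l : Filter β}
    {Ωs : β → Matrix (VecIdx dμ dδ) (VecIdx dμ dδ) ℝ} {Ω : Matrix (VecIdx dμ dδ) (VecIdx dμ dδ) ℝ}
    (hΩ : Tendsto Ωs l (𝓝 Ω)) {δs : β → Fin dδ → ℝ} {δ : Fin dδ → ℝ} (hδ : Tendsto δs l (𝓝 δ)) :
    Tendsto (fun q => sandwich (Ωs q) (δs q)) l (𝓝 (sandwich Ω δ)) := by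
  have h1 : Tendsto (fun q => (loading (δs q) : Matrix (VecIdx dμ dδ) (Fin dμ) ℝ)) l
      (𝓝 (loading δ : Matrix (VecIdx dμ dδ) (Fin dμ) ℝ)) :=
    (continuous_loading (dμ := dμ)).continuousAt.tendsto.comp hδ
  have h2 := tendsto_transpose_mul_mul h1 hΩ
  simp only [sandwich]
  exact h2

lemma isSymm_sandwich {Ω : Matrix (VecIdx dμ dδ) (VecIdx dμ dδ) ℝ} (hΩ : Ω.IsSymm)
    (δ : Fin dδ → ℝ) : (sandwich Ω δ).IsSymm := by
  rw [Matrix.IsSymm, sandwich, Matrix.transpose_mul, Matrix.transpose_mul,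
    Matrix.transpose_transpose, hΩ.eq, Matrix.mul_assoc]

end Loading

/-! ### Local coordinates of the model -/

namespace Model

variable {dC dμ dδ : ℕ} (M : Model dC dμ dδ)

/-- The scaled slackness of the constraints at `δ*_F`. -/
def hF (n : ℕ) (F : Law dμ dδ) : Fin dC → ℝ :=
  √(n : ℝ) • (M.bF n F - M.CF n F *ᵥ M.deltaStar n F)

/-- The origin of the local coordinates. -/
def origin (n : ℕ) (F : Law dμ dδ) (e : Est dμ dδ) : Fin dμ → ℝ :=
  M.muF n F - (e.Pi - M.PiF n F) *ᵥ M.deltaStar n F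

/-- The scaled estimation error. -/
def scaledError (n : ℕ) (F : Law dμ dδ) (e : Est dμ dδ) : EuclideanSpace ℝ (VecIdx dμ dδ) :=
  √(n : ℝ) • stackVec (e.mu - M.muF n F) (e.Pi - M.PiF n F)

variable {n : ℕ} {F : Law dμ dδ} {e : Est dμ dδ}

/-- The origin is shifted so as to absorb the estimation error of `Π` at `δ*`: the estimated
constraints have the same slack at `(origin, δ*)` as the true ones at `(μ_F, δ*)`, which is
nonrandom. -/
lemma hF_eq : M.hF n F = √(n : ℝ) • (M.d n - (M.B *ᵥ M.origin n F e +
    M.Cbar e *ᵥ M.deltaStar n F)) := by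
  rw [hF]
  congr 1
  rw [bF, CF, Cbar, CMat, CMat, origin, Matrix.mulVec_sub, Matrix.mulVec_mulVec, Matrix.mul_sub,
    Matrix.sub_mulVec, Matrix.add_mulVec, Matrix.add_mulVec]
  abel

/-- The rescaled observation is linear in the scaled error, which is why its variance is `sandwich`.
-/
lemma smul_mu_sub_origin : √(n : ℝ) • (e.mu - M.origin n F e) =
    (loading (M.deltaStar n F) : Matrix (VecIdx dμ dδ) (Fin dμ) ℝ)ᵀ *ᵥ
      (M.scaledError n F e).ofLp := by
  rw [scaledError, stackVec_smul, transpose_loading_mulVec, Matrix.smul_mulVec, ← smul_add, origin]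
  congr 1; abel

lemma deltaStar_mem (hF : F ∈ M.null n) : M.deltaStar n F ∈ poly (M.CF n F) (M.bF n F) :=
  (minNormPoint_spec hF.2).1

lemma hF_nonneg (hF : F ∈ M.null n) : 0 ≤ M.hF n F :=
  smul_nonneg (Real.sqrt_nonneg _) (sub_nonneg.mpr (M.deltaStar_mem hF))

lemma origin_mem_ppoly (hF : F ∈ M.null n) : M.origin n F e ∈ ppoly M.B (M.d n) (M.Cbar e) := by
  refine ⟨M.deltaStar n F, ?_⟩
  have h1 := M.deltaStar_mem hF
  have h2 : M.B *ᵥ M.origin n F e + M.Cbar e *ᵥ M.deltaStar n F =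
      M.d n - (M.bF n F - M.CF n F *ᵥ M.deltaStar n F) := by
    rw [bF, CF, Cbar, CMat, CMat, origin, Matrix.mulVec_sub, Matrix.mulVec_mulVec, Matrix.mul_sub,
      Matrix.sub_mulVec, Matrix.add_mulVec, Matrix.add_mulVec]
    abel
  rw [h2]
  exact sub_le_self _ (sub_nonneg.mpr h1)

/-- The choice in `muTilde` is a genuine minimizer because the form is coercive and the constraint
set is closed and nonempty. -/
lemma muTilde_spec (hn : 1 ≤ n) (hne : (ppoly M.B (M.d n) (M.Cbar e)).Nonempty) {c : ℝ}
    (hc : 0 < c) (hq : ∀ z, c * ‖z‖ ^ 2 ≤ quad e.Upsilon z) :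
    M.muTilde n e ∈ ppoly M.B (M.d n) (M.Cbar e) ∧ ∀ μ' ∈ ppoly M.B (M.d n) (M.Cbar e),
      quad e.Upsilon (e.mu - M.muTilde n e) ≤ quad e.Upsilon (e.mu - μ') := by
  have hn' : (0 : ℝ) < n := by exact_mod_cast hn
  obtain ⟨μ, h1, h2⟩ := exists_quadForm_min e.Upsilon hc hq e.mu
    (isClosed_ppoly M.B (M.d n) (M.Cbar e)) hne
  have h3 : M.muTilde n e ∈ ppoly M.B (M.d n) (M.Cbar e) ∧
      ∀ μ' ∈ ppoly M.B (M.d n) (M.Cbar e),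
        (n : ℝ) * quad e.Upsilon (e.mu - M.muTilde n e) ≤ (n : ℝ) * quad e.Upsilon (e.mu - μ') :=
    Classical.epsilon_spec (p := fun μ => μ ∈ ppoly M.B (M.d n) (M.Cbar e) ∧
      ∀ μ' ∈ ppoly M.B (M.d n) (M.Cbar e),
        (n : ℝ) * quad e.Upsilon (e.mu - μ) ≤ (n : ℝ) * quad e.Upsilon (e.mu - μ'))
      ⟨μ, h1, fun μ' hμ' => mul_le_mul_of_nonneg_left (h2 μ' hμ') hn'.le⟩
  exact ⟨h3.1, fun μ' hμ' => le_of_mul_le_mul_left (h3.2 μ' hμ') hn'⟩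

/-! ### Consistency of the preliminary estimators -/

section Consistency

variable {ns : ℕ → ℕ} {Fs : ℕ → Law dμ dδ} {es : ℕ → Est dμ dδ} {μ : Fin dμ → ℝ}
  {d : Fin dC → ℝ} {P : Matrix (Fin dμ) (Fin dδ) ℝ} {z : EuclideanSpace ℝ (VecIdx dμ dδ)}
  {Ω : Matrix (VecIdx dμ dδ) (VecIdx dμ dδ) ℝ} {Υ : Matrix (Fin dμ) (Fin dμ) ℝ}

lemma tendsto_CMat {β : Type*} {l : Filter β} {Ps : β → Matrix (Fin dμ) (Fin dδ) ℝ}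
    (hP : Tendsto Ps l (𝓝 P)) : Tendsto (fun q => M.CMat (Ps q)) l (𝓝 (M.CMat P)) := by
  have hc : Continuous fun Q : Matrix (Fin dμ) (Fin dδ) ℝ => M.B * Q + M.D := by fun_prop
  exact (hc.tendsto _).comp hP

lemma tendsto_bF (hμ : Tendsto (fun q => M.muF (ns q) (Fs q)) atTop (𝓝 μ))
    (hd : Tendsto (fun q => M.d (ns q)) atTop (𝓝 d)) :
    Tendsto (fun q => M.bF (ns q) (Fs q)) atTop (𝓝 (d - M.B *ᵥ μ)) :=
  hd.sub (tendsto_mulVec tendsto_const_nhds hμ)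

lemma tendsto_deltaStar (hμ : Tendsto (fun q => M.muF (ns q) (Fs q)) atTop (𝓝 μ))
    (hP : Tendsto (fun q => M.PiF (ns q) (Fs q)) atTop (𝓝 P))
    (hd : Tendsto (fun q => M.d (ns q)) atTop (𝓝 d)) (hnull : ∀ q, Fs q ∈ M.null (ns q))
    (hne : (poly (M.CMat P) (d - M.B *ᵥ μ)).Nonempty)
    (hr : ∀ᶠ q in atTop, rowRank (M.CF (ns q) (Fs q))
      (minActivatable (M.CMat P) (toE (d - M.B *ᵥ μ))) =
      rowRank (M.CMat P) (minActivatable (M.CMat P) (toE (d - M.B *ᵥ μ)))) :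
    Tendsto (fun q => M.deltaStar (ns q) (Fs q)) atTop
      (𝓝 (minNormPoint (poly (M.CMat P) (d - M.B *ᵥ μ)))) :=
  tendsto_minNormPoint (M.tendsto_CMat hP) (M.tendsto_bF hμ hd)
    (Eventually.of_forall fun q => (hnull q).2) hne hr

lemma tendsto_zero_of_smul {β E : Type*} [NormedAddCommGroup E] [NormedSpace ℝ E] {l : Filter β}
    {s : β → ℝ} (hs : Tendsto s l atTop) {f : β → E} {a : E}
    (hf : Tendsto (fun q => s q • f q) l (𝓝 a)) : Tendsto f l (𝓝 0) := by
  have h1 := hs.inv_tendsto_atTop.smul hf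
  rw [zero_smul] at h1
  refine h1.congr' ?_
  filter_upwards [hs.eventually_gt_atTop 0] with q hq
  simp only [Pi.inv_apply]
  rw [smul_smul, inv_mul_cancel₀ hq.ne', one_smul]

lemma tendsto_of_scaledError (hns : Tendsto ns atTop atTop)
    (hz : Tendsto (fun q => M.scaledError (ns q) (Fs q) (es q)) atTop (𝓝 z)) :
    Tendsto (fun q => (es q).mu - M.muF (ns q) (Fs q)) atTop (𝓝 0) ∧
    Tendsto (fun q => (es q).Pi - M.PiF (ns q) (Fs q)) atTop (𝓝 0) := by
  have hs : Tendsto (fun q => √((ns q : ℕ) : ℝ)) atTop atTop :=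
    Real.tendsto_sqrt_atTop.comp (tendsto_natCast_atTop_atTop.comp hns)
  have h1 := tendsto_zero_of_smul hs hz
  have h2 : ∀ i, Tendsto (fun q => (stackVec ((es q).mu - M.muF (ns q) (Fs q))
      ((es q).Pi - M.PiF (ns q) (Fs q))).ofLp i) atTop (𝓝 0) := fun i =>
    tendsto_pi_nhds.mp (((PiLp.continuous_ofLp 2 _).tendsto _).comp h1) i
  exact ⟨tendsto_pi_nhds.mpr fun i => h2 (Sum.inl i),
    tendsto_pi_nhds.mpr fun i => tendsto_pi_nhds.mpr fun j => h2 (Sum.inr (j, i))⟩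

/-- The origin is feasible and close to the unrestricted estimator, so the restricted one is close
too. Continuity of the minimum norm point under stable rank then gives the limit of `deltaTilde`. -/
lemma tendsto_sigmaTilde (hns : Tendsto ns atTop atTop) (hn1 : ∀ q, 1 ≤ ns q)
    (hμ : Tendsto (fun q => M.muF (ns q) (Fs q)) atTop (𝓝 μ))
    (hP : Tendsto (fun q => M.PiF (ns q) (Fs q)) atTop (𝓝 P))
    (hd : Tendsto (fun q => M.d (ns q)) atTop (𝓝 d)) (hnull : ∀ q, Fs q ∈ M.null (ns q))
    (hne : (poly (M.CMat P) (d - M.B *ᵥ μ)).Nonempty)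
    (hδ : Tendsto (fun q => M.deltaStar (ns q) (Fs q)) atTop
      (𝓝 (minNormPoint (poly (M.CMat P) (d - M.B *ᵥ μ)))))
    (hz : Tendsto (fun q => M.scaledError (ns q) (Fs q) (es q)) atTop (𝓝 z))
    (hΩ : Tendsto (fun q => (es q).Omega) atTop (𝓝 Ω))
    (hΥ : Tendsto (fun q => (es q).Upsilon) atTop (𝓝 Υ)) (hΥpd : Υ.PosDef)
    (hr : ∀ᶠ q in atTop, rowRank (M.Cbar (es q))
      (minActivatable (M.CMat P) (toE (d - M.B *ᵥ μ))) =
      rowRank (M.CMat P) (minActivatable (M.CMat P) (toE (d - M.B *ᵥ μ)))) :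
    Tendsto (fun q => M.sigmaTilde (ns q) (es q)) atTop
      (𝓝 (sandwich Ω (minNormPoint (poly (M.CMat P) (d - M.B *ᵥ μ))))) := by
  obtain ⟨hz1, hz2⟩ := M.tendsto_of_scaledError hns hz
  have hPi : Tendsto (fun q => (es q).Pi) atTop (𝓝 P) := by
    have := hz2.add hP
    simpa using this
  have horig : Tendsto (fun q => (es q).mu - M.origin (ns q) (Fs q) (es q)) atTop (𝓝 0) := by
    have h1 := hz1.add (tendsto_mulVec hz2 hδ)
    rw [Matrix.zero_mulVec, add_zero] at h1
    refine h1.congr fun q => ?_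
    rw [origin]; abel
  obtain ⟨c, hc, hlow⟩ := exists_quad_lower_of_tendsto hΥ hΥpd
  have hspec : ∀ᶠ q in atTop, M.muTilde (ns q) (es q) ∈ ppoly M.B (M.d (ns q)) (M.Cbar (es q)) ∧
      c * ‖(es q).mu - M.muTilde (ns q) (es q)‖ ^ 2 ≤
        quad (es q).Upsilon ((es q).mu - M.origin (ns q) (Fs q) (es q)) := by
    filter_upwards [hlow] with q hq
    have h1 := M.origin_mem_ppoly (e := es q) (hnull q)
    have h2 := M.muTilde_spec (hn1 q) ⟨_, h1⟩ hc hq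
    exact ⟨h2.1, (hq _).trans (h2.2 _ h1)⟩
  have hdiff : Tendsto (fun q => (es q).mu - M.muTilde (ns q) (es q)) atTop (𝓝 0) := by
    have h1 := tendsto_quad hΥ horig
    have h0 : quad Υ (0 : Fin dμ → ℝ) = 0 := by simp [quad]
    rw [h0] at h1
    have h2 : Tendsto (fun q => √(c⁻¹ * quad (es q).Upsilon
        ((es q).mu - M.origin (ns q) (Fs q) (es q)))) atTop (𝓝 0) := by
      have := (h1.const_mul c⁻¹).sqrt
      simpa using this
    refine squeeze_zero_norm' ?_ h2
    filter_upwards [hspec] with q hq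
    refine Real.le_sqrt_of_sq_le ?_
    rw [inv_mul_eq_div, le_div_iff₀ hc, mul_comm]
    exact hq.2
  have hmu : Tendsto (fun q => M.muTilde (ns q) (es q)) atTop (𝓝 μ) := by
    have := (hz1.add hμ).sub hdiff
    simpa using this
  refine tendsto_sandwich hΩ ?_
  refine tendsto_minNormPoint (M.tendsto_CMat hPi)
    (hd.sub (tendsto_mulVec tendsto_const_nhds hmu)) ?_ hne hr
  filter_upwards [hspec] with q hq
  obtain ⟨δ, hδ'⟩ := hq.1
  refine ⟨δ, ?_⟩
  change M.Cbar (es q) *ᵥ δ ≤ M.d (ns q) - M.B *ᵥ M.muTilde (ns q) (es q)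
  rw [le_sub_iff_add_le']
  exact hδ'

end Consistency

end Model

/-! ### Limits of rejections -/

namespace Model

variable {dC dμ dδ : ℕ} (M : Model dC dμ dδ)

/-- Rejections along a sequence of sample sizes and values of the estimators, in the limit. -/
theorem mem_limitRegion {ns : ℕ → ℕ} {Fs : ℕ → Law dμ dδ} {es : ℕ → Est dμ dδ}
    {μ : Fin dμ → ℝ} {d : Fin dC → ℝ} {P : Matrix (Fin dμ) (Fin dδ) ℝ}
    {z : EuclideanSpace ℝ (VecIdx dμ dδ)} {Ω : Matrix (VecIdx dμ dδ) (VecIdx dμ dδ) ℝ}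
    {Υ S W V : Matrix (Fin dμ) (Fin dμ) ℝ} {h : Fin dC → EReal} {κ : Fin dC → ℝ}
    {δ : Fin dδ → ℝ} (hδ' : δ = minNormPoint (poly (M.CMat P) (d - M.B *ᵥ μ)))
    (hns : Tendsto ns atTop atTop) (hn1 : ∀ q, 1 ≤ ns q)
    (hμ : Tendsto (fun q => M.muF (ns q) (Fs q)) atTop (𝓝 μ))
    (hP : Tendsto (fun q => M.PiF (ns q) (Fs q)) atTop (𝓝 P))
    (hd : Tendsto (fun q => M.d (ns q)) atTop (𝓝 d)) (hnull : ∀ q, Fs q ∈ M.null (ns q))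
    (hne : (poly (M.CMat P) (d - M.B *ᵥ μ)).Nonempty)
    (hδ : Tendsto (fun q => M.deltaStar (ns q) (Fs q)) atTop (𝓝 δ))
    (hz : Tendsto (fun q => M.scaledError (ns q) (Fs q) (es q)) atTop (𝓝 z))
    (hΩ : Tendsto (fun q => (es q).Omega) atTop (𝓝 Ω)) (hsymm : ∀ q, (es q).Omega.IsSymm)
    (hΥ : Tendsto (fun q => (es q).Upsilon) atTop (𝓝 Υ)) (hΥpd : Υ.PosDef)
    (hr : ∀ᶠ q in atTop, rowRank (M.Cbar (es q))
      (minActivatable (M.CMat P) (toE (d - M.B *ᵥ μ))) =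
      rowRank (M.CMat P) (minActivatable (M.CMat P) (toE (d - M.B *ᵥ μ))))
    (hS : S = sandwich Ω δ) (hSpd : S.PosDef) (hWV : W * V = 1) (hVW : V * W = 1)
    (hW : Wᵀ * W = S⁻¹)
    (hh : ∀ j, Tendsto (fun q => ((M.hF (ns q) (Fs q) j : ℝ) : EReal)) atTop (𝓝 (h j)))
    (hκ0 : 0 ≤ κ) (hκB : M.Bᵀ *ᵥ κ = 0) (hκD : M.Dᵀ *ᵥ κ = 0)
    (hκd : ∀ n, 1 ≤ n → κ ⬝ᵥ M.d n = 0)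
    (hrank : ∀ (x ν : Fin dμ → ℝ) (ψ : Fin dC → ℝ), IsProjection S M.B (M.CMat P) h x ν →
      0 ≤ ψ → (∀ j ∉ minActivatable (M.CMat P) (shiftE M.B h ν), ψ j = 0) →
      M.Bᵀ *ᵥ ψ = S⁻¹ *ᵥ (x - ν) → (M.CMat P)ᵀ *ᵥ ψ = 0 →
      ∀ᶠ q in atTop, rowRank (M.Cbar (es q)) {j | 0 < ψ j + κ j} =
        rowRank (M.CMat P) {j | 0 < ψ j + κ j})
    {α : ℝ} (hα : 0 < α) (hα' : α < 1 / 2) {muHat : ℕ → Est dμ dδ → Fin dμ → ℝ}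
    {deltaHat : ℕ → Est dμ dδ → Fin dδ → ℝ} {betaHat : ℕ → Est dμ dδ → ℝ}
    (hsol : ∀ n, 1 ≤ n → ∀ e, (M.sigmaTilde n e).PosDef →
      M.IsSolution n e (muHat n e) (deltaHat n e))
    (hbeta : ∀ n, 1 ≤ n → ∀ e, (M.sigmaTilde n e).PosDef →
      M.IsRefinedLevel n α e (muHat n e) (deltaHat n e) (betaHat n e))
    (hrej : ∀ q, cv (M.sHat (ns q) (es q) (muHat (ns q) (es q)) (deltaHat (ns q) (es q)))
      (betaHat (ns q) (es q)) < M.T (ns q) (es q)) :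
    whiten W ((loading δ : Matrix (VecIdx dμ dδ) (Fin dμ) ℝ)ᵀ *ᵥ z.ofLp) ∈
      limitRegion α W V S hWV hVW M.B (M.CMat P) h := by
  subst hδ'
  have hSig : Tendsto (fun q => M.sigmaTilde (ns q) (es q)) atTop (𝓝 S) := by
    rw [hS]
    exact M.tendsto_sigmaTilde hns hn1 hμ hP hd hnull hne hδ hz hΩ hΥ hΥpd hr
  have hpd : ∀ᶠ q in atTop, (M.sigmaTilde (ns q) (es q)).PosDef :=
    eventually_posDef hSig hSpd (Eventually.of_forall fun q => isSymm_sandwich (hsymm q) _)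
  have hPi : Tendsto (fun q => (es q).Pi) atTop (𝓝 P) := by
    have := (M.tendsto_of_scaledError hns hz).2.add hP
    simpa using this
  have hx : Tendsto (fun q => √((ns q : ℕ) : ℝ) •
      ((es q).mu - M.origin (ns q) (Fs q) (es q))) atTop
      (𝓝 ((loading (minNormPoint (poly (M.CMat P) (d - M.B *ᵥ μ))) :
        Matrix (VecIdx dμ dδ) (Fin dμ) ℝ)ᵀ *ᵥ z.ofLp)) := by
    have h1 := tendsto_mulVec (tendsto_transpose
      ((continuous_loading (dμ := dμ)).continuousAt.tendsto.comp hδ))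
      (((PiLp.continuous_ofLp 2 _).tendsto _).comp hz)
    refine h1.congr fun q => ?_
    rw [M.smul_mu_sub_origin]
    rfl
  have hκC : ∀ Q : Matrix (Fin dμ) (Fin dδ) ℝ, (M.B * Q + M.D)ᵀ *ᵥ κ = 0 := by
    intro Q
    rw [transpose_mul_add_mulVec, hκB, hκD, Matrix.mulVec_zero, add_zero]
  have H : LocalLimit M.B (fun q => M.B * (es q).Pi + M.D) (M.B * P + M.D)
      (fun q => M.hF (ns q) (Fs q)) h S κ atTop :=
    { tendsto_mat := M.tendsto_CMat hPi
      nonneg := fun q => M.hF_nonneg (hnull q)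
      tendsto_rhs := hh
      posDef := hSpd
      kappa_nonneg := hκ0
      kappa_left := hκB
      kappa_mat := fun q => hκC _
      kappa_rhs := fun q => by
        have h1 := hκB
        have h2 := hκC (M.PiF (ns q) (Fs q))
        rw [Matrix.mulVec_transpose] at h1 h2
        rw [hF, dotProduct_smul, bF, CF, CMat, dotProduct_sub, dotProduct_sub,
          dotProduct_mulVec_eq_zero h1, dotProduct_mulVec_eq_zero h2, hκd _ (hn1 q), sub_zero,
          sub_zero, smul_zero]
      rank := hrank }
  have hl : ((Ultrafilter.of atTop : Ultrafilter ℕ) : Filter ℕ) ≤ atTop := Ultrafilter.of_le _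
  have hsn : ∀ q, 0 < √((ns q : ℕ) : ℝ) := fun q =>
    Real.sqrt_pos.mpr (by exact_mod_cast hn1 q)
  have hsq : ∀ q, √((ns q : ℕ) : ℝ) ^ 2 = ns q := fun q => Real.sq_sqrt (Nat.cast_nonneg _)
  refine mem_limitRegion_of_reject hl hWV hVW hW H hPi (hSig.mono_left hl) (hl hpd)
    (hx.mono_left hl) (νs := fun q => √((ns q : ℕ) : ℝ) •
      (muHat (ns q) (es q) - M.origin (ns q) (Fs q) (es q))) (hl ?_) hα' (hl ?_)
  · filter_upwards [hpd] with q hq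
    exact ((hsol _ (hn1 q) _ hq).isProjection M (hn1 q)).smul_sub (hsn q) M.hF_eq
  · filter_upwards [hpd] with q hq
    have hso := hsol _ (hn1 q) _ hq
    have h1 := M.reject_spec (hn1 q) hq hso hα hα' (hbeta _ (hn1 q) _ hq) (hrej q)
    have hT := hso.T_eq M
    have hdim := coneDim_smul_sub (B := M.B) (C := M.Cbar (es q))
      (μ := muHat (ns q) (es q)) (hsn q) (M.hF_eq (F := Fs q) (e := es q))
    change coneDim M.B (M.B * (es q).Pi + M.D) _ _ = _ at hdim
    rw [quad_smul_sub_sub, hsq, ← hT, hdim]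
    refine ⟨h1.1, fun r hr => ?_⟩
    obtain ⟨h2, h3⟩ := h1.2 r hr
    refine ⟨h2, fun hr1 => ⟨(h3 hr1).1, fun t ht => ?_⟩⟩
    refine ((h3 hr1).2 t ht).imp_right ?_
    rintro ⟨c, hc, hball⟩
    refine ⟨√((ns q : ℕ) : ℝ) • (c - M.origin (ns q) (Fs q) (es q)), ?_, fun ν' hν' => ?_⟩
    · rwa [quad_smul_sub_sub, hsq]
    · obtain ⟨μ', rfl⟩ := exists_eq_smul_sub (hsn q) (M.origin (ns q) (Fs q) (es q)) ν'
      rw [quad_smul_sub_sub, hsq] at hν'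
      exact (smul_sub_mem_ppoly_iff (hsn q) M.hF_eq).mpr (hball _ hν')

end Model

/-! ### Probability -/

section Probability

open scoped ENNReal RealInnerProductSpace

/-- A portmanteau bound: events whose probabilities are at least `a` force the limit law to give
at least `a` to every set that contains the limits of values attained on the events. -/
lemma le_measure_of_tendstoInDistribution {Θ E : Type*} [MeasurableSpace Θ]
    [PseudoMetricSpace E] [MeasurableSpace E] [BorelSpace E]
    {μs : ℕ → Measure Θ} [∀ q, IsProbabilityMeasure (μs q)] {γ : Measure E}
    [IsProbabilityMeasure γ] {Zs : ℕ → Θ → E}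
    (hZ : TendstoInDistribution Zs atTop (id : E → E) μs γ) {A : ℕ → Set Θ}
    {G : ℕ → ℕ → Set Θ} (hG : ∀ q, Antitone fun k => G k q)
    (hG0 : ∀ k, Tendsto (fun q => μs q (G k q)ᶜ) atTop (𝓝 0)) {a : ℝ≥0∞}
    (ha : ∀ q, a ≤ μs q (A q)) {R : Set E}
    (hR : ∀ z, (∀ k : ℕ, ∃ q ≥ k, ∃ e ∈ A q, e ∈ G k q ∧ dist (Zs q e) z < 1 / (k + 1)) → z ∈ R) :
    a ≤ γ R := by
  -- Closed decreasing sets of values attained late on the events; each has limit probability at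
  -- least `a`, hence so has the intersection.
  set C : ℕ → Set E := fun k => closure (⋃ q ≥ k, Zs q '' (A q ∩ G k q)) with hC
  have hanti : Antitone C := by
    intro k k' hk
    refine closure_mono (Set.iUnion₂_subset fun q hq => ?_)
    refine Set.subset_iUnion₂_of_subset q (hk.trans hq) (Set.image_mono ?_)
    exact Set.inter_subset_inter_right _ (hG q hk)
  have hone : ∀ k, a ≤ γ (C k) := by
    intro k
    have hport : limsup (fun q => μs q (Zs q ⁻¹' C k)) atTop ≤ γ (C k) := by
      have h1 := ProbabilityMeasure.limsup_measure_closed_le_of_tendsto hZ.tendsto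
        (F := C k) isClosed_closure
      simp only [ProbabilityMeasure.coe_mk, Measure.map_id] at h1
      refine le_trans (le_of_eq ?_) h1
      congr 1
      ext q
      rw [Measure.map_apply_of_aemeasurable (hZ.forall_aemeasurable q)
        isClosed_closure.measurableSet]
    -- Otherwise the probability of `A q` is eventually less than `b + (a - b)`, from the closed set
    -- and the complement of `G`.
    by_contra! hlt
    obtain ⟨b, hb1, hb2⟩ := exists_between hlt
    have h1 := eventually_lt_of_limsup_lt (hport.trans_lt hb1)
    have h2 := (hG0 k).eventually_lt_const (tsub_pos_of_lt hb2)
    obtain ⟨q, h3, h4, h5⟩ := (h1.and (h2.and (eventually_ge_atTop k))).exists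
    have hsub : A q ⊆ Zs q ⁻¹' C k ∪ (G k q)ᶜ := by
      intro e he
      by_cases heG : e ∈ G k q
      · left
        exact subset_closure (Set.mem_iUnion₂.mpr ⟨q, h5, e, ⟨he, heG⟩, rfl⟩)
      · exact Or.inr heG
    have h6 := (ha q).trans ((measure_mono hsub).trans (measure_union_le _ _))
    have h7 := ENNReal.add_lt_add h3 h4
    rw [add_tsub_cancel_of_le hb2.le] at h7
    exact absurd h6 (not_le.mpr h7)
  have hint : a ≤ γ (⋂ k, C k) := by
    rw [hanti.measure_iInter (fun k => isClosed_closure.measurableSet.nullMeasurableSet)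
      ⟨0, measure_ne_top _ _⟩]
    exact le_iInf hone
  refine hint.trans (measure_mono fun z hz => hR z fun k => ?_)
  have h1 := Set.mem_iInter.mp hz k
  rw [hC, Metric.mem_closure_iff] at h1
  obtain ⟨y, hy, hd⟩ := h1 (1 / (k + 1)) (by positivity)
  simp only [Set.mem_iUnion] at hy
  obtain ⟨q, hq, e, he, rfl⟩ := hy
  exact ⟨q, hq, e, he.1, he.2, by rwa [dist_comm]⟩

/-- Lower semicontinuity of the rank, needed for the measurability of rank events. -/
lemma isOpen_le_rank {κ ι : Type*} [Fintype κ] [Fintype ι] (r : ℕ) :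
    IsOpen {A : Matrix κ ι ℝ | r ≤ A.rank} := by
  classical
  let T : Matrix κ ι ℝ →ₗ[ℝ] ((ι → ℝ) →L[ℝ] (κ → ℝ)) :=
    (LinearMap.toContinuousLinearMap : ((ι → ℝ) →ₗ[ℝ] (κ → ℝ)) ≃ₗ[ℝ] _).toLinearMap ∘ₗ
      (Matrix.toLin' : Matrix κ ι ℝ ≃ₗ[ℝ] _).toLinearMap
  have hT : Continuous T := LinearMap.continuous_of_finiteDimensional T
  have h1 := (isOpen_setOfPred_nat_le_rank (𝕜 := ℝ) (E := ι → ℝ) (F := κ → ℝ) r).preimage hT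
  convert h1 using 1
  ext A
  simp only [Set.mem_ofPred_eq, Set.mem_preimage, LinearMap.rank]
  rw [← Module.finrank_eq_rank, Nat.cast_le]
  rfl

lemma tendsto_measure_compl {Θ : Type*} [MeasurableSpace Θ] {μs : ℕ → Measure Θ}
    [∀ q, IsProbabilityMeasure (μs q)] {A : ℕ → Set Θ} (hA : ∀ q, MeasurableSet (A q))
    (h : Tendsto (fun q => μs q (A q)) atTop (𝓝 1)) :
    Tendsto (fun q => μs q (A q)ᶜ) atTop (𝓝 0) := by
  have h1 : Tendsto (fun q => 1 - μs q (A q)) atTop (𝓝 (1 - 1)) :=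
    ENNReal.Tendsto.sub tendsto_const_nhds h (Or.inl ENNReal.one_ne_top)
  rw [tsub_self] at h1
  refine h1.congr fun q => ?_
  rw [prob_compl_eq_one_sub (hA q)]

variable {dC dμ dδ : ℕ}

lemma Model.measurableSet_rank (M : Model dC dμ dδ) (K : Set (Fin dC)) (r : ℕ) :
    MeasurableSet {e : Est dμ dδ | rowRank (M.Cbar e) K = r} := by
  classical
  have hc : Continuous fun e : Est dμ dδ =>
      (M.Cbar e).submatrix (Subtype.val : K → Fin dC) id := by
    have h1 : Continuous fun e : Est dμ dδ => e.Pi := by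
      unfold Est.Pi
      exact continuous_fst.comp continuous_snd
    have h2 : Continuous fun e : Est dμ dδ => M.Cbar e := by
      unfold Model.Cbar Model.CMat
      fun_prop
    exact h2.matrix_submatrix _ _
  have h : {e : Est dμ dδ | rowRank (M.Cbar e) K = r} =
      {e | r ≤ rowRank (M.Cbar e) K} \ {e | r + 1 ≤ rowRank (M.Cbar e) K} := by
    ext e
    simp only [Set.mem_ofPred_eq, Set.mem_sdiff]
    omega
  rw [h]
  have h3 : ∀ r, IsOpen {e : Est dμ dδ | r ≤ rowRank (M.Cbar e) K} := fun r =>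
    (isOpen_le_rank r).preimage hc
  exact (h3 r).measurableSet.diff (h3 _).measurableSet

/-- The whitened limit of the scaled estimation error is standard normal. -/
lemma map_whiten_multivariateGaussian {Ω : Matrix (VecIdx dμ dδ) (VecIdx dμ dδ) ℝ}
    (hΩ : Ω.PosSemidef) {δ : Fin dδ → ℝ} {W V : Matrix (Fin dμ) (Fin dμ) ℝ} (hWV : W * V = 1)
    (hV : V * Vᵀ = sandwich Ω δ) :
    (multivariateGaussian 0 Ω).map (fun z => whiten W
      ((loading δ : Matrix (VecIdx dμ dδ) (Fin dμ) ℝ)ᵀ *ᵥ z.ofLp)) =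
      stdGaussian (EuclideanSpace ℝ (Fin dμ)) := by
  have hm : Measurable fun z : EuclideanSpace ℝ (VecIdx dμ dδ) => whiten W
      ((loading δ : Matrix (VecIdx dμ dδ) (Fin dμ) ℝ)ᵀ *ᵥ z.ofLp) := by
    refine Continuous.measurable ?_
    unfold whiten
    refine (PiLp.continuous_toLp 2 _).comp (Continuous.matrix_mulVec continuous_const
      (Continuous.matrix_mulVec continuous_const (PiLp.continuous_ofLp 2 _)))
  have : IsProbabilityMeasure ((multivariateGaussian 0 Ω).map (fun z => whiten W
      ((loading δ : Matrix (VecIdx dμ dδ) (Fin dμ) ℝ)ᵀ *ᵥ z.ofLp))) :=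
    Measure.isProbabilityMeasure_map hm.aemeasurable
  refine Measure.ext_of_charFun ?_
  ext t
  set A : Matrix (VecIdx dμ dδ) (Fin dμ) ℝ := loading δ with hA
  set u : EuclideanSpace ℝ (VecIdx dμ dδ) := WithLp.toLp 2 (A *ᵥ (Wᵀ *ᵥ t.ofLp)) with hu
  have hin : ∀ z : EuclideanSpace ℝ (VecIdx dμ dδ), ⟪whiten W (Aᵀ *ᵥ z.ofLp), t⟫ = ⟪z, u⟫ := by
    intro z
    rw [real_inner_comm, inner_whiten, EuclideanSpace.inner_eq_star_dotProduct, star_trivial, hu,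
      Matrix.mulVec_transpose A, ← dotProduct_comm, ← Matrix.dotProduct_mulVec, dotProduct_comm]
  rw [charFun_apply, integral_map hm.aemeasurable (by fun_prop)]
  simp only [hin]
  rw [← charFun_apply, charFun_multivariateGaussian hΩ, charFun_stdGaussian]
  have hquad : u.ofLp ⬝ᵥ (Ω *ᵥ u.ofLp) = ‖t‖ ^ 2 := by
    have h1 : u.ofLp ⬝ᵥ (Ω *ᵥ u.ofLp) = quad (sandwich Ω δ) (Wᵀ *ᵥ t.ofLp) := by
      rw [quad, sandwich, ← hA, hu, ← Matrix.mulVec_mulVec, ← Matrix.mulVec_mulVec,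
        Matrix.mulVec_transpose A, dotProduct_comm _ (Matrix.vecMul _ _),
        ← Matrix.dotProduct_mulVec, dotProduct_comm]
    have h2 : V * Vᵀ = (Vᵀ)ᵀ * Vᵀ := by rw [Matrix.transpose_transpose]
    rw [h1, ← hV, h2, quad_transpose_mul, Matrix.mulVec_mulVec, ← Matrix.transpose_mul, hWV,
      Matrix.transpose_one, Matrix.one_mulVec, ← real_inner_self_eq_norm_sq,
      EuclideanSpace.inner_eq_star_dotProduct, star_trivial]
  simp [inner_zero_right, hquad]
  ring_nf

end Probability

/-! ### Asymptotic level along convergent sequences -/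

namespace Model

open scoped ENNReal

variable {dC dμ dδ : ℕ} (M : Model dC dμ dδ)

/-- The rank of the selected rows of the estimator is, with probability tending to one, the rank
of these rows of the limit. -/
def RankStable (Fs : ℕ → Law dμ dδ) (P : Matrix (Fin dμ) (Fin dδ) ℝ)
    (K : Set (Fin dC)) : Prop :=
  Tendsto (fun q => (Fs q : Measure (Est dμ dδ))
    {e | rowRank (M.Cbar e) K = rowRank (M.CMat P) K}) atTop (𝓝 1)

/-- Values of the estimators of the nuisance parameters within `1 / (k + 1)` of their limits, for
which the ranks are those of the limit. -/
def goodSet (Fs : ℕ → Law dμ dδ) (P : Matrix (Fin dμ) (Fin dδ) ℝ)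
    (Ω : Matrix (VecIdx dμ dδ) (VecIdx dμ dδ) ℝ) (Υ : Matrix (Fin dμ) (Fin dμ) ℝ) (k : ℕ) :
    Set (Est dμ dδ) :=
  {e | (∀ i j, |e.Omega i j - Ω i j| < 1 / (k + 1)) ∧
    (∀ i j, |e.Upsilon i j - Υ i j| < 1 / (k + 1)) ∧ e.Omega.IsSymm ∧
    ∀ K, M.RankStable Fs P K → rowRank (M.Cbar e) K = rowRank (M.CMat P) K}

/-- A union bound over the finitely many sets of rows; rows without stable rank impose no condition.
-/
lemma tendsto_compl_goodSet {Fs : ℕ → Law dμ dδ} {P : Matrix (Fin dμ) (Fin dδ) ℝ}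
    {Ω : Matrix (VecIdx dμ dδ) (VecIdx dμ dδ) ℝ} {Υ : Matrix (Fin dμ) (Fin dμ) ℝ}
    (hΩ : ∀ ε : ℝ, 0 < ε → Tendsto (fun q => (Fs q : Measure (Est dμ dδ))
      {e | ∃ i j, ε ≤ |e.Omega i j - Ω i j|}) atTop (𝓝 0))
    (hΥ : ∀ ε : ℝ, 0 < ε → Tendsto (fun q => (Fs q : Measure (Est dμ dδ))
      {e | ∃ i j, ε ≤ |e.Upsilon i j - Υ i j|}) atTop (𝓝 0))
    (hsymm : ∀ q, ∀ᵐ e ∂(Fs q : Measure (Est dμ dδ)), e.Omega.IsSymm) (k : ℕ) :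
    Tendsto (fun q => (Fs q : Measure (Est dμ dδ)) (M.goodSet Fs P Ω Υ k)ᶜ) atTop (𝓝 0) := by
  classical
  set ε : ℝ := 1 / (k + 1) with hε
  have hε0 : 0 < ε := by positivity
  let E : Set (Fin dC) → Set (Est dμ dδ) := fun K =>
    {e | M.RankStable Fs P K ∧ rowRank (M.Cbar e) K ≠ rowRank (M.CMat P) K}
  have hE : ∀ K, Tendsto (fun q => (Fs q : Measure (Est dμ dδ)) (E K)) atTop (𝓝 0) := by
    intro K
    by_cases hK : M.RankStable Fs P K
    · have h1 := tendsto_measure_compl (fun _ => M.measurableSet_rank K _) hK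
      simpa only [E, hK, true_and, Set.compl_ofPred] using h1
    · simp [E, hK]
  have hsum : Tendsto (fun q => (Fs q : Measure (Est dμ dδ))
      {e | ∃ i j, ε ≤ |e.Omega i j - Ω i j|} + (Fs q : Measure (Est dμ dδ))
      {e | ∃ i j, ε ≤ |e.Upsilon i j - Υ i j|} +
      ∑ K : Set (Fin dC), (Fs q : Measure (Est dμ dδ)) (E K)) atTop (𝓝 0) := by
    have := ((hΩ ε hε0).add (hΥ ε hε0)).add (tendsto_finsetSum Finset.univ fun K _ => hE K)
    simpa using this
  refine tendsto_of_tendsto_of_tendsto_of_le_of_le tendsto_const_nhds hsum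
    (fun _ => zero_le) fun q => ?_
  have hsub : (M.goodSet Fs P Ω Υ k)ᶜ ⊆ ({e | ∃ i j, ε ≤ |e.Omega i j - Ω i j|} ∪
      {e | ∃ i j, ε ≤ |e.Upsilon i j - Υ i j|} ∪ ⋃ K, E K) ∪ {e | ¬ e.Omega.IsSymm} := by
    intro e he
    by_contra hcon
    simp only [E, Set.mem_union, Set.mem_iUnion, Set.mem_ofPred_eq, not_or, not_exists, not_le,
      not_and, not_not] at hcon
    exact he ⟨hcon.1.1.1, hcon.1.1.2, hcon.2, hcon.1.2⟩
  refine (measure_mono hsub).trans ((measure_union_le _ _).trans ?_)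
  rw [show (Fs q : Measure (Est dμ dδ)) {e | ¬ e.Omega.IsSymm} = 0 from hsymm q, add_zero]
  refine (measure_union_le _ _).trans (add_le_add (measure_union_le _ _) ?_)
  refine (measure_iUnion_le _).trans ?_
  rw [tsum_fintype]

lemma tendsto_of_abs_lt {ι κ : Type*} {Xs : ℕ → Matrix ι κ ℝ} {X : Matrix ι κ ℝ}
    (h : ∀ k i j, |Xs k i j - X i j| < 1 / ((k : ℝ) + 1)) : Tendsto Xs atTop (𝓝 X) := by
  refine tendsto_pi_nhds.mpr fun i => tendsto_pi_nhds.mpr fun j => ?_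
  rw [tendsto_iff_dist_tendsto_zero]
  refine squeeze_zero (fun _ => dist_nonneg) (fun k => ?_) tendsto_one_div_add_atTop_nhds_zero_nat
  rw [Real.dist_eq]
  exact (h k i j).le

/-- The asymptotic level along sequences for which all the limits exist. -/
theorem le_level_of_tendsto {ns : ℕ → ℕ} {Fs : ℕ → Law dμ dδ}
    {μ : Fin dμ → ℝ} {d : Fin dC → ℝ} {P : Matrix (Fin dμ) (Fin dδ) ℝ}
    {Ω : Matrix (VecIdx dμ dδ) (VecIdx dμ dδ) ℝ}
    {Υ : Matrix (Fin dμ) (Fin dμ) ℝ} {h : Fin dC → EReal} {κ : Fin dC → ℝ}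
    {δ : Fin dδ → ℝ} (hδ' : δ = minNormPoint (poly (M.CMat P) (d - M.B *ᵥ μ)))
    (hns : Tendsto ns atTop atTop) (hn1 : ∀ q, 1 ≤ ns q)
    (hμ : Tendsto (fun q => M.muF (ns q) (Fs q)) atTop (𝓝 μ))
    (hP : Tendsto (fun q => M.PiF (ns q) (Fs q)) atTop (𝓝 P))
    (hd : Tendsto (fun q => M.d (ns q)) atTop (𝓝 d)) (hnull : ∀ q, Fs q ∈ M.null (ns q))
    (hne : (poly (M.CMat P) (d - M.B *ᵥ μ)).Nonempty)
    (hδ : Tendsto (fun q => M.deltaStar (ns q) (Fs q)) atTop (𝓝 δ))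
    (hΩpsd : Ω.PosSemidef)
    (hZ : TendstoInDistribution (fun q e => M.scaledError (ns q) (Fs q) e) atTop
      (id : EuclideanSpace ℝ (VecIdx dμ dδ) → EuclideanSpace ℝ (VecIdx dμ dδ))
      (fun q => (Fs q : Measure (Est dμ dδ))) (multivariateGaussian 0 Ω))
    (hΩ : ∀ ε : ℝ, 0 < ε → Tendsto (fun q => (Fs q : Measure (Est dμ dδ))
      {e | ∃ i j, ε ≤ |e.Omega i j - Ω i j|}) atTop (𝓝 0))
    (hΥ : ∀ ε : ℝ, 0 < ε → Tendsto (fun q => (Fs q : Measure (Est dμ dδ))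
      {e | ∃ i j, ε ≤ |e.Upsilon i j - Υ i j|}) atTop (𝓝 0))
    (hsymm : ∀ q, ∀ᵐ e ∂(Fs q : Measure (Est dμ dδ)), e.Omega.IsSymm) (hΥpd : Υ.PosDef)
    (hr : M.RankStable Fs P (minActivatable (M.CMat P) (toE (d - M.B *ᵥ μ))))
    (hSpd : (sandwich Ω δ).PosDef)
    (hh : ∀ j, Tendsto (fun q => ((M.hF (ns q) (Fs q) j : ℝ) : EReal)) atTop (𝓝 (h j)))
    (hκ0 : 0 ≤ κ) (hκB : M.Bᵀ *ᵥ κ = 0) (hκD : M.Dᵀ *ᵥ κ = 0)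
    (hκd : ∀ n, 1 ≤ n → κ ⬝ᵥ M.d n = 0)
    (hrank : ∀ (x ν : Fin dμ → ℝ) (ψ : Fin dC → ℝ),
      IsProjection (sandwich Ω δ) M.B (M.CMat P) h x ν →
      0 ≤ ψ → (∀ j ∉ minActivatable (M.CMat P) (shiftE M.B h ν), ψ j = 0) →
      M.Bᵀ *ᵥ ψ = (sandwich Ω δ)⁻¹ *ᵥ (x - ν) → (M.CMat P)ᵀ *ᵥ ψ = 0 →
      M.RankStable Fs P {j | 0 < ψ j + κ j})
    {α : ℝ} (hα : 0 < α) (hα' : α < 1 / 2) {muHat : ℕ → Est dμ dδ → Fin dμ → ℝ}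
    {deltaHat : ℕ → Est dμ dδ → Fin dδ → ℝ} {betaHat : ℕ → Est dμ dδ → ℝ}
    (hsol : ∀ n, 1 ≤ n → ∀ e, (M.sigmaTilde n e).PosDef →
      M.IsSolution n e (muHat n e) (deltaHat n e))
    (hbeta : ∀ n, 1 ≤ n → ∀ e, (M.sigmaTilde n e).PosDef →
      M.IsRefinedLevel n α e (muHat n e) (deltaHat n e) (betaHat n e))
    {a : ℝ≥0∞} (hrej : ∀ q, a ≤ (Fs q : Measure (Est dμ dδ))
      {e | cv (M.sHat (ns q) e (muHat (ns q) e) (deltaHat (ns q) e)) (betaHat (ns q) e) <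
        M.T (ns q) e}) :
    a ≤ ENNReal.ofReal α := by
  obtain ⟨W, V, hWV, hVW, hW, hV⟩ := exists_whitening hSpd
  have h0 : ∀ j, 0 ≤ h j := fun j => ge_of_tendsto' (hh j) fun q => by
    exact_mod_cast M.hF_nonneg (hnull q) j
  set f : EuclideanSpace ℝ (VecIdx dμ dδ) → EuclideanSpace ℝ (Fin dμ) := fun z => whiten W
    ((loading δ : Matrix (VecIdx dμ dδ) (Fin dμ) ℝ)ᵀ *ᵥ z.ofLp) with hf
  have hmap := map_whiten_multivariateGaussian hΩpsd hWV hV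
  rw [← hf] at hmap
  -- The image under a map that is not almost everywhere measurable is zero by convention, which a
  -- probability measure is not.
  have hfm : AEMeasurable f (multivariateGaussian 0 Ω) := by
    by_contra hcon
    rw [Measure.map_of_not_aemeasurable hcon] at hmap
    exact IsProbabilityMeasure.ne_zero (stdGaussian (EuclideanSpace ℝ (Fin dμ))) hmap.symm
  have key : a ≤ multivariateGaussian 0 Ω
      (f ⁻¹' limitRegion α W V (sandwich Ω δ) hWV hVW M.B (M.CMat P) h) := by
    refine le_measure_of_tendstoInDistribution hZ (G := fun k _ => M.goodSet Fs P Ω Υ k)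
      (fun q => ?_) (M.tendsto_compl_goodSet hΩ hΥ hsymm) hrej fun z hz => ?_
    · intro k k' hk e he
      have hle : 1 / ((k' : ℝ) + 1) ≤ 1 / ((k : ℝ) + 1) := by gcongr
      exact ⟨fun i j => (he.1 i j).trans_le hle, fun i j => (he.2.1 i j).trans_le hle, he.2.2⟩
    -- From here the argument is deterministic: rejecting realizations with good nuisance estimates
    -- and scaled errors converging to `z`.
    · choose qs hqs es hes hgood hdist using hz
      have hq : Tendsto qs atTop atTop := tendsto_atTop_mono hqs tendsto_id
      refine M.mem_limitRegion (ns := ns ∘ qs) (Fs := Fs ∘ qs) (es := es) hδ' (hns.comp hq)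
        (fun q => hn1 _) (hμ.comp hq) (hP.comp hq) (hd.comp hq) (fun q => hnull _) hne
        (hδ.comp hq) ?_ (tendsto_of_abs_lt fun k => (hgood k).1) (fun k => (hgood k).2.2.1)
        (tendsto_of_abs_lt fun k => (hgood k).2.1) hΥpd
        (Eventually.of_forall fun k => (hgood k).2.2.2 _ hr) rfl hSpd hWV hVW hW
        (fun j => (hh j).comp hq) hκ0 hκB hκD hκd
        (fun x ν ψ h1 h2 h3 h4 h5 => Eventually.of_forall fun k =>
          (hgood k).2.2.2 _ (hrank x ν ψ h1 h2 h3 h4 h5)) hα hα' hsol hbeta hes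
      rw [tendsto_iff_dist_tendsto_zero]
      exact squeeze_zero (fun _ => dist_nonneg) (fun k => (hdist k).le)
        tendsto_one_div_add_atTop_nhds_zero_nat
  -- This inequality holds for every set, so the measurability of the limit region is not needed.
  refine key.trans ((Measure.le_map_apply hfm _).trans ?_)
  rw [hmap]
  exact stdGaussian_limitRegion_le hSpd hWV hVW hW h0 hα hα'

end Model

/-! ### Existence of convergent subsequences -/

namespace Model

open scoped ENNReal

variable {dC dμ dδ : ℕ} (M : Model dC dμ dδ)

/-- Nonnegative combinations of the inequalities that cancel, with positive weights on all the
inequalities that come from an equality. -/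
lemma exists_equality_weights : ∃ κ : Fin dC → ℝ, 0 ≤ κ ∧ M.Bᵀ *ᵥ κ = 0 ∧ M.Dᵀ *ᵥ κ = 0 ∧
    (∀ n, 1 ≤ n → κ ⬝ᵥ M.d n = 0) ∧ ∀ j ∈ M.eqIdx, 0 < κ j := by
  classical
  have hw : ∀ j : Fin dC, ∃ w : Fin dC → ℝ, 0 ≤ w ∧ M.Bᵀ *ᵥ w = 0 ∧ M.Dᵀ *ᵥ w = 0 ∧
      (∀ n, 1 ≤ n → w ⬝ᵥ M.d n = 0) ∧ (j ∈ M.eqIdx → 0 < w j) := by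
    intro j
    by_cases hj : j ∈ M.eqIdx
    · obtain ⟨i, hB, hD, hd⟩ := hj
      have hnn : ∀ i : Fin dC, (0 : Fin dC → ℝ) ≤ Pi.single i 1 := fun i =>
        Pi.single_nonneg.mpr zero_le_one
      -- Weight one on each of the two opposing inequalities; summing over `j` then covers all
      -- equalities.
      refine ⟨Pi.single j 1 + Pi.single i 1, add_nonneg (hnn _) (hnn _), ?_, ?_, ?_, fun _ => ?_⟩
      · rw [Matrix.mulVec_add, Matrix.mulVec_single_one, Matrix.mulVec_single_one]
        exact (congrArg (M.B j + ·) hB).trans (add_neg_cancel _)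
      · rw [Matrix.mulVec_add, Matrix.mulVec_single_one, Matrix.mulVec_single_one]
        exact (congrArg (M.D j + ·) hD).trans (add_neg_cancel _)
      · intro n hn
        rw [add_dotProduct, single_one_dotProduct, single_one_dotProduct, hd n hn, add_neg_cancel]
      · have := hnn i j
        simp only [Pi.add_apply, Pi.single_eq_same, Pi.zero_apply] at this ⊢
        linarith
    · exact ⟨0, le_rfl, Matrix.mulVec_zero _, Matrix.mulVec_zero _, fun n _ => zero_dotProduct _,
        fun h => absurd h hj⟩
  choose w h0 hB hD hd hpos using hw
  refine ⟨∑ j, w j, Finset.sum_nonneg fun j _ => h0 j, ?_, ?_, fun n hn => ?_, fun j hj => ?_⟩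
  · rw [Matrix.mulVec_sum]
    exact Finset.sum_eq_zero fun j _ => hB j
  · rw [Matrix.mulVec_sum]
    exact Finset.sum_eq_zero fun j _ => hD j
  · rw [sum_dotProduct]
    exact Finset.sum_eq_zero fun j _ => hd j n hn
  · rw [Finset.sum_apply]
    exact (hpos j hj).trans_le
      (Finset.single_le_sum (f := fun i => w i j) (fun i _ => h0 i j) (Finset.mem_univ j))

/-- Weights that cancel are supported on constraints that bind. -/
lemma active_of_weight_pos {κ : Fin dC → ℝ} (hκ0 : 0 ≤ κ) (hκB : M.Bᵀ *ᵥ κ = 0)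
    (hκD : M.Dᵀ *ᵥ κ = 0) {μ : Fin dμ → ℝ} {d : Fin dC → ℝ} {P : Matrix (Fin dμ) (Fin dδ) ℝ}
    (hκd : κ ⬝ᵥ d = 0) {δ : Fin dδ → ℝ} (hδ : δ ∈ poly (M.CMat P) (d - M.B *ᵥ μ)) {j : Fin dC}
    (hj : 0 < κ j) : (M.CMat P *ᵥ δ) j = (d - M.B *ᵥ μ) j := by
  have hC : (M.CMat P)ᵀ *ᵥ κ = 0 := by
    rw [CMat, transpose_mul_add_mulVec, hκB, hκD, Matrix.mulVec_zero, add_zero]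
  have hsum : κ ⬝ᵥ (M.CMat P *ᵥ δ - (d - M.B *ᵥ μ)) = 0 := by
    rw [Matrix.mulVec_transpose] at hC hκB
    rw [dotProduct_sub, dotProduct_sub, dotProduct_mulVec_eq_zero hC,
      dotProduct_mulVec_eq_zero hκB, hκd]
    simp
  by_contra hcon
  exact hj.ne' (eq_zero_of_slack hκ0 (sub_nonpos.mpr hδ) hsum (sub_ne_zero.mpr hcon))

/-- The rank of `C_F` is not random: its equality holds once the joint event has positive
probability. -/
lemma rankStable_of_and {ns : ℕ → ℕ} {Fs : ℕ → Law dμ dδ} {P : Matrix (Fin dμ) (Fin dδ) ℝ}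
    {K : Set (Fin dC)} (h : Tendsto (fun q => (Fs q : Measure (Est dμ dδ))
      {e | rowRank (M.Cbar e) K = rowRank (M.CF (ns q) (Fs q)) K ∧
        rowRank (M.CF (ns q) (Fs q)) K = rowRank (M.CMat P) K}) atTop (𝓝 1)) :
    M.RankStable Fs P K ∧ ∀ᶠ q in atTop, rowRank (M.CF (ns q) (Fs q)) K = rowRank (M.CMat P) K := by
  constructor
  · exact tendsto_of_tendsto_of_tendsto_of_le_of_le h tendsto_const_nhds
      (fun q => measure_mono fun e he => he.1.trans he.2) fun q => prob_le_one
  · filter_upwards [h.eventually_const_lt zero_lt_one] with q hq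
    obtain ⟨e, he⟩ := nonempty_of_measure_ne_zero hq.ne'
    exact he.2

/-- Sequential compactness of the product of extended real lines. -/
lemma exists_subseq_hF (ns : ℕ → ℕ) (Fs : ℕ → Law dμ dδ) :
    ∃ (χ : ℕ → ℕ) (h : Fin dC → EReal), StrictMono χ ∧ ∀ j,
      Tendsto (fun q => ((M.hF (ns (χ q)) (Fs (χ q)) j : ℝ) : EReal)) atTop (𝓝 (h j)) := by
  obtain ⟨h, χ, hχ, hlim⟩ := CompactSpace.tendsto_subseq fun q => toE (M.hF (ns q) (Fs q))
  exact ⟨χ, h, hχ, fun j => tendsto_pi_nhds.mp hlim j⟩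

/-- The limits needed for the asymptotic level exist along a subsequence. -/
def HasStableSubseq (ns : ℕ → ℕ) (Fs : ℕ → Law dμ dδ) (μ : Fin dμ → ℝ) (d : Fin dC → ℝ)
    (P : Matrix (Fin dμ) (Fin dδ) ℝ) : Prop :=
  ∃ (χ : ℕ → ℕ) (h : Fin dC → EReal) (κ : Fin dC → ℝ), StrictMono χ ∧
    (∀ᶠ q in atTop, rowRank (M.CF (ns (χ q)) (Fs (χ q)))
      (minActivatable (M.CMat P) (toE (d - M.B *ᵥ μ))) =
      rowRank (M.CMat P) (minActivatable (M.CMat P) (toE (d - M.B *ᵥ μ)))) ∧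
    M.RankStable (fun q => Fs (χ q)) P (minActivatable (M.CMat P) (toE (d - M.B *ᵥ μ))) ∧
    (∀ j, Tendsto (fun q => ((M.hF (ns (χ q)) (Fs (χ q)) j : ℝ) : EReal)) atTop (𝓝 (h j))) ∧
    0 ≤ κ ∧ M.Bᵀ *ᵥ κ = 0 ∧ M.Dᵀ *ᵥ κ = 0 ∧ (∀ n, 1 ≤ n → κ ⬝ᵥ M.d n = 0) ∧
    ∀ (S : Matrix (Fin dμ) (Fin dμ) ℝ) (x ν : Fin dμ → ℝ) (ψ : Fin dC → ℝ), S.PosDef →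
      IsProjection S M.B (M.CMat P) h x ν → 0 ≤ ψ →
      (∀ j ∉ minActivatable (M.CMat P) (shiftE M.B h ν), ψ j = 0) →
      M.Bᵀ *ᵥ ψ = S⁻¹ *ᵥ (x - ν) → (M.CMat P)ᵀ *ᵥ ψ = 0 →
      M.RankStable (fun q => Fs (χ q)) P {j | 0 < ψ j + κ j}

variable {F : ℕ → Law dμ dδ} {θ : ℕ → ℕ} {μ : Fin dμ → ℝ} {d : Fin dC → ℝ}
  {P : Matrix (Fin dμ) (Fin dδ) ℝ}

/-- The supports of `ψ + κ` contain all equalities and are simultaneously active at the limiting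
minimum norm point, so the rank assumption covers them. -/
lemma hasStableSubseq_of_assumption2 (h2 : M.Assumption2) (hF : M.IsNullSeq F) (hθ : StrictMono θ)
    (hθ1 : ∀ q, 1 ≤ θ q) (hpar : M.ParamConv F θ μ d P)
    (hne : (poly (M.CMat P) (d - M.B *ᵥ μ)).Nonempty) :
    M.HasStableSubseq θ (fun q => F (θ q)) μ d P := by
  obtain ⟨χ₁, hχ₁, hK⟩ := h2 F hF θ hθ μ d P hpar
  obtain ⟨χ₂, h, hχ₂, hh⟩ := M.exists_subseq_hF (fun q => θ (χ₁ q)) (fun q => F (θ (χ₁ q)))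
  obtain ⟨κ, hκ0, hκB, hκD, hκd, hκpos⟩ := M.exists_equality_weights
  have hχ : StrictMono (χ₁ ∘ χ₂) := hχ₁.comp hχ₂
  have hlim := hχ.tendsto_atTop
  obtain ⟨hμ, hP, hd⟩ := hpar
  have hstab : ∀ K ∈ simActive (M.CMat P) (d - M.B *ᵥ μ), M.eqIdx ⊆ K →
      M.RankStable (fun q => F (θ (χ₁ (χ₂ q)))) P K ∧ ∀ᶠ q in atTop,
        rowRank (M.CF (θ (χ₁ (χ₂ q))) (F (θ (χ₁ (χ₂ q))))) K = rowRank (M.CMat P) K :=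
    fun K hK1 hK2 => M.rankStable_of_and ((hK K hK1 hK2).comp hχ₂.tendsto_atTop)
  have hκlim : κ ⬝ᵥ d = 0 := by
    have h1 : Tendsto (fun q => κ ⬝ᵥ M.d (θ q)) atTop (𝓝 (κ ⬝ᵥ d)) :=
      ((continuous_const.dotProduct continuous_id).tendsto d).comp hd
    refine tendsto_nhds_unique h1 ?_
    simp only [hκd _ (hθ1 _)]
    exact tendsto_const_nhds
  have hact : ∀ δ ∈ poly (M.CMat P) (d - M.B *ᵥ μ), ∀ j, 0 < κ j →
      (M.CMat P *ᵥ δ) j = (d - M.B *ᵥ μ) j := fun δ hδ j hj =>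
    M.active_of_weight_pos hκ0 hκB hκD hκlim hδ hj
  set δ := minNormPoint (poly (M.CMat P) (d - M.B *ᵥ μ)) with hδdef
  have hδ : δ ∈ poly (M.CMat P) (d - M.B *ᵥ μ) := (minNormPoint_spec hne).1
  -- Equality rows bind at every feasible point, so they belong to the minimal activatable set.
  have hK0 := hstab (minActivatable (M.CMat P) (toE (d - M.B *ᵥ μ)))
    ⟨δ, hδ, fun j hj => by
      have := eq_of_mem_minActivatable (by rwa [polyE_toE]) hj (δ := δ)
      exact EReal.coe_eq_coe_iff.mp this⟩ (by
      rintro j hj _ ⟨δ', hδ', rfl⟩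
      rw [polyE_toE] at hδ'
      exact EReal.coe_eq_coe_iff.mpr (hact δ' hδ' j (hκpos j hj)))
  have hns : Tendsto (fun q => θ (χ₁ (χ₂ q))) atTop atTop := hθ.tendsto_atTop.comp hlim
  have hδlim := M.tendsto_deltaStar (hμ.comp hlim) (hP.comp hlim) (hd.comp hlim)
    (fun q => hF _ (hθ1 _)) hne hK0.2
  refine ⟨χ₁ ∘ χ₂, h, κ, hχ, hK0.2, hK0.1, hh, hκ0, hκB, hκD, hκd, ?_⟩
  intro S x ν ψ _ hproj hψ0 hψ _ _
  refine (hstab _ ⟨δ, hδ, fun j hj => ?_⟩ fun j hj => ?_).1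
  · rcases (hκ0 j).lt_or_eq with hκj | hκj
    · exact hact δ hδ j hκj
    have hψj : 0 < ψ j := by
      have h1 : 0 < ψ j + κ j := hj
      rwa [← hκj, Pi.zero_apply, add_zero] at h1
    have hjm : j ∈ minActivatable (M.CMat P) (shiftE M.B h ν) := by
      by_contra hcon
      exact hψj.ne' (hψ j hcon)
    obtain ⟨δ', hδ'⟩ := hproj.1
    have h1 := coe_eq_shiftE_iff.mp (eq_of_mem_minActivatable (mem_polyE_shiftE_iff.mpr hδ') hjm)
    have h2 : Tendsto (fun q => M.hF (θ (χ₁ (χ₂ q))) (F (θ (χ₁ (χ₂ q)))) j) atTop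
        (𝓝 ((M.B *ᵥ ν) j + (M.CMat P *ᵥ δ') j)) := by
      have h3 := hh j
      rw [← h1] at h3
      exact EReal.tendsto_coe.mp h3
    -- An active row has a finite scaled slack in the limit, so its unscaled slack vanishes; by
    -- continuity of `deltaStar` this makes it active at the limit point.
    have h3 : Tendsto (fun q => M.bF (θ (χ₁ (χ₂ q))) (F (θ (χ₁ (χ₂ q)))) j -
        (M.CF (θ (χ₁ (χ₂ q))) (F (θ (χ₁ (χ₂ q)))) *ᵥ
          M.deltaStar (θ (χ₁ (χ₂ q))) (F (θ (χ₁ (χ₂ q))))) j) atTop (𝓝 0) :=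
      tendsto_zero_of_smul
        (Real.tendsto_sqrt_atTop.comp (tendsto_natCast_atTop_atTop.comp hns)) h2
    have h4 := ((M.tendsto_bF (hμ.comp hlim) (hd.comp hlim)).sub
      (tendsto_mulVec (M.tendsto_CMat (hP.comp hlim)) hδlim))
    have h5 := tendsto_nhds_unique h3 (tendsto_pi_nhds.mp h4 j)
    rw [Pi.sub_apply] at h5
    exact (sub_eq_zero.mp h5.symm).symm
  · exact add_pos_of_nonneg_of_pos (hψ0 j) (hκpos j hj)

/-- The multiplier supports are themselves members of `lActivatable`, so no equality weights are
needed and `κ = 0`. -/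
lemma hasStableSubseq_of_assumption34 (h3 : M.Assumption3) (h4 : M.Assumption4)
    (hF : M.IsNullSeq F) (hθ : StrictMono θ) (hθ1 : ∀ q, 1 ≤ θ q) (hpar : M.ParamConv F θ μ d P)
    (hne : (poly (M.CMat P) (d - M.B *ᵥ μ)).Nonempty) :
    M.HasStableSubseq θ (fun q => F (θ q)) μ d P := by
  obtain ⟨χ₁, hχ₁, hK⟩ := h3 F hF θ hθ μ d P hpar hne
  obtain ⟨χ₂, h, hχ₂, hh⟩ := M.exists_subseq_hF (fun q => θ (χ₁ q)) (fun q => F (θ (χ₁ q)))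
  have hlim := (hχ₁.comp hχ₂).tendsto_atTop
  obtain ⟨χ₃, hχ₃, hKL⟩ := h4 F hF (θ ∘ χ₁ ∘ χ₂) (hθ.comp (hχ₁.comp hχ₂)) μ d P h
    ⟨hpar.1.comp hlim, hpar.2.1.comp hlim, hpar.2.2.comp hlim⟩
    (fun j => ge_of_tendsto' (hh j) fun q => by
      exact_mod_cast M.hF_nonneg (hF _ (hθ1 _)) j) hh
  have hK0 := M.rankStable_of_and ((hK _ rfl).comp (hχ₂.comp hχ₃).tendsto_atTop)
  rw [shiftE_toE] at hK0
  refine ⟨χ₁ ∘ χ₂ ∘ χ₃, h, 0, hχ₁.comp (hχ₂.comp hχ₃), hK0.2, hK0.1,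
    fun j => (hh j).comp hχ₃.tendsto_atTop, le_rfl, Matrix.mulVec_zero _, Matrix.mulVec_zero _,
    fun n _ => zero_dotProduct _, fun S x ν ψ hS hproj hψ0 hψ hψB hψC => ?_⟩
  -- The factor 2 matches the gradient of the quadratic form in `IsMultiplier`; it does not change
  -- the support.
  refine hKL _ (Or.inr ⟨S, x, ν, (2 : ℝ) • ψ, hS, hproj, ⟨?_, ?_, ?_, ?_⟩, ?_⟩)
  · rw [Matrix.mulVec_smul, hψB, ← smul_add, ← Matrix.mulVec_add]
    simp
  · rw [Matrix.mulVec_smul, hψC, smul_zero]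
  · exact smul_nonneg zero_le_two hψ0
  · intro j hj
    rw [Pi.smul_apply, hψ j hj, smul_zero]
  · ext j
    simp

/-- The asymptotic level along subsequences of sequences that satisfy the null hypothesis. -/
theorem le_level_of_subseq {α : ℝ} (hα : 0 < α) (hα' : α < 1 / 2)
    (hsymm : ∀ n, 1 ≤ n → ∀ F ∈ M.null n,
      ∀ᵐ e ∂(F : Measure (Est dμ dδ)), e.Omega.IsSymm)
    (h1 : M.Assumption1) (h2 : M.Assumption2 ∨ (M.Assumption3 ∧ M.Assumption4))
    {muHat : ℕ → Est dμ dδ → Fin dμ → ℝ}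
    {deltaHat : ℕ → Est dμ dδ → Fin dδ → ℝ} {betaHat : ℕ → Est dμ dδ → ℝ}
    (hsol : ∀ n, 1 ≤ n → ∀ e, (M.sigmaTilde n e).PosDef →
      M.IsSolution n e (muHat n e) (deltaHat n e))
    (hbeta : ∀ n, 1 ≤ n → ∀ e, (M.sigmaTilde n e).PosDef →
      M.IsRefinedLevel n α e (muHat n e) (deltaHat n e) (betaHat n e))
    (hF : M.IsNullSeq F) {φ : ℕ → ℕ} (hφ : StrictMono φ) (hφ1 : ∀ q, 1 ≤ φ q)
    {a : ℝ≥0∞} (hrej : ∀ q, a ≤ (F (φ q) : Measure (Est dμ dδ))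
      {e | cv (M.sHat (φ q) e (muHat (φ q) e) (deltaHat (φ q) e)) (betaHat (φ q) e) <
        M.T (φ q) e}) :
    a ≤ ENNReal.ofReal α := by
  obtain ⟨χ, μ, d, P, Ω, Υ, hχ, hΩpsd, hΥpd, hpar, hZ, hSpd, hΩ, hΥ, hne⟩ := h1 F hF φ hφ
  have hstab : M.HasStableSubseq (φ ∘ χ) (fun q => F ((φ ∘ χ) q)) μ d P := by
    rcases h2 with h2 | ⟨h3, h4⟩
    · exact M.hasStableSubseq_of_assumption2 h2 hF (hφ.comp hχ) (fun q => hφ1 _) hpar hne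
    · exact M.hasStableSubseq_of_assumption34 h3 h4 hF (hφ.comp hχ) (fun q => hφ1 _) hpar hne
  obtain ⟨ω, h, κ, hω, hCF, hr, hh, hκ0, hκB, hκD, hκd, hrank⟩ := hstab
  have hlim := hω.tendsto_atTop
  have hZ' : TendstoInDistribution (fun q e => M.scaledError (φ (χ (ω q))) (F (φ (χ (ω q)))) e) atTop
      (id : EuclideanSpace ℝ (VecIdx dμ dδ) → EuclideanSpace ℝ (VecIdx dμ dδ))
      (fun q => (F (φ (χ (ω q))) : Measure (Est dμ dδ))) (multivariateGaussian 0 Ω) :=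
    { forall_aemeasurable := fun q => hZ.forall_aemeasurable (ω q)
      aemeasurable_limit := hZ.aemeasurable_limit
      tendsto := hZ.tendsto.comp hlim }
  have hμ := hpar.1.comp hlim
  have hP := hpar.2.1.comp hlim
  have hd := hpar.2.2.comp hlim
  have hnull : ∀ q, F (φ (χ (ω q))) ∈ M.null (φ (χ (ω q))) := fun q => hF _ (hφ1 _)
  exact M.le_level_of_tendsto rfl (((hφ.comp hχ).comp hω).tendsto_atTop) (fun q => hφ1 _) hμ hP hd
    hnull hne (M.tendsto_deltaStar hμ hP hd hnull hne hCF) hΩpsd hZ'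
    (fun ε hε => (hΩ ε hε).comp hlim) (fun ε hε => (hΥ ε hε).comp hlim)
    (fun q => hsymm _ (hφ1 _) _ (hnull q)) hΥpd hr hSpd hh hκ0 hκB hκD hκd
    (fun x ν ψ => hrank _ x ν ψ hSpd) hα hα' hsol hbeta fun q => hrej _

end Model

end GCC

end

/-- Uniformity over the null reduces to sequences: distributions that nearly attain the supremum
along a subsequence contradict the bound of `le_level_of_subseq`. -/
theorem mainTheorem4 {dC dμ dδ : ℕ} (M : GCC.Model dC dμ dδ) (α : ℝ) (hα : 0 < α)
    (hα' : α < 1 / 2)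
    (hne : ∀ n, 1 ≤ n → (M.null n).Nonempty)
    (hsymm : ∀ n, 1 ≤ n → ∀ F ∈ M.null n,
      ∀ᵐ e ∂(F : Measure (GCC.Est dμ dδ)), e.Omega.IsSymm)
    (h1 : M.Assumption1)
    (h2 : M.Assumption2 ∨ (M.Assumption3 ∧ M.Assumption4))
    (muHat : ℕ → GCC.Est dμ dδ → Fin dμ → ℝ) (deltaHat : ℕ → GCC.Est dμ dδ → Fin dδ → ℝ)
    (betaHat : ℕ → GCC.Est dμ dδ → ℝ)
    (hsol : ∀ n, 1 ≤ n → ∀ e, (M.sigmaTilde n e).PosDef →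
      M.IsSolution n e (muHat n e) (deltaHat n e))
    (hbeta : ∀ n, 1 ≤ n → ∀ e, (M.sigmaTilde n e).PosDef →
      M.IsRefinedLevel n α e (muHat n e) (deltaHat n e) (betaHat n e)) :
    (∀ n, 1 ≤ n → ∀ e, (M.sigmaTilde n e).PosDef →
      betaHat n e ∈ Set.Icc α (2 * α)) ∧
    limsup (fun n : ℕ => ⨆ F ∈ M.null n, (F : Measure (GCC.Est dμ dδ))
      {e | GCC.cv (M.sHat n e (muHat n e) (deltaHat n e)) (betaHat n e) < M.T n e}) atTop
      ≤ ENNReal.ofReal α := by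
  refine ⟨fun n hn e hS => M.refinedLevel_mem (hsol n hn e hS) hα (hbeta n hn e hS), ?_⟩
  set A : ℕ → Set (GCC.Est dμ dδ) := fun n =>
    {e | GCC.cv (M.sHat n e (muHat n e) (deltaHat n e)) (betaHat n e) < M.T n e} with hA
  by_contra! hlt
  obtain ⟨a, ha1, ha2⟩ := exists_between hlt
  have hfreq := frequently_lt_of_lt_limsup (by isBoundedDefault) ha2
  obtain ⟨φ, hφ, hφa⟩ := extraction_of_frequently_atTop
    (hfreq.and_eventually (eventually_ge_atTop 1))
  -- Off the subsequence any null distribution will do; nonemptiness supplies one, since the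
  -- assumptions concern sequences that are null at every `n ≥ 1`.
  have hex : ∀ n, 1 ≤ n → ∃ F ∈ M.null n,
      a < (⨆ F ∈ M.null n, (F : Measure (GCC.Est dμ dδ)) (A n)) →
        a ≤ (F : Measure (GCC.Est dμ dδ)) (A n) := by
    intro n hn
    by_cases h : a < ⨆ F ∈ M.null n, (F : Measure (GCC.Est dμ dδ)) (A n)
    · have h' := h
      simp only [lt_iSup_iff] at h'
      obtain ⟨F, hF, hFa⟩ := h'
      exact ⟨F, hF, fun _ => hFa.le⟩
    · obtain ⟨F, hF⟩ := hne n hn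
      exact ⟨F, hF, fun h' => absurd h' h⟩
  choose! F hF hFa using hex
  exact absurd (M.le_level_of_subseq hα hα' hsymm h1 h2 hsol hbeta hF hφ (fun q => (hφa q).2)
    fun q => hFa _ (hφa q).2 (hφa q).1) (not_le.mpr ha1)
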